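/- **Definitions.** Let $\sigma\subset\mathbb C=\mathbb R^2$ be nonempty and compact and $f:\sigma\to\mathbb C$. For a finite list $S=[x_0,\dots,x_n]$ of points of $\sigma$ with consecutive points different, put $\operatorname{cvar}(f,S)=\sum_{i=1}^n|f(x_i)-f(x_{i-1})|$. For a line $\ell$ in the plane, the segment from $x_i$ to $x_{i+1}$ ($0\le i<n$) is a crossing segment of $S$ on $\ell$ if (1) $x_i,x_{i+1}$ lie strictly on opposite sides of $\ell$, or (2) $i=0$ and $x_i\in\ell$, or (3) $x_i\notin\ell$ and $x_{i+1}\in\ell$. Let $\operatorname{vf}(S)$ be the maximum over all lines $\ell$ of the number of crossing segments of $S$ on $\ell$ (and $\operatorname{vf}([x_0])=1$). Let $\operatorname{var}(f,\sigma)=\sup_S \operatorname{cvar}(f,S)/\operatorname{vf}(S)$, $\|f\|_{BV(\sigma)}=\|f\|_\infty+\operatorname{var}(f,\sigma)$, and $BV(\sigma)=\{f:\|f\|_{BV(\sigma)}<\infty\}$. The Banach algebra $AC(\sigma)$ is the closure in $BV(\sigma)$ of the set of restrictions to $\sigma$ of complex polynomials in the two real coordinates. Two such algebras are isomorphic, $AC(\sigma)\simeq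 AC(\tau)$, if there is an algebra isomorphism between them that is continuous with continuous inverse. A *differentiable convex curve* is a simple arc in the plane of finite length, with distinct endpoints, which has a supporting line through each of its points and whose arc-length parametrization is differentiable except possibly at the endpoints. A *polygonal mosaic* is a finite collection $\mathcal M$ of convex polygons (with their interiors) such that $\bigcup_{P\in\mathcal M}P$ is connected and, whenever $P\ne Q$ in $\mathcal M$ intersect, $P\cap Q$ is either a single point which is a vertex of both $P$ and $Q$, or a line segment which is a full side of both $P$ and $Q$. A nonempty compact connected set $\sigma\subset\mathbb C$ belongs to $\mathrm{PIC}$ if there is a polygonal mosaic $\mathcal M$ with $\sigma\subseteq\bigcup_{P\in\mathcal M}P$ such that, for each $P\in\mathcal M$, $\sigma\cap P$ is a differentiable convex curve joining two vertices of $P$ which touches the boundary of $P$ only at those two points. Let $\mathrm{UPIC}$ be the family of sets $\sigma=\sigma_1\cup\dots\cup\sigma_M$, $M\ge1$, with $\sigma_1,\dots,\sigma_M\in\mathrm{PIC}$ pairwise disjoint. **Theorem.** Let $\sigma,\tau\in\mathrm{UPIC}$. Then $AC(\sigma)\simeq AC(\tau)$ if and only if $\sigma$ is homeomorphic to $\tau$.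 -/

import Mathlib

open scoped ENNReal

noncomputable section

namespace PlanarAC

/-! ### Two-dimensional variation -/

/-- The affine function `z ↦ ⟨u, z⟩ - c`. For `u ≠ 0` its zero set is a line in the plane, every
line arises in this way, and the sign of the function says on which side of the line `z` lies. -/
def lineFun (u : ℂ) (c : ℝ) (z : ℂ) : ℝ := inner ℝ u z - c

/-- For the list `[x 0, x 1, …, x n]` and `i < n`, the segment from `x i` to `x (i + 1)` is a
crossing segment on the line `{lineFun u c = 0}`. -/
def IsCrossing (x : ℕ → ℂ) (u : ℂ) (c : ℝ) (i : ℕ) : Prop :=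
  lineFun u c (x i) * lineFun u c (x (i + 1)) < 0 ∨
  (i = 0 ∧ lineFun u c (x i) = 0) ∨
  (lineFun u c (x i) ≠ 0 ∧ lineFun u c (x (i + 1)) = 0)

open scoped Classical in
/-- The number of crossing segments of the list `[x 0, …, x n]` on the line `{lineFun u c = 0}`;
for a one-point list (`n = 0`) it is `1` if the point lies on the line and `0` otherwise. -/
def crossingCount (n : ℕ) (x : ℕ → ℂ) (u : ℂ) (c : ℝ) : ℕ :=
  if n = 0 then (if lineFun u c (x 0) = 0 then 1 else 0)
  else ((Finset.range n).filter (IsCrossing x u c)).card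

/-- The variation factor of the list `[x 0, …, x n]`: the maximal number of crossing segments
over all lines in the plane. -/
def variationFactor (n : ℕ) (x : ℕ → ℂ) : ℕ∞ :=
  ⨆ (u : ℂ) (_ : u ≠ 0) (c : ℝ), (crossingCount n x u c : ℕ∞)

/-- The curve variation of `f` on the list `[x 0, …, x n]`. -/
def curveVariation {σ : Set ℂ} (f : σ → ℂ) (n : ℕ) (x : ℕ → σ) : ℝ≥0∞ :=
  ∑ i ∈ Finset.range n, ‖f (x (i + 1)) - f (x i)‖ₑ

/-- The two-dimensional variation of `f : σ → ℂ`. The supremum is over all finite lists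
`[x 0, …, x n]` of elements of `σ` in which consecutive points are different. -/
def variation {σ : Set ℂ} (f : σ → ℂ) : ℝ≥0∞ :=
  ⨆ (n : ℕ) (x : ℕ → σ) (_ : ∀ i < n, x i ≠ x (i + 1)),
    curveVariation f n x / (variationFactor n (fun i => (x i : ℂ)) : ℝ≥0∞)

/-- The supremum norm, with values in `[0, ∞]`. -/
def supNorm {σ : Set ℂ} (f : σ → ℂ) : ℝ≥0∞ := ⨆ z, ‖f z‖ₑ

/-- The variation norm `‖f‖_∞ + var(f, σ)`, with values in `[0, ∞]`. -/
def bvNorm {σ : Set ℂ} (f : σ → ℂ) : ℝ≥0∞ := supNorm f + variation f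

section lemmas

variable {σ : Set ℂ}

theorem le_supNorm (f : σ → ℂ) (z : σ) : ‖f z‖ₑ ≤ supNorm f := le_iSup (fun z => ‖f z‖ₑ) z

theorem le_variation (f : σ → ℂ) (n : ℕ) (x : ℕ → σ) (h : ∀ i < n, x i ≠ x (i + 1)) :
    curveVariation f n x / (variationFactor n (fun i => (x i : ℂ)) : ℝ≥0∞) ≤ variation f :=
  le_iSup_of_le n (le_iSup_of_le x (le_iSup_of_le h le_rfl))

theorem supNorm_add_le (f g : σ → ℂ) : supNorm (f + g) ≤ supNorm f + supNorm g :=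
  iSup_le fun z => (enorm_add_le _ _).trans (add_le_add (le_supNorm f z) (le_supNorm g z))

theorem supNorm_mul_le (f g : σ → ℂ) : supNorm (f * g) ≤ supNorm f * supNorm g :=
  iSup_le fun z => by
    rw [Pi.mul_apply, enorm_mul]
    exact mul_le_mul' (le_supNorm f z) (le_supNorm g z)

theorem curveVariation_add_le (f g : σ → ℂ) (n : ℕ) (x : ℕ → σ) :
    curveVariation (f + g) n x ≤ curveVariation f n x + curveVariation g n x := by
  unfold curveVariation
  rw [← Finset.sum_add_distrib]
  refine Finset.sum_le_sum fun i _ => ?_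
  rw [Pi.add_apply, Pi.add_apply, add_sub_add_comm]
  exact enorm_add_le _ _

theorem curveVariation_mul_le (f g : σ → ℂ) (n : ℕ) (x : ℕ → σ) :
    curveVariation (f * g) n x ≤
      supNorm f * curveVariation g n x + supNorm g * curveVariation f n x := by
  unfold curveVariation
  rw [Finset.mul_sum, Finset.mul_sum, ← Finset.sum_add_distrib]
  refine Finset.sum_le_sum fun i _ => ?_
  have : (f * g) (x (i + 1)) - (f * g) (x i) =
      f (x (i + 1)) * (g (x (i + 1)) - g (x i)) + g (x i) * (f (x (i + 1)) - f (x i)) := by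
    simp only [Pi.mul_apply]; ring
  rw [this]
  refine (enorm_add_le _ _).trans ?_
  rw [enorm_mul, enorm_mul]
  exact add_le_add (mul_le_mul' (le_supNorm f _) le_rfl) (mul_le_mul' (le_supNorm g _) le_rfl)

theorem variation_add_le (f g : σ → ℂ) : variation (f + g) ≤ variation f + variation g := by
  refine iSup_le fun n => iSup_le fun x => iSup_le fun h => ?_
  refine (ENNReal.div_le_div_right (curveVariation_add_le f g n x) _).trans ?_
  rw [ENNReal.add_div]
  exact add_le_add (le_variation f n x h) (le_variation g n x h)

theorem variation_mul_le (f g : σ → ℂ) :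
    variation (f * g) ≤ supNorm f * variation g + supNorm g * variation f := by
  refine iSup_le fun n => iSup_le fun x => iSup_le fun h => ?_
  refine (ENNReal.div_le_div_right (curveVariation_mul_le f g n x) _).trans ?_
  rw [ENNReal.add_div, mul_div_assoc, mul_div_assoc]
  exact add_le_add (mul_le_mul' le_rfl (le_variation g n x h))
    (mul_le_mul' le_rfl (le_variation f n x h))

theorem bvNorm_add_le (f g : σ → ℂ) : bvNorm (f + g) ≤ bvNorm f + bvNorm g :=
  (add_le_add (supNorm_add_le f g) (variation_add_le f g)).trans (add_add_add_comm _ _ _ _).le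

theorem bvNorm_mul_le (f g : σ → ℂ) : bvNorm (f * g) ≤ bvNorm f * bvNorm g := by
  refine (add_le_add (supNorm_mul_le f g) (variation_mul_le f g)).trans ?_
  unfold bvNorm
  rw [add_mul, mul_add, mul_add, mul_comm (supNorm g) (variation f), add_assoc]
  gcongr
  exact le_self_add

theorem variation_const (a : ℂ) : variation (fun _ : σ => a) = 0 := by
  simp [variation, curveVariation]

theorem bvNorm_const_le (a : ℂ) : bvNorm (fun _ : σ => a) ≤ ‖a‖ₑ := by
  rw [bvNorm, variation_const, add_zero]
  exact iSup_le fun _ => le_rfl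

theorem bvNorm_neg (f : σ → ℂ) : bvNorm (-f) = bvNorm f := by
  simp only [bvNorm, supNorm, variation, curveVariation, Pi.neg_apply, enorm_neg]
  simp only [neg_sub_neg, enorm_sub_rev]

end lemmas

/-! ### The algebras `BV(σ)` and `AC(σ)` -/

/-- The functions of bounded variation on `σ`, as a subalgebra of all functions `σ → ℂ`. -/
def bvSubalgebra (σ : Set ℂ) : Subalgebra ℂ (σ → ℂ) where
  carrier := {f | bvNorm f < ∞}
  mul_mem' {f g} hf hg := (bvNorm_mul_le f g).trans_lt (ENNReal.mul_lt_top hf hg)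
  add_mem' {f g} hf hg := (bvNorm_add_le f g).trans_lt (ENNReal.add_lt_top.2 ⟨hf, hg⟩)
  algebraMap_mem' a := (bvNorm_const_le a).trans_lt enorm_lt_top

/-- The algebra `BV(σ)`. It is a type of its own, so that its topology is that of the variation
norm and not the topology of pointwise convergence. -/
def BV (σ : Set ℂ) : Type := bvSubalgebra σ

instance (σ : Set ℂ) : CommRing (BV σ) := inferInstanceAs (CommRing (bvSubalgebra σ))

instance (σ : Set ℂ) : Algebra ℂ (BV σ) := inferInstanceAs (Algebra ℂ (bvSubalgebra σ))

/-- The inclusion of `BV(σ)` in the algebra of all functions on `σ`. -/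
def BV.toFun (σ : Set ℂ) : BV σ →ₐ[ℂ] (σ → ℂ) := (bvSubalgebra σ).val

theorem BV.bvNorm_ne_top {σ : Set ℂ} (f : BV σ) : bvNorm (BV.toFun σ f) ≠ ∞ := ne_of_lt f.2

/-- The variation norm on `BV(σ)`. -/
def BV.ringNorm (σ : Set ℂ) : RingNorm (BV σ) where
  toFun f := (bvNorm (BV.toFun σ f)).toReal
  map_zero' := by
    rw [map_zero]
    have h := bvNorm_const_le (σ := σ) 0
    rw [enorm_zero, nonpos_iff_eq_zero] at h
    change (bvNorm (fun _ : σ => (0 : ℂ))).toReal = 0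
    rw [h, ENNReal.toReal_zero]
  add_le' f g := by
    rw [map_add, ← ENNReal.toReal_add f.bvNorm_ne_top g.bvNorm_ne_top]
    exact ENNReal.toReal_mono (ENNReal.add_ne_top.2 ⟨f.bvNorm_ne_top, g.bvNorm_ne_top⟩)
      (bvNorm_add_le _ _)
  neg' f := by rw [map_neg, bvNorm_neg]
  mul_le' f g := by
    rw [map_mul, ← ENNReal.toReal_mul]
    exact ENNReal.toReal_mono (ENNReal.mul_ne_top f.bvNorm_ne_top g.bvNorm_ne_top)
      (bvNorm_mul_le _ _)
  eq_zero_of_map_eq_zero' f hf := by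
    have h0 : bvNorm (BV.toFun σ f) = 0 :=
      ((ENNReal.toReal_eq_zero_iff _).1 hf).resolve_right f.bvNorm_ne_top
    refine Subtype.ext (funext fun z => ?_)
    have h1 : ‖BV.toFun σ f z‖ₑ ≤ 0 := (le_supNorm _ z).trans (le_self_add.trans h0.le)
    exact enorm_eq_zero.1 (nonpos_iff_eq_zero.1 h1)

instance (σ : Set ℂ) : NormedCommRing (BV σ) :=
  { RingNorm.toNormedRing (BV.ringNorm σ) with mul_comm := mul_comm }

theorem BV.norm_def {σ : Set ℂ} (f : BV σ) : ‖f‖ = (bvNorm (BV.toFun σ f)).toReal := rfl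

instance (σ : Set ℂ) : NormedAlgebra ℂ (BV σ) where
  norm_smul_le a f := by
    rw [BV.norm_def, BV.norm_def, map_smul, ← toReal_enorm a, ← ENNReal.toReal_mul]
    refine ENNReal.toReal_mono (ENNReal.mul_ne_top enorm_ne_top f.bvNorm_ne_top) ?_
    have h : a • BV.toFun σ f = (fun _ => a) * BV.toFun σ f := rfl
    rw [h]
    exact (bvNorm_mul_le _ _).trans (mul_le_mul' (bvNorm_const_le a) le_rfl)

/-- The restrictions to `σ` of the complex polynomials `∑ c_{nm} x ^ n y ^ m` in the two real
coordinates `x = Re z`, `y = Im z`. -/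
def polynomialFunctions (σ : Set ℂ) : Subalgebra ℂ (σ → ℂ) :=
  (MvPolynomial.aeval
    ![(fun z : σ => ((z : ℂ).re : ℂ)), (fun z : σ => ((z : ℂ).im : ℂ))] :
      MvPolynomial (Fin 2) ℂ →ₐ[ℂ] (σ → ℂ)).range

/-- The algebra `AC(σ)` of absolutely continuous functions: the closure in `BV(σ)`, for the
variation norm, of the polynomial functions. -/
def AC (σ : Set ℂ) : Subalgebra ℂ (BV σ) :=
  ((polynomialFunctions σ).comap (BV.toFun σ)).topologicalClosure

/-! ### Polygonally inscribed curves -/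

/-- A convex polygon, including its interior. Its vertices are its extreme points. -/
def IsConvexPolygon (P : Set ℂ) : Prop :=
  (interior P).Nonempty ∧ ∃ s : Set ℂ, s.Finite ∧ P = convexHull ℝ s

/-- `s` is a (full) side of the convex polygon `P`. -/
def IsSide (P s : Set ℂ) : Prop :=
  ∃ v ∈ P.extremePoints ℝ, ∃ w ∈ P.extremePoints ℝ,
    v ≠ w ∧ s = segment ℝ v w ∧ s ⊆ frontier P

/-- A (convex) polygonal mosaic in the plane. -/
structure IsPolygonalMosaic (𝓜 : Set (Set ℂ)) : Prop where
  finite : 𝓜.Finite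
  isConvexPolygon : ∀ P ∈ 𝓜, IsConvexPolygon P
  isConnected_sUnion : IsConnected (⋃₀ 𝓜)
  inter : ∀ P ∈ 𝓜, ∀ Q ∈ 𝓜, P ≠ Q → (P ∩ Q).Nonempty →
    (∃ v, v ∈ P.extremePoints ℝ ∧ v ∈ Q.extremePoints ℝ ∧ P ∩ Q = {v}) ∨
    (IsSide P (P ∩ Q) ∧ IsSide Q (P ∩ Q))

/-- `C` is a differentiable convex curve with distinct endpoints `v` and `w`: a simple arc,
parametrized by arc length, differentiable except possibly at its endpoints, with a supporting
line through each of its points. (Here `L` is the length; `v ≠ w` follows from injectivity.) -/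
def IsDiffConvexCurve (C : Set ℂ) (v w : ℂ) : Prop :=
  ∃ (L : ℝ) (γ : ℝ → ℂ), 0 < L ∧ ContinuousOn γ (Set.Icc 0 L) ∧ Set.InjOn γ (Set.Icc 0 L) ∧
    γ '' Set.Icc 0 L = C ∧ γ 0 = v ∧ γ L = w ∧
    (∀ t ∈ Set.Ioo 0 L, DifferentiableAt ℝ γ t ∧ ‖deriv γ t‖ = 1) ∧
    (∀ p ∈ C, ∃ u : ℂ, u ≠ 0 ∧ ∀ z ∈ C, inner ℝ u z ≤ inner ℝ u p)

/-- `σ` is a polygonally inscribed curve. -/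
def IsPIC (σ : Set ℂ) : Prop :=
  IsCompact σ ∧ IsConnected σ ∧ ∃ 𝓜 : Set (Set ℂ), IsPolygonalMosaic 𝓜 ∧ σ ⊆ ⋃₀ 𝓜 ∧
    ∀ P ∈ 𝓜, ∃ v ∈ P.extremePoints ℝ, ∃ w ∈ P.extremePoints ℝ,
      IsDiffConvexCurve (σ ∩ P) v w ∧ σ ∩ frontier P = {v, w}

/-- `σ` is a finite (nonempty) union of pairwise disjoint polygonally inscribed curves. -/
def IsUPIC (σ : Set ℂ) : Prop :=
  ∃ (M : ℕ) (s : Fin M → Set ℂ), 1 ≤ M ∧ (∀ m, IsPIC (s m)) ∧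
    Pairwise (fun m k => Disjoint (s m) (s k)) ∧ σ = ⋃ m, s m

end PlanarAC

end

/-!
# Isomorphism classes of algebras of absolutely continuous functions

An isomorphism of the algebras gives a homeomorphism of the sets for every pair of compact sets:
the points of `σ` are the continuous characters of `AC(σ)` (`exists_eq_eval`). If the kernel of a
character contained, for each point, a function that does not vanish there, it would contain a
strictly positive function `G`, and `H = 1 - G / max G` would have supremum norm less than `1`. As
the variation of `H ^ n` grows at most like `n * r ^ (n - 1)`, the powers of `H` tend to `0`, but
the character has the value `1` on each of them. The coordinate functions turn the bijection of
points into a homeomorphism (`nonempty_homeomorph_of_algEquiv`).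

For the converse the sets are decomposed into convex arcs, one for each polygon of the mosaics
(`ArcSystem`, `IsUPIC.exists_arcSystem`). Two arcs can meet only at vertices of their polygons, and
there the two polygons lie on different sides of a line. Each arc is locally a bi-Lipschitz graph
over some direction. The derivative of the height in this direction stays away from `0` because a
supporting line at a point with nearly vanishing derivative would cut off other points of the curve,
and by Darboux's theorem it keeps its sign (`exists_chart`).

For such a set the variation norm is equivalent to the supremum norm plus the sum of the variations
along the arcs.

* Upper bound (`ArcSystem.exists_bvNorm_le`): the jumps of a list are sorted by a compactness
  argument into long jumps and jumps between sets separated by a line, which are few in comparison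
  with the variation factor, and jumps inside one chart. In a chart each level of the
  one-dimensional variation function corresponds to a line, and integration over the levels
  (`sum_abs_sub_le`) bounds the sum of the jumps by the variation times the variation factor.
* Lower bound (`ArcSystem.exists_pathNorm_le`): a list that runs monotonically through a chart has a
  variation factor at most `5`. If a line separated four consecutive alternating points of the
  chart, no supporting line could pass through the point between the second and the third of them
  where the arc crosses the line (`IsArc.not_four_alternating`).

Consequently `AC(σ)` consists of the functions that are absolutely continuous along each arc
(`ArcSystem.mem_acFun_iff`). The essential step is that a function is in `AC(σ)` if it is Lipschitz
along the arcs and constant near their ends: it locally is a Lipschitz function of one linear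
coordinate, such functions are limits of polynomials, and membership in `AC(σ)` is a local property
(`mem_acFun_of_locally`).

Therefore the algebra depends, up to isomorphism, only on the coincidences between the arcs of a
decomposition (`ArcSystem.exists_algEquiv`). A homeomorphism need not be absolutely continuous, but
it maps a sufficiently fine subdivision of the first decomposition to a subdivision of the second
one (`ArcSystem.exists_image_subarc`), and the subdivided decompositions have the same coincidences.
-/

namespace PlanarAC

open Set Filter Topology MeasureTheory

/-! ### Counting crossings -/

theorem lineFun_add (u : ℂ) (c ε : ℝ) (z : ℂ) : lineFun u (c + ε) z = lineFun u c z - ε := by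
  unfold lineFun; ring

/-- Segments that cross a line strictly are counted by the variation factor. -/
theorem card_le_variationFactor {n : ℕ} {x : ℕ → ℂ} {u : ℂ} (hu : u ≠ 0) (c : ℝ) {I : Finset ℕ}
    (hI : I ⊆ Finset.range n)
    (h : ∀ i ∈ I, lineFun u c (x i) * lineFun u c (x (i + 1)) < 0) :
    ((I.card : ℕ∞) : ℝ≥0∞) ≤ (variationFactor n x : ℝ≥0∞) := by
  classical
  rcases Nat.eq_zero_or_pos n with rfl | hn
  · have : I = ∅ := by simpa using hI
    simp [this]
  · have h1 : I.card ≤ crossingCount n x u c := by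
      unfold crossingCount
      rw [if_neg hn.ne']
      refine Finset.card_le_card fun i hi => ?_
      rw [Finset.mem_filter]
      exact ⟨hI hi, Or.inl (h i hi)⟩
    have h2 : (crossingCount n x u c : ℕ∞) ≤ variationFactor n x :=
      le_iSup_of_le u (le_iSup_of_le hu (le_iSup_of_le c le_rfl))
    have h3 : (I.card : ℕ∞) ≤ variationFactor n x := le_trans (by exact_mod_cast h1) h2
    exact ENat.toENNReal_le.2 h3

/-- Segments whose ends lie weakly on opposite sides of a line, not both on it, are crossed
strictly by one of two nearby parallel lines. -/
theorem exists_strict_of_weak (n : ℕ) (x : ℕ → ℂ) (u : ℂ) (c : ℝ) :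
    ∃ ε > 0, ∀ i < n, lineFun u c (x i) * lineFun u c (x (i + 1)) ≤ 0 →
      ¬ (lineFun u c (x i) = 0 ∧ lineFun u c (x (i + 1)) = 0) →
      lineFun u (c + ε) (x i) * lineFun u (c + ε) (x (i + 1)) < 0 ∨
      lineFun u (c + -ε) (x i) * lineFun u (c + -ε) (x (i + 1)) < 0 := by
  classical
  have key : ∃ ε > 0, ∀ i ∈ Finset.range (n + 1), lineFun u c (x i) ≠ 0 →
      ε < |lineFun u c (x i)| := by
    induction Finset.range (n + 1) using Finset.induction_on with
    | empty => exact ⟨1, one_pos, by simp⟩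
    | insert a s _ ih =>
      obtain ⟨ε, hε, h⟩ := ih
      by_cases ha : lineFun u c (x a) = 0
      · refine ⟨ε, hε, fun i hi hne => ?_⟩
        rcases Finset.mem_insert.1 hi with rfl | hi
        · exact absurd ha hne
        · exact h i hi hne
      · have hpos : 0 < |lineFun u c (x a)| := abs_pos.2 ha
        refine ⟨min ε (|lineFun u c (x a)| / 2), lt_min hε (by positivity), fun i hi hne => ?_⟩
        rcases Finset.mem_insert.1 hi with rfl | hi
        · exact (min_le_right _ _).trans_lt (by linarith)
        · exact (min_le_left _ _).trans_lt (h i hi hne)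
  obtain ⟨ε, hε, h⟩ := key
  refine ⟨ε, hε, fun i hi hle hne => ?_⟩
  have h1 := h i (Finset.mem_range.2 (by omega))
  have h2 := h (i + 1) (Finset.mem_range.2 (by omega))
  simp only [lineFun_add]
  set p := lineFun u c (x i)
  set q := lineFun u c (x (i + 1))
  rcases lt_trichotomy p 0 with hp | hp | hp
  · right
    have h1 := h1 hp.ne
    rw [abs_of_neg hp] at h1
    have hq : 0 ≤ q := by nlinarith
    nlinarith
  · rcases lt_trichotomy q 0 with hq | hq | hq
    · right
      have h2 := h2 hq.ne
      rw [abs_of_neg hq] at h2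
      rw [hp]; nlinarith
    · exact absurd ⟨hp, hq⟩ hne
    · left
      have h2 := h2 hq.ne'
      rw [abs_of_pos hq] at h2
      rw [hp]; nlinarith
  · left
    have h1 := h1 hp.ne'
    rw [abs_of_pos hp] at h1
    have hq : q ≤ 0 := by nlinarith
    nlinarith

theorem card_le_two_mul_variationFactor {n : ℕ} {x : ℕ → ℂ} {u : ℂ} (hu : u ≠ 0) (c : ℝ)
    {I : Finset ℕ} (hI : I ⊆ Finset.range n)
    (h : ∀ i ∈ I, lineFun u c (x i) * lineFun u c (x (i + 1)) ≤ 0 ∧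
      ¬ (lineFun u c (x i) = 0 ∧ lineFun u c (x (i + 1)) = 0)) :
    ((I.card : ℕ∞) : ℝ≥0∞) ≤ 2 * (variationFactor n x : ℝ≥0∞) := by
  classical
  obtain ⟨ε, _, hε⟩ := exists_strict_of_weak n x u c
  have hsub : I ⊆ I.filter (fun i => lineFun u (c + ε) (x i) * lineFun u (c + ε) (x (i + 1)) < 0) ∪
      I.filter (fun i => lineFun u (c + -ε) (x i) * lineFun u (c + -ε) (x (i + 1)) < 0) := by
    intro i hi
    rw [Finset.mem_union, Finset.mem_filter, Finset.mem_filter]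
    rcases hε i (Finset.mem_range.1 (hI hi)) (h i hi).1 (h i hi).2 with h | h
    · exact Or.inl ⟨hi, h⟩
    · exact Or.inr ⟨hi, h⟩
  have hcard := (Finset.card_le_card hsub).trans (Finset.card_union_le _ _)
  rw [two_mul]
  refine le_trans ?_ (add_le_add
    (card_le_variationFactor (x := x) hu (c + ε) ((Finset.filter_subset _ I).trans hI)
      fun i hi => (Finset.mem_filter.1 hi).2)
    (card_le_variationFactor (x := x) hu (c + -ε) ((Finset.filter_subset _ I).trans hI)
      fun i hi => (Finset.mem_filter.1 hi).2))
  exact_mod_cast hcard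

/-- A discrete coarea inequality. The numbers `v i`, attached to the points `x i`, increase with
the height of the points in direction `u`; then each level of `v` corresponds to a line, and
integration over the levels bounds the sum of the jumps of `v`. -/
theorem sum_abs_sub_le {n : ℕ} {x : ℕ → ℂ} {u : ℂ} (hu : u ≠ 0) {I : Finset ℕ}
    (hI : I ⊆ Finset.range n) {v : ℕ → ℝ} {a b : ℝ} {N : Set ℕ}
    (hN : ∀ i ∈ I, i ∈ N ∧ i + 1 ∈ N) (hv : ∀ i ∈ N, v i ∈ Icc a b)
    (hmono : ∀ i ∈ N, ∀ j ∈ N, v i < v j → inner ℝ u (x i) < inner ℝ u (x j)) :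
    ∑ i ∈ I, ENNReal.ofReal |v (i + 1) - v i| ≤
      ENNReal.ofReal (b - a) * (variationFactor n x : ℝ≥0∞) := by
  classical
  have hterm : ∀ i ∈ I, ENNReal.ofReal |v (i + 1) - v i| =
      ∫⁻ y in Icc a b, (Ioo (min (v i) (v (i + 1))) (max (v i) (v (i + 1)))).indicator 1 y := by
    intro i hi
    have h1 := hv i (hN i hi).1
    have h2 := hv _ (hN i hi).2
    rw [lintegral_indicator_one measurableSet_Ioo, Measure.restrict_apply measurableSet_Ioo,
      inter_eq_left.2, Real.volume_Ioo, max_sub_min_eq_abs]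
    exact fun y hy => ⟨(le_min h1.1 h2.1).trans hy.1.le, hy.2.le.trans (max_le h1.2 h2.2)⟩
  rw [Finset.sum_congr rfl hterm, ← lintegral_finsetSum]
  swap
  · exact fun i _ => measurable_one.indicator measurableSet_Ioo
  have hpt : ∀ y, ∑ i ∈ I, (Ioo (min (v i) (v (i + 1))) (max (v i) (v (i + 1)))).indicator
      (1 : ℝ → ℝ≥0∞) y ≤ (variationFactor n x : ℝ≥0∞) := by
    intro y
    set I' := I.filter fun i => y ∈ Ioo (min (v i) (v (i + 1))) (max (v i) (v (i + 1)))
    have hsum : ∑ i ∈ I, (Ioo (min (v i) (v (i + 1))) (max (v i) (v (i + 1)))).indicator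
        (1 : ℝ → ℝ≥0∞) y = (I'.card : ℕ∞) := by
      simp [I', indicator_apply]
    rw [hsum]
    set nodes : Finset ℕ := (I ∪ I.image (· + 1))
    have hnodes : ∀ i ∈ nodes, i ∈ N := by
      intro i hi
      rcases Finset.mem_union.1 hi with hi | hi
      · exact (hN i hi).1
      · obtain ⟨j, hj, rfl⟩ := Finset.mem_image.1 hi
        exact (hN j hj).2
    -- a line that separates the points below the level `y` from those above it
    obtain ⟨m, hlo, hhi⟩ := Order.exists_between_finsets
      ((nodes.filter fun i => v i < y).image fun i => inner ℝ u (x i))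
      ((nodes.filter fun i => y < v i).image fun i => inner ℝ u (x i)) (by
        intro p hp q hq
        obtain ⟨i, hi, rfl⟩ := Finset.mem_image.1 hp
        obtain ⟨j, hj, rfl⟩ := Finset.mem_image.1 hq
        rw [Finset.mem_filter] at hi hj
        exact hmono i (hnodes i hi.1) j (hnodes j hj.1) (hi.2.trans hj.2))
    have hlo' : ∀ i ∈ nodes, v i < y → lineFun u m (x i) < 0 := fun i hi h =>
      sub_neg.2 (hlo _ (Finset.mem_image.2 ⟨i, Finset.mem_filter.2 ⟨hi, h⟩, rfl⟩))
    have hhi' : ∀ i ∈ nodes, y < v i → 0 < lineFun u m (x i) := fun i hi h =>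
      sub_pos.2 (hhi _ (Finset.mem_image.2 ⟨i, Finset.mem_filter.2 ⟨hi, h⟩, rfl⟩))
    refine card_le_variationFactor hu m ((Finset.filter_subset _ _).trans hI) fun i hi => ?_
    obtain ⟨hiI, hy⟩ := Finset.mem_filter.1 hi
    have hi0 : i ∈ nodes := Finset.mem_union_left _ hiI
    have hi1 : i + 1 ∈ nodes := Finset.mem_union_right _ (Finset.mem_image_of_mem _ hiI)
    rcases le_total (v i) (v (i + 1)) with h | h
    · rw [min_eq_left h, max_eq_right h] at hy
      exact mul_neg_of_neg_of_pos (hlo' _ hi0 hy.1) (hhi' _ hi1 hy.2)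
    · rw [min_eq_right h, max_eq_left h] at hy
      exact mul_neg_of_pos_of_neg (hhi' _ hi0 hy.2) (hlo' _ hi1 hy.1)
  calc _ ≤ ∫⁻ _ in Icc a b, (variationFactor n x : ℝ≥0∞) := lintegral_mono hpt
    _ = _ := by
      rw [lintegral_const, Measure.restrict_apply_univ, Real.volume_Icc, mul_comm]

/-- A function whose increments are dominated by those of `V (⟨u, z⟩)`, with `V` monotone, has
variation at most the total increment of `V`. -/
theorem variation_le_of_monotoneOn {σ : Set ℂ} {f : σ → ℂ} {u : ℂ} (hu : u ≠ 0) {V : ℝ → ℝ}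
    {a b : ℝ} (hab : a ≤ b) (hV : MonotoneOn V (Icc a b))
    (hσ : ∀ z : σ, inner ℝ u (z : ℂ) ∈ Icc a b)
    (h : ∀ z w : σ, ‖f z - f w‖ ≤ |V (inner ℝ u (z : ℂ)) - V (inner ℝ u (w : ℂ))|) :
    variation f ≤ ENNReal.ofReal (V b - V a) := by
  refine iSup_le fun n => iSup_le fun x => iSup_le fun _ => ENNReal.div_le_of_le_mul ?_
  refine le_trans (Finset.sum_le_sum fun i _ => ?_)
    (sum_abs_sub_le (x := fun i => (x i : ℂ)) hu (Finset.Subset.refl _)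
      (v := fun i => V (inner ℝ u (x i : ℂ))) (N := univ) (fun i _ => ⟨trivial, trivial⟩)
      (fun i _ => ⟨hV (left_mem_Icc.2 hab) (hσ _) (hσ _).1,
        hV (hσ _) (right_mem_Icc.2 hab) (hσ _).2⟩) ?_)
  · rw [← ofReal_norm]
    exact ENNReal.ofReal_le_ofReal (h _ _)
  · intro i _ j _ hij
    by_contra hle
    exact absurd (hV (hσ _) (hσ _) (not_lt.1 hle)) (not_le.2 hij)

theorem bvNorm_ne_top_of_monotoneOn {σ : Set ℂ} {f : σ → ℂ} {u : ℂ} (hu : u ≠ 0) {V : ℝ → ℝ}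
    {a b : ℝ} (hab : a ≤ b) (hV : MonotoneOn V (Icc a b))
    (hσ : ∀ z : σ, inner ℝ u (z : ℂ) ∈ Icc a b)
    (h : ∀ z w : σ, ‖f z - f w‖ ≤ |V (inner ℝ u (z : ℂ)) - V (inner ℝ u (w : ℂ))|)
    {B : ℝ} (hB : ∀ z, ‖f z‖ ≤ B) : bvNorm f ≠ ∞ := by
  have h1 := variation_le_of_monotoneOn hu hab hV hσ h
  have h2 : supNorm f ≤ ENNReal.ofReal B := iSup_le fun z => by
    rw [← ofReal_norm]; exact ENNReal.ofReal_le_ofReal (hB z)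
  exact (ENNReal.add_lt_top.2 ⟨h2.trans_lt ENNReal.ofReal_lt_top,
    h1.trans_lt ENNReal.ofReal_lt_top⟩).ne

/-! ### The functions in `AC(σ)` -/

/-- `AC(σ)` as an algebra of functions on `σ`. -/
noncomputable def acFun (σ : Set ℂ) : Subalgebra ℂ (σ → ℂ) := (AC σ).map (BV.toFun σ)

theorem toFun_mem_acFun {σ : Set ℂ} (F : AC σ) : BV.toFun σ F ∈ acFun σ := ⟨F, F.2, rfl⟩

theorem BV.toFun_injective (σ : Set ℂ) : Function.Injective (BV.toFun σ) :=
  fun _ _ h => Subtype.ext h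

theorem exists_BV {σ : Set ℂ} {f : σ → ℂ} (hf : bvNorm f ≠ ∞) : ∃ F : BV σ, BV.toFun σ F = f :=
  ⟨⟨f, hf.lt_top⟩, rfl⟩

theorem bvNorm_ne_top_of_mem_acFun {σ : Set ℂ} {f : σ → ℂ} (hf : f ∈ acFun σ) :
    bvNorm f ≠ ∞ := by
  obtain ⟨F, _, rfl⟩ := hf
  exact F.bvNorm_ne_top

theorem BV.dist_eq {σ : Set ℂ} (F G : BV σ) :
    dist F G = (bvNorm (BV.toFun σ F - BV.toFun σ G)).toReal := by
  rw [dist_eq_norm, BV.norm_def, map_sub]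

/-- `AC(σ)` is closed for the variation norm. -/
theorem mem_acFun_of_forall_approx {σ : Set ℂ} {f : σ → ℂ}
    (h : ∀ ε : ℝ, 0 < ε → ∃ g ∈ acFun σ, bvNorm (f - g) ≤ ENNReal.ofReal ε) : f ∈ acFun σ := by
  have hf : bvNorm f ≠ ∞ := by
    obtain ⟨g, hg, hfg⟩ := h 1 one_pos
    have := bvNorm_add_le (f - g) g
    rw [sub_add_cancel] at this
    exact (this.trans_lt (ENNReal.add_lt_top.2 ⟨hfg.trans_lt ENNReal.ofReal_lt_top,
      (bvNorm_ne_top_of_mem_acFun hg).lt_top⟩)).ne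
  obtain ⟨F, rfl⟩ := exists_BV hf
  refine ⟨F, ?_, rfl⟩
  have hcl : IsClosed (AC σ : Set (BV σ)) := Subalgebra.isClosed_topologicalClosure _
  change F ∈ (AC σ : Set (BV σ))
  rw [← hcl.closure_eq, Metric.mem_closure_iff]
  intro ε hε
  obtain ⟨g, ⟨G, hG, rfl⟩, hfg⟩ := h (ε / 2) (by linarith)
  refine ⟨G, hG, ?_⟩
  rw [BV.dist_eq]
  calc _ ≤ ε / 2 := ENNReal.toReal_le_of_le_ofReal (by linarith) hfg
    _ < ε := by linarith

theorem exists_polynomial_approx {σ : Set ℂ} {f : σ → ℂ} (hf : f ∈ acFun σ) {ε : ℝ}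
    (hε : 0 < ε) : ∃ p ∈ polynomialFunctions σ, bvNorm (f - p) ≤ ENNReal.ofReal ε := by
  obtain ⟨F, hF, rfl⟩ := hf
  have hF' : F ∈ closure ((polynomialFunctions σ).comap (BV.toFun σ) : Set (BV σ)) := hF
  obtain ⟨G, hG, hFG⟩ := Metric.mem_closure_iff.1 hF' ε hε
  refine ⟨BV.toFun σ G, hG, ?_⟩
  rw [BV.dist_eq] at hFG
  have : bvNorm (BV.toFun σ F - BV.toFun σ G) ≠ ∞ := by
    rw [← map_sub]; exact BV.bvNorm_ne_top _
  change bvNorm (BV.toFun σ F - BV.toFun σ G) ≤ _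
  rw [← ENNReal.ofReal_toReal this]
  exact ENNReal.ofReal_le_ofReal hFG.le

/-- Polynomials lie in `BV(σ)` only when their variation is finite, which is automatic on bounded
sets but has to be known before `AC(σ)` is entered. -/
theorem mem_acFun_of_polynomial {σ : Set ℂ} {f : σ → ℂ} (hf : f ∈ polynomialFunctions σ)
    (hbv : bvNorm f ≠ ∞) : f ∈ acFun σ := by
  obtain ⟨F, rfl⟩ := exists_BV hbv
  exact ⟨F, Subalgebra.le_topologicalClosure _ hf, rfl⟩

theorem re_mem_polynomialFunctions (σ : Set ℂ) :
    (fun z : σ => ((z : ℂ).re : ℂ)) ∈ polynomialFunctions σ :=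
  ⟨MvPolynomial.X 0, by simp⟩

theorem im_mem_polynomialFunctions (σ : Set ℂ) :
    (fun z : σ => ((z : ℂ).im : ℂ)) ∈ polynomialFunctions σ :=
  ⟨MvPolynomial.X 1, by simp⟩

theorem inner_eq_re_im (u z : ℂ) : inner ℝ u z = u.re * z.re + u.im * z.im := by
  rw [Complex.inner]; simp; ring

/-- The height in a fixed direction is absolutely continuous on bounded sets. -/
theorem inner_mem_acFun {σ : Set ℂ} (hσ : Bornology.IsBounded σ) (u : ℂ) :
    (fun z : σ => ((inner ℝ u (z : ℂ) : ℝ) : ℂ)) ∈ acFun σ := by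
  refine mem_acFun_of_polynomial ?_ ?_
  · have : (fun z : σ => ((inner ℝ u (z : ℂ) : ℝ) : ℂ)) =
        (u.re : ℂ) • (fun z : σ => ((z : ℂ).re : ℂ)) +
        (u.im : ℂ) • (fun z : σ => ((z : ℂ).im : ℂ)) := by
      ext z
      simp only [inner_eq_re_im]
      push_cast
      rfl
    rw [this]
    exact add_mem (Subalgebra.smul_mem _ (re_mem_polynomialFunctions σ) _)
      (Subalgebra.smul_mem _ (im_mem_polynomialFunctions σ) _)
  · rcases eq_or_ne u 0 with rfl | hu
    · have := bvNorm_const_le (σ := σ) 0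
      simp only [inner_zero_left, Complex.ofReal_zero]
      exact (this.trans_lt enorm_lt_top).ne
    · obtain ⟨R, hR⟩ := hσ.exists_norm_le
      have hb : ∀ z : σ, |inner ℝ u (z : ℂ)| ≤ ‖u‖ * |R| := fun z =>
        (abs_real_inner_le_norm u z).trans
          (mul_le_mul_of_nonneg_left ((hR z z.2).trans (le_abs_self R)) (norm_nonneg _))
      refine bvNorm_ne_top_of_monotoneOn hu (V := id) (a := -(‖u‖ * |R|)) (b := ‖u‖ * |R|)
        (by have : 0 ≤ ‖u‖ * |R| := by positivity
            linarith) (monotone_id.monotoneOn _) (fun z => abs_le.1 (hb z)) (fun z w => ?_)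
        (B := ‖u‖ * |R|) (fun z => ?_)
      · rw [← Complex.ofReal_sub, Complex.norm_real]; rfl
      · rw [Complex.norm_real]; exact hb z

theorem re_mem_acFun {σ : Set ℂ} (hσ : Bornology.IsBounded σ) :
    (fun z : σ => ((z : ℂ).re : ℂ)) ∈ acFun σ := by
  simpa [inner_eq_re_im] using inner_mem_acFun hσ 1

theorem im_mem_acFun {σ : Set ℂ} (hσ : Bornology.IsBounded σ) :
    (fun z : σ => ((z : ℂ).im : ℂ)) ∈ acFun σ := by
  simpa [inner_eq_re_im] using inner_mem_acFun hσ Complex.I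

/-! ### Characters of `AC(σ)` -/

theorem norm_toFun_le {σ : Set ℂ} (F : BV σ) (z : σ) : ‖BV.toFun σ F z‖ ≤ ‖F‖ := by
  rw [BV.norm_def, ← toReal_enorm]
  exact ENNReal.toReal_mono F.bvNorm_ne_top ((le_supNorm _ z).trans le_self_add)

theorem continuous_of_mem_acFun {σ : Set ℂ} {f : σ → ℂ} (hf : f ∈ acFun σ) : Continuous f := by
  have hpoly : ∀ p ∈ polynomialFunctions σ, Continuous p := by
    rintro _ ⟨p, rfl⟩
    change Continuous (MvPolynomial.aeval _ p)
    induction p using MvPolynomial.induction_on with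
    | C a => rw [MvPolynomial.aeval_C]; exact continuous_const
    | add p q hp hq => rw [map_add]; exact hp.add hq
    | mul_X p i hp =>
      rw [map_mul, MvPolynomial.aeval_X]
      refine hp.mul ?_
      fin_cases i
      · exact Complex.continuous_ofReal.comp (Complex.continuous_re.comp continuous_subtype_val)
      · exact Complex.continuous_ofReal.comp (Complex.continuous_im.comp continuous_subtype_val)
  refine continuous_of_uniform_approx_of_continuous fun s hs => ?_
  obtain ⟨ε, hε, hεs⟩ := Metric.mem_uniformity_dist.1 hs
  obtain ⟨p, hp, hfp⟩ := exists_polynomial_approx hf (half_pos hε)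
  refine ⟨p, hpoly p hp, fun z => hεs ?_⟩
  have h1 : ‖(f - p) z‖ₑ ≤ ENNReal.ofReal (ε / 2) :=
    ((le_supNorm _ z).trans le_self_add).trans hfp
  rw [← ofReal_norm, ENNReal.ofReal_le_ofReal_iff (by linarith)] at h1
  rw [dist_eq_norm]
  exact h1.trans_lt (by linarith)

theorem bvNorm_star {σ : Set ℂ} (f : σ → ℂ) : bvNorm (star f) = bvNorm f := by
  have h : ∀ a : ℂ, ‖star a‖ₑ = ‖a‖ₑ := fun a => by
    rw [← ofReal_norm, ← ofReal_norm, norm_star]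
  simp only [bvNorm, supNorm, variation, curveVariation, Pi.star_apply, ← star_sub, h]

theorem star_mem_acFun {σ : Set ℂ} {f : σ → ℂ} (hf : f ∈ acFun σ) : star f ∈ acFun σ := by
  have hpoly : ∀ p ∈ polynomialFunctions σ, star p ∈ polynomialFunctions σ := by
    rintro _ ⟨p, rfl⟩
    change star (MvPolynomial.aeval _ p) ∈ _
    induction p using MvPolynomial.induction_on with
    | C a =>
      rw [MvPolynomial.aeval_C]
      exact Subalgebra.algebraMap_mem (polynomialFunctions σ) (star a)
    | add p q hp hq => rw [map_add, star_add]; exact add_mem hp hq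
    | mul_X p i hp =>
      rw [map_mul, MvPolynomial.aeval_X, star_mul']
      refine mul_mem hp ?_
      fin_cases i
      · convert! re_mem_polynomialFunctions σ
        exact Complex.conj_ofReal _
      · convert! im_mem_polynomialFunctions σ
        exact Complex.conj_ofReal _
  refine mem_acFun_of_forall_approx fun ε hε => ?_
  obtain ⟨p, hp, hfp⟩ := exists_polynomial_approx hf hε
  have hb : bvNorm (star p) ≠ ∞ := by
    rw [bvNorm_star]
    have h1 := bvNorm_add_le (p - f) f
    rw [sub_add_cancel, ← neg_sub, bvNorm_neg] at h1
    exact (h1.trans_lt (ENNReal.add_lt_top.2 ⟨hfp.trans_lt ENNReal.ofReal_lt_top,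
      (bvNorm_ne_top_of_mem_acFun hf).lt_top⟩)).ne
  exact ⟨star p, mem_acFun_of_polynomial (hpoly p hp) hb, by rw [← star_sub, bvNorm_star]; exact hfp⟩

theorem supNorm_pow_le {σ : Set ℂ} (f : σ → ℂ) {r : ℝ≥0∞} (hr : supNorm f ≤ r) (n : ℕ) :
    supNorm (f ^ n) ≤ r ^ n :=
  iSup_le fun z => by
    rw [Pi.pow_apply, enorm_pow]
    exact pow_le_pow_left' ((le_supNorm f z).trans hr) n

theorem variation_pow_le {σ : Set ℂ} (f : σ → ℂ) {r : ℝ≥0∞} (hr : supNorm f ≤ r) (n : ℕ) :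
    variation (f ^ (n + 1)) ≤ (n + 1 : ℕ) * r ^ n * variation f := by
  induction n with
  | zero => simp
  | succ n ih =>
    rw [pow_succ]
    refine (variation_mul_le _ _).trans ((add_le_add (mul_le_mul' (supNorm_pow_le f hr (n + 1))
      le_rfl) (mul_le_mul' hr ih)).trans (le_of_eq ?_))
    push_cast
    ring

/-- Multiples of the powers of a function with supremum norm `< 1` tend to `0` in `BV(σ)`: the
variation of the `n`-th power grows at most like `n * r ^ (n - 1)`. -/
theorem tendsto_pow_of_norm_le {σ : Set ℂ} (F : AC σ) {r : ℝ} (hr0 : 0 ≤ r) (hr1 : r < 1)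
    (h : ∀ z, ‖BV.toFun σ F z‖ ≤ r) : Tendsto (fun n : ℕ => F ^ (n + 1)) atTop (𝓝 0) := by
  have hs : supNorm (BV.toFun σ F) ≤ ENNReal.ofReal r := iSup_le fun z => by
    rw [← ofReal_norm]; exact ENNReal.ofReal_le_ofReal (h z)
  have hv : variation (BV.toFun σ F) ≠ ∞ :=
    ne_top_of_le_ne_top (BV.bvNorm_ne_top (F : BV σ)) le_add_self
  have hbound : ∀ n : ℕ, ‖F ^ (n + 1)‖ ≤
      r ^ (n + 1) + (n * r ^ n + r ^ n) * (variation (BV.toFun σ F)).toReal := by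
    intro n
    have h1 : bvNorm (BV.toFun σ F ^ (n + 1)) ≤ ENNReal.ofReal
        (r ^ (n + 1) + (n * r ^ n + r ^ n) * (variation (BV.toFun σ F)).toReal) := by
      refine (add_le_add (supNorm_pow_le _ hs (n + 1)) (variation_pow_le _ hs n)).trans
        (le_of_eq ?_)
      rw [ENNReal.ofReal_add (by positivity) (by positivity), ENNReal.ofReal_pow hr0,
        ENNReal.ofReal_mul (by positivity), ENNReal.ofReal_toReal hv,
        ← ENNReal.ofReal_pow hr0, ← ENNReal.ofReal_pow hr0,
        show (n * r ^ n + r ^ n : ℝ) = ((n + 1 : ℕ) : ℝ) * r ^ n by push_cast; ring,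
        ENNReal.ofReal_mul (by positivity), ENNReal.ofReal_natCast]
    have h2 : ‖F ^ (n + 1)‖ = (bvNorm (BV.toFun σ F ^ (n + 1))).toReal := by
      rw [← map_pow]; rfl
    rw [h2]
    exact ENNReal.toReal_le_of_le_ofReal (by positivity) h1
  refine tendsto_zero_iff_norm_tendsto_zero.2
    (squeeze_zero (fun _ => norm_nonneg _) hbound ?_)
  have t1 : Tendsto (fun n : ℕ => r ^ n) atTop (𝓝 0) := tendsto_pow_atTop_nhds_zero_of_lt_one hr0 hr1
  have t2 : Tendsto (fun n : ℕ => (n : ℝ) * r ^ n) atTop (𝓝 0) :=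
    tendsto_self_mul_const_pow_of_lt_one hr0 hr1
  have := (t1.comp (tendsto_add_atTop_nat 1)).add
    ((t2.add t1).mul_const (variation (BV.toFun σ F)).toReal)
  simpa using this

/-- A continuous character of `AC(σ)` is the evaluation at a point of `σ`. Otherwise a sum of
functions `f * conj f` in its kernel would be strictly positive on `σ`; such a function is
invertible up to elements of small norm. -/
theorem exists_eq_eval {σ : Set ℂ} (hσ : IsCompact σ) [Nonempty σ] (χ : AC σ →ₐ[ℂ] ℂ)
    (hχ : Continuous χ) : ∃ z : σ, ∀ F : AC σ, χ F = BV.toFun σ F z := by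
  by_contra! hcon
  have : CompactSpace σ := isCompact_iff_compactSpace.1 hσ
  have key : ∃ G : AC σ, χ G = 0 ∧ ∃ ρ : σ → ℝ, (∀ z, BV.toFun σ G z = ρ z) ∧ (∀ z, 0 ≤ ρ z) ∧
      ∀ z ∈ (univ : Set σ), 0 < ρ z := by
    refine isCompact_univ.induction_on (p := fun A : Set σ => ∃ G : AC σ, χ G = 0 ∧
      ∃ ρ : σ → ℝ, (∀ z, BV.toFun σ G z = ρ z) ∧ (∀ z, 0 ≤ ρ z) ∧ ∀ z ∈ A, 0 < ρ z) ?_ ?_ ?_ ?_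
    · exact ⟨0, map_zero _, 0, fun z => by simp, fun z => le_rfl, fun z hz => hz.elim⟩
    · rintro A B hAB ⟨G, h0, ρ, h1, h2, h3⟩
      exact ⟨G, h0, ρ, h1, h2, fun z hz => h3 z (hAB hz)⟩
    · rintro A B ⟨G, h0, ρ, h1, h2, h3⟩ ⟨G', h0', ρ', h1', h2', h3'⟩
      refine ⟨G + G', (χ.map_add' G G').trans
        (by rw [← add_zero (0 : ℂ)]; exact congrArg₂ _ h0 h0'), ρ + ρ', fun z => ?_, fun z => ?_,
        fun z hz => ?_⟩
      · have : BV.toFun σ ((G + G' : AC σ) : BV σ) z = BV.toFun σ G z + BV.toFun σ G' z := by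
          rw [AddMemClass.coe_add, map_add]; rfl
        rw [this, h1, h1']; simp
      · exact add_nonneg (h2 z) (h2' z)
      · rcases hz with hz | hz
        · exact add_pos_of_pos_of_nonneg (h3 z hz) (h2' z)
        · exact add_pos_of_nonneg_of_pos (h2 z) (h3' z hz)
    · intro z _
      obtain ⟨F₀, hF₀⟩ := hcon z
      set F : AC σ := F₀ - algebraMap ℂ _ (χ F₀)
      have hF : χ F = 0 := by simp [F]
      have hFz : BV.toFun σ F z ≠ 0 := by
        have : BV.toFun σ F z = BV.toFun σ F₀ z - χ F₀ := by
          simp only [F, AddSubgroupClass.coe_sub, map_sub, Pi.sub_apply]; rfl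
        rw [this]
        exact sub_ne_zero.2 (Ne.symm hF₀)
      obtain ⟨F', hF', hF'eq⟩ := star_mem_acFun (toFun_mem_acFun F)
      have hcont : Continuous fun w => Complex.normSq (BV.toFun σ F w) :=
        Complex.continuous_normSq.comp (continuous_of_mem_acFun (toFun_mem_acFun F))
      refine ⟨{w | 0 < Complex.normSq (BV.toFun σ F w)}, ?_, F * ⟨F', hF'⟩, by
        rw [map_mul, hF, zero_mul], fun w => Complex.normSq (BV.toFun σ F w), fun w => ?_,
        fun w => Complex.normSq_nonneg _, fun w hw => hw⟩
      · rw [nhdsWithin_univ]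
        exact (isOpen_lt continuous_const hcont).mem_nhds (Complex.normSq_pos.2 hFz)
      · have : BV.toFun σ ((F * ⟨F', hF'⟩ : AC σ) : BV σ) w = BV.toFun σ F w * BV.toFun σ F' w := by
          rw [MulMemClass.coe_mul, map_mul]; rfl
        rw [this, show BV.toFun σ F' w = star (BV.toFun σ F w) from congrFun hF'eq w]
        exact Complex.mul_conj _
  obtain ⟨G, hG, ρ, hρ, -, hpos⟩ := key
  have hcont : Continuous ρ := by
    have : ρ = fun z => (BV.toFun σ G z).re := by ext z; rw [hρ]; simp
    rw [this]
    exact Complex.continuous_re.comp (continuous_of_mem_acFun (toFun_mem_acFun G))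
  obtain ⟨z₀, -, hmin⟩ := isCompact_univ.exists_isMinOn univ_nonempty hcont.continuousOn
  obtain ⟨z₁, -, hmax⟩ := isCompact_univ.exists_isMaxOn univ_nonempty hcont.continuousOn
  have hmin' : ∀ z, ρ z₀ ≤ ρ z := fun z => hmin (mem_univ z)
  have hmax' : ∀ z, ρ z ≤ ρ z₁ := fun z => hmax (mem_univ z)
  have hm := hpos z₀ trivial
  have hM := hpos z₁ trivial
  set H : AC σ := 1 - algebraMap ℂ _ ((ρ z₁ : ℂ)⁻¹) * G
  have hχH : χ H = 1 := by simp [H, hG]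
  have hHval : ∀ z, BV.toFun σ H z = ((1 - ρ z / ρ z₁ : ℝ) : ℂ) := by
    intro z
    have : BV.toFun σ H z = 1 - (ρ z₁ : ℂ)⁻¹ * BV.toFun σ G z := by
      simp only [H, AddSubgroupClass.coe_sub, map_sub, Pi.sub_apply]; rfl
    rw [this, hρ]
    push_cast
    ring
  have hlim := tendsto_pow_of_norm_le H (r := 1 - ρ z₀ / ρ z₁)
    (sub_nonneg.2 ((div_le_one hM).2 (hmax' z₀))) (by
      have := div_pos hm hM
      linarith) (fun z => by
      rw [hHval, Complex.norm_real, Real.norm_eq_abs, abs_of_nonneg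
        (sub_nonneg.2 ((div_le_one hM).2 (hmax' z)))]
      have := div_le_div_of_nonneg_right (hmin' z) hM.le
      linarith)
  have h2 := (hχ.tendsto 0).comp hlim
  have h3 : (⇑χ ∘ fun n : ℕ => H ^ (n + 1)) = fun _ => (1 : ℂ) := by
    ext n; simp [hχH]
  rw [h3, map_zero] at h2
  exact one_ne_zero (tendsto_nhds_unique tendsto_const_nhds h2)

theorem eq_of_forall_toFun_eq {σ : Set ℂ} (hσ : IsCompact σ) {z w : σ}
    (h : ∀ F : AC σ, BV.toFun σ F z = BV.toFun σ F w) : z = w := by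
  obtain ⟨X, hX, hX'⟩ := re_mem_acFun hσ.isBounded
  obtain ⟨Y, hY, hY'⟩ := im_mem_acFun hσ.isBounded
  have h1 := h ⟨X, hX⟩
  have h2 := h ⟨Y, hY⟩
  have h1' : BV.toFun σ X z = BV.toFun σ X w := h1
  have h2' : BV.toFun σ Y z = BV.toFun σ Y w := h2
  rw [show BV.toFun σ X = _ from hX'] at h1'
  rw [show BV.toFun σ Y = _ from hY'] at h2'
  exact Subtype.ext (Complex.ext (Complex.ofReal_injective h1') (Complex.ofReal_injective h2'))

/-- The map dual to an isomorphism. It is continuous because its real and imaginary parts are the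
images of the coordinate functions. -/
theorem exists_continuous_of_algEquiv {σ τ : Set ℂ} (hσ : IsCompact σ) [Nonempty σ]
    (Φ : AC σ ≃ₐ[ℂ] AC τ) (hΦ : Continuous Φ) :
    ∃ φ : τ → σ, Continuous φ ∧ ∀ (F : AC σ) (w : τ), BV.toFun τ (Φ F) w = BV.toFun σ F (φ w) := by
  have hex : ∀ w : τ, ∃ z : σ, ∀ F : AC σ, BV.toFun τ (Φ F) w = BV.toFun σ F z := by
    intro w
    set ev : AC τ →ₐ[ℂ] ℂ := (Pi.evalAlgHom ℂ (fun _ : τ => ℂ) w).comp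
      ((BV.toFun τ).comp (AC τ).val)
    have hev : Continuous ev :=
      AddMonoidHomClass.continuous_of_bound ev 1 fun F => by
        rw [one_mul]; exact norm_toFun_le (F : BV τ) w
    exact exists_eq_eval hσ (ev.comp (Φ : AC σ →ₐ[ℂ] AC τ)) (hev.comp hΦ)
  choose φ hφ using hex
  refine ⟨φ, ?_, fun F w => hφ w F⟩
  obtain ⟨X, hX, hX'⟩ := re_mem_acFun hσ.isBounded
  obtain ⟨Y, hY, hY'⟩ := im_mem_acFun hσ.isBounded
  have hre : Continuous fun w => ((φ w : ℂ).re : ℂ) := by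
    have h1 := continuous_of_mem_acFun (toFun_mem_acFun (Φ ⟨X, hX⟩))
    have h2 : BV.toFun τ (Φ ⟨X, hX⟩) = fun w => ((φ w : ℂ).re : ℂ) := by
      ext w
      rw [hφ w ⟨X, hX⟩]
      exact congrFun hX' (φ w)
    rwa [h2] at h1
  have him : Continuous fun w => ((φ w : ℂ).im : ℂ) := by
    have h1 := continuous_of_mem_acFun (toFun_mem_acFun (Φ ⟨Y, hY⟩))
    have h2 : BV.toFun τ (Φ ⟨Y, hY⟩) = fun w => ((φ w : ℂ).im : ℂ) := by
      ext w
      rw [hφ w ⟨Y, hY⟩]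
      exact congrFun hY' (φ w)
    rwa [h2] at h1
  refine Continuous.subtype_mk (f := fun w => (φ w : ℂ)) ?_ fun w => (φ w).2
  have : (fun w => (φ w : ℂ)) = fun w => ((φ w : ℂ).re : ℂ) + ((φ w : ℂ).im : ℂ) * Complex.I := by
    ext w; rw [Complex.re_add_im]
  rw [this]
  exact hre.add (him.mul continuous_const)

/-- Isomorphic algebras have homeomorphic underlying sets: the points are the continuous
characters. -/
theorem nonempty_homeomorph_of_algEquiv {σ τ : Set ℂ} (hσ : IsCompact σ) (hτ : IsCompact τ)
    (hσ₀ : σ.Nonempty) (hτ₀ : τ.Nonempty) (Φ : AC σ ≃ₐ[ℂ] AC τ) (hΦ : Continuous Φ)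
    (hΦ' : Continuous Φ.symm) : Nonempty (σ ≃ₜ τ) := by
  have := hσ₀.to_subtype
  have := hτ₀.to_subtype
  obtain ⟨φ, hφ, hφ'⟩ := exists_continuous_of_algEquiv hσ Φ hΦ
  obtain ⟨ψ, hψ, hψ'⟩ := exists_continuous_of_algEquiv hτ Φ.symm hΦ'
  refine ⟨⟨⟨ψ, φ, fun z => ?_, fun w => ?_⟩, hψ, hφ⟩⟩
  · refine eq_of_forall_toFun_eq hσ fun F => ?_
    rw [← hφ', ← hψ', AlgEquiv.symm_apply_apply]
  · refine eq_of_forall_toFun_eq hτ fun F => ?_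
    rw [← hψ', ← hφ', AlgEquiv.apply_symm_apply]

/-! ### Lipschitz functions of one linear coordinate -/

/-- Polynomials are dense in `L¹`. -/
theorem exists_polynomial_integral_abs_sub_le {g : ℝ → ℝ} {a b : ℝ} (hab : a ≤ b)
    (hg : IntervalIntegrable g volume a b) {ε : ℝ} (hε : 0 < ε) :
    ∃ q : Polynomial ℝ, ∫ t in a..b, |g t - q.eval t| ≤ ε := by
  have hg' : Integrable g (volume.restrict (Ioc a b)) :=
    (intervalIntegrable_iff_integrableOn_Ioc_of_le hab).1 hg
  obtain ⟨k, -, hk, hkc, -⟩ := hg'.exists_hasCompactSupport_integral_sub_le (half_pos hε)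
  set δ : ℝ := ε / (2 * (b - a + 1))
  have hba : 0 < b - a + 1 := by linarith
  have hδ : 0 < δ := by positivity
  obtain ⟨q, hq⟩ := exists_polynomial_near_of_continuousOn a b k hkc.continuousOn δ hδ
  refine ⟨q, ?_⟩
  have i1 : IntervalIntegrable (fun t => |g t - k t|) volume a b :=
    (hg.sub (hkc.intervalIntegrable a b)).abs
  have i2 : IntervalIntegrable (fun t => |k t - q.eval t|) volume a b :=
    ((hkc.sub q.continuous).abs).intervalIntegrable a b
  calc ∫ t in a..b, |g t - q.eval t|
      ≤ ∫ t in a..b, (|g t - k t| + |k t - q.eval t|) := by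
        refine intervalIntegral.integral_mono_on hab
          (hg.sub (q.continuous.intervalIntegrable a b)).abs (i1.add i2) fun t _ => ?_
        exact abs_sub_le _ _ _
    _ = (∫ t in a..b, |g t - k t|) + ∫ t in a..b, |k t - q.eval t| :=
        intervalIntegral.integral_add i1 i2
    _ ≤ ε / 2 + ∫ _ in a..b, δ := by
        refine add_le_add ?_ ?_
        · rw [intervalIntegral.integral_of_le hab]
          exact hk
        · refine intervalIntegral.integral_mono_on hab i2 (by simp) fun t ht => ?_
          rw [abs_sub_comm]
          exact (hq t ht).le
    _ ≤ ε := by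
        have h1 : (∫ _ in a..b, δ) = (b - a) * δ := by simp
        have h2 : (b - a + 1) * δ = ε / 2 := by simp only [δ]; field_simp
        rw [h1]
        nlinarith

theorem exists_derivative_eq (q : Polynomial ℝ) :
    ∃ P : Polynomial ℝ, Polynomial.derivative P = q := by
  induction q using Polynomial.induction_on' with
  | add p q hp hq =>
    obtain ⟨P, rfl⟩ := hp
    obtain ⟨Q, rfl⟩ := hq
    exact ⟨P + Q, Polynomial.derivative_add⟩
  | monomial n c =>
    refine ⟨Polynomial.monomial (n + 1) (c / (n + 1)), ?_⟩
    rw [Polynomial.derivative_monomial]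
    congr 1
    push_cast
    field_simp

/-- A Lipschitz function is approximated in variation by polynomials. The function `V` is the
total variation function of the difference, bounded by the integral of `|G' - P'|`. -/
theorem exists_polynomial_variation_le {G : ℝ → ℝ} {K : NNReal} (hG : LipschitzWith K G) {a b : ℝ}
    (hab : a ≤ b) {ε : ℝ} (hε : 0 < ε) :
    ∃ (P : Polynomial ℝ) (V : ℝ → ℝ), MonotoneOn V (Icc a b) ∧ V a = 0 ∧ V b ≤ ε ∧
      G a = P.eval a ∧ ∀ s ∈ Icc a b, ∀ t ∈ Icc a b,
        |(G s - P.eval s) - (G t - P.eval t)| ≤ |V s - V t| := by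
  have hac : ∀ s t, AbsolutelyContinuousOnInterval G s t := fun s t =>
    hG.lipschitzOnWith.absolutelyContinuousOnInterval
  have hint : ∀ s t, IntervalIntegrable (deriv G) volume s t := fun s t =>
    (hac s t).intervalIntegrable_deriv
  obtain ⟨q, hq⟩ := exists_polynomial_integral_abs_sub_le hab (hint a b) hε
  obtain ⟨P₀, rfl⟩ := exists_derivative_eq q
  set q := Polynomial.derivative P₀
  set P : Polynomial ℝ := P₀ + Polynomial.C (G a - P₀.eval a)
  have hintq : ∀ s t, IntervalIntegrable (fun x => deriv G x - q.eval x) volume s t := fun s t =>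
    (hint s t).sub (q.continuous.intervalIntegrable s t)
  set V : ℝ → ℝ := fun t => ∫ x in a..t, |deriv G x - q.eval x|
  have hV : ∀ s t, V t - V s = ∫ x in s..t, |deriv G x - q.eval x| := fun s t =>
    intervalIntegral.integral_interval_sub_left (hintq a t).abs (hintq a s).abs
  have hmono : Monotone V := fun s t hst => by
    rw [← sub_nonneg, hV]
    exact intervalIntegral.integral_nonneg hst fun _ _ => abs_nonneg _
  refine ⟨P, V, hmono.monotoneOn _, by simp [V], hq, by simp [P], ?_⟩
  have key : ∀ s t, s ≤ t → |(G t - P.eval t) - (G s - P.eval s)| ≤ V t - V s := by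
    intro s t hst
    have h1 : ∫ x in s..t, (deriv G x - q.eval x) = (G t - P.eval t) - (G s - P.eval s) := by
      rw [intervalIntegral.integral_sub (hint s t) (q.continuous.intervalIntegrable s t),
        (hac s t).integral_deriv_eq_sub,
        intervalIntegral.integral_eq_sub_of_hasDerivAt (f := fun x => P.eval x)
          (fun x _ => ?_) (q.continuous.intervalIntegrable s t)]
      · ring
      · have : q = Polynomial.derivative P := by simp [P, q]
        rw [this]
        exact P.hasDerivAt x
    rw [← h1, hV]
    exact intervalIntegral.abs_integral_le_integral_abs hst
  intro s _ t _
  rcases le_total s t with h | h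
  · rw [abs_sub_comm, abs_sub_comm (V s)]
    exact (key s t h).trans (le_abs_self _)
  · exact (key t s h).trans (le_abs_self _)

theorem polynomial_comp_mem_acFun {σ : Set ℂ} {h : σ → ℝ}
    (hh : (fun z => (h z : ℂ)) ∈ acFun σ) (P : Polynomial ℝ) :
    (fun z => ((P.eval (h z) : ℝ) : ℂ)) ∈ acFun σ := by
  induction P using Polynomial.induction_on' with
  | add p q hp hq =>
    have := add_mem hp hq
    convert! this using 1
    funext z
    simp
  | monomial n c =>
    have := Subalgebra.smul_mem _ (pow_mem hh n) (c : ℂ)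
    convert! this using 1
    funext z
    simp

theorem isBounded_heights {σ : Set ℂ} (hσ : Bornology.IsBounded σ) (u : ℂ) :
    ∃ a b : ℝ, a ≤ b ∧ ∀ z : σ, inner ℝ u (z : ℂ) ∈ Icc a b := by
  obtain ⟨R, hR⟩ := hσ.exists_norm_le
  have h0 : 0 ≤ ‖u‖ * |R| := by positivity
  refine ⟨-(‖u‖ * |R|), ‖u‖ * |R|, by linarith, fun z => abs_le.1 ?_⟩
  exact (abs_real_inner_le_norm u z).trans
    (mul_le_mul_of_nonneg_left ((hR z z.2).trans (le_abs_self R)) (norm_nonneg _))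

/-- Along a single direction the two-dimensional variation is at most the one-dimensional one, so an
approximation of `G` by polynomials in one-dimensional variation approximates its composition with
the height function. -/
theorem lipschitz_comp_inner_mem_acFun {σ : Set ℂ} (hσ : Bornology.IsBounded σ) (u : ℂ)
    {G : ℝ → ℝ} {K : NNReal} (hG : LipschitzWith K G) :
    (fun z : σ => ((G (inner ℝ u (z : ℂ)) : ℝ) : ℂ)) ∈ acFun σ := by
  rcases eq_or_ne u 0 with rfl | hu
  · simp only [inner_zero_left]
    exact Subalgebra.algebraMap_mem (acFun σ) (G 0 : ℂ)
  obtain ⟨a, b, hab, hz⟩ := isBounded_heights hσ u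
  refine mem_acFun_of_forall_approx fun ε hε => ?_
  obtain ⟨P, V, hV, hVa, hVb, ha, hGP⟩ := exists_polynomial_variation_le hG hab (half_pos hε)
  refine ⟨_, polynomial_comp_mem_acFun (inner_mem_acFun hσ u) P, ?_⟩
  have hsplit : ENNReal.ofReal ε = ENNReal.ofReal (ε / 2) + ENNReal.ofReal (ε / 2) := by
    rw [← ENNReal.ofReal_add (by linarith) (by linarith), add_halves]
  rw [hsplit]
  have hle : ENNReal.ofReal (V b - V a) ≤ ENNReal.ofReal (ε / 2) :=
    ENNReal.ofReal_le_ofReal (by linarith)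
  refine add_le_add (iSup_le fun z => le_trans ?_ hle)
    ((variation_le_of_monotoneOn hu hab hV hz fun z w => ?_).trans hle)
  · rw [← ofReal_norm]
    refine ENNReal.ofReal_le_ofReal ?_
    simp only [Pi.sub_apply]
    rw [← Complex.ofReal_sub, Complex.norm_real, Real.norm_eq_abs]
    have h1 := hGP _ (hz z) a (left_mem_Icc.2 hab)
    rw [ha, sub_self, sub_zero] at h1
    refine h1.trans ?_
    rw [abs_of_nonneg (sub_nonneg.2 (hV (left_mem_Icc.2 hab) (hz z) (hz z).1))]
    exact sub_le_sub_right (hV (hz z) (right_mem_Icc.2 hab) (hz z).2) _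
  · simp only [Pi.sub_apply]
    rw [← Complex.ofReal_sub, ← Complex.ofReal_sub, ← Complex.ofReal_sub, Complex.norm_real]
    exact hGP _ (hz z) _ (hz w)

theorem lipschitz_complex_comp_inner_mem_acFun {σ : Set ℂ} (hσ : Bornology.IsBounded σ) (u : ℂ)
    {G : ℝ → ℂ} {K : NNReal} (hG : LipschitzWith K G) :
    (fun z : σ => G (inner ℝ u (z : ℂ))) ∈ acFun σ := by
  have hre : LipschitzWith K fun t => (G t).re := LipschitzWith.of_dist_le_mul fun s t => by
    rw [Real.dist_eq, ← Complex.sub_re]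
    exact (Complex.abs_re_le_norm _).trans ((dist_eq_norm _ _).symm.le.trans (hG.dist_le_mul s t))
  have him : LipschitzWith K fun t => (G t).im := LipschitzWith.of_dist_le_mul fun s t => by
    rw [Real.dist_eq, ← Complex.sub_im]
    exact (Complex.abs_im_le_norm _).trans ((dist_eq_norm _ _).symm.le.trans (hG.dist_le_mul s t))
  have := add_mem (lipschitz_comp_inner_mem_acFun hσ u hre)
    (Subalgebra.smul_mem _ (lipschitz_comp_inner_mem_acFun hσ u him) Complex.I)
  convert! this using 1
  funext z
  simp only [Pi.add_apply, Pi.smul_apply, smul_eq_mul]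
  rw [mul_comm, Complex.re_add_im]

/-! ### Localization -/

theorem exists_tent (x₀ : ℝ) {r : ℝ} (hr : 0 < r) : ∃ (T : ℝ → ℝ) (K : NNReal), LipschitzWith K T ∧
    (∀ x, |x - x₀| ≤ r → T x = 1) ∧ ∀ x, T x ≠ 0 → |x - x₀| < 2 * r := by
  have h1 : LipschitzWith 1 fun x : ℝ => dist x x₀ := LipschitzWith.dist_left x₀
  have h2 : LipschitzWith (Real.nnabs r⁻¹) fun x : ℝ => 2 - dist x x₀ / r :=
    LipschitzWith.of_dist_le_mul fun x y => by
      have := h1.dist_le_mul x y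
      rw [Real.dist_eq] at this ⊢
      rw [show 2 - dist x x₀ / r - (2 - dist y x₀ / r) = -(r⁻¹ * (dist x x₀ - dist y x₀)) by
        field_simp; ring, abs_neg, abs_mul, Real.coe_nnabs]
      simp only [NNReal.coe_one, one_mul] at this
      exact mul_le_mul_of_nonneg_left this (abs_nonneg _)
  refine ⟨_, _, (h2.const_min 1).const_max 0, fun x hx => ?_, fun x hx => ?_⟩
  · rw [← Real.dist_eq] at hx
    have := (div_le_one hr).2 hx
    rw [min_eq_left (by linarith), max_eq_right zero_le_one]
  · by_contra hle
    rw [not_lt, ← Real.dist_eq] at hle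
    have := (le_div_iff₀ hr).2 hle
    exact hx (max_eq_left ((min_le_right _ _).trans (by linarith)))

/-- A product of two tents, one in each coordinate. -/
theorem exists_bump {σ : Set ℂ} (hσ : Bornology.IsBounded σ) (z : σ) {s : Set σ} (hs : s ∈ 𝓝 z) :
    ∃ B ∈ acFun σ, (∀ᶠ w in 𝓝 z, B w = 1) ∧ ∀ w, w ∉ s → B w = 0 := by
  obtain ⟨ε, hε, hball⟩ := Metric.mem_nhds_iff.1 hs
  obtain ⟨T, K, hT, hT1, hT0⟩ := exists_tent (z : ℂ).re (r := ε / 4) (by linarith)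
  obtain ⟨T', K', hT', hT1', hT0'⟩ := exists_tent (z : ℂ).im (r := ε / 4) (by linarith)
  have hB1 := lipschitz_comp_inner_mem_acFun hσ 1 hT
  have hB2 := lipschitz_comp_inner_mem_acFun hσ Complex.I hT'
  refine ⟨_, mul_mem hB1 hB2, ?_, fun w hw => ?_⟩
  · filter_upwards [Metric.ball_mem_nhds z (show (0 : ℝ) < ε / 4 by linarith)] with w hw
    have hw : ‖(w : ℂ) - z‖ < ε / 4 := by rw [← dist_eq_norm]; exact hw
    have h1 := (Complex.abs_re_le_norm ((w : ℂ) - z)).trans hw.le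
    have h2 := (Complex.abs_im_le_norm ((w : ℂ) - z)).trans hw.le
    rw [Complex.sub_re] at h1
    rw [Complex.sub_im] at h2
    simp [hT1 _ h1, hT1' _ h2]
  · by_contra hne
    apply hw
    simp only [Pi.mul_apply, mul_ne_zero_iff, ne_eq, Complex.ofReal_eq_zero, inner_eq_re_im,
      Complex.one_re, Complex.one_im, Complex.I_re, Complex.I_im, zero_mul, one_mul, add_zero,
      zero_add] at hne
    have h1 := hT0 _ hne.1
    have h2 := hT0' _ hne.2
    apply hball
    rw [Metric.mem_ball, Subtype.dist_eq, dist_eq_norm]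
    refine (Complex.norm_le_abs_re_add_abs_im _).trans_lt ?_
    rw [Complex.sub_re, Complex.sub_im]
    linarith

/-- A function that locally agrees with functions in `AC(σ)` belongs to `AC(σ)`, by a partition
of unity. -/
theorem mem_acFun_of_locally {σ : Set ℂ} (hσ : IsCompact σ) {g : σ → ℂ}
    (h : ∀ z : σ, ∃ F ∈ acFun σ, ∀ᶠ w in 𝓝 z, g w = F w) : g ∈ acFun σ := by
  have : CompactSpace σ := isCompact_iff_compactSpace.1 hσ
  -- sets `A` with a function `B` that equals `1` on `A` and satisfies `g * B ∈ AC(σ)` form an ideal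
  have key : ∃ B ∈ acFun σ, (∀ w ∈ (univ : Set σ), B w = 1) ∧ g * B ∈ acFun σ := by
    refine isCompact_univ.induction_on
      (p := fun A : Set σ => ∃ B ∈ acFun σ, (∀ w ∈ A, B w = 1) ∧ g * B ∈ acFun σ) ?_ ?_ ?_ ?_
    · exact ⟨0, zero_mem _, fun w hw => hw.elim, by rw [mul_zero]; exact zero_mem _⟩
    · rintro A A' hA ⟨B, hB, h1, h2⟩
      exact ⟨B, hB, fun w hw => h1 w (hA hw), h2⟩
    · rintro A A' ⟨B, hB, h1, h2⟩ ⟨B', hB', h1', h2'⟩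
      refine ⟨B + B' - B * B', sub_mem (add_mem hB hB') (mul_mem hB hB'), fun w hw => ?_, ?_⟩
      · simp only [Pi.sub_apply, Pi.add_apply, Pi.mul_apply]
        rcases hw with hw | hw
        · rw [h1 w hw]; ring
        · rw [h1' w hw]; ring
      · rw [show g * (B + B' - B * B') = g * B + g * B' - g * B * B' by ring]
        exact sub_mem (add_mem h2 h2') (mul_mem h2 hB')
    · intro z _
      obtain ⟨F, hF, hgF⟩ := h z
      obtain ⟨B, hB, hB1, hB0⟩ := exists_bump hσ.isBounded z hgF
      refine ⟨{w | B w = 1}, by rw [nhdsWithin_univ]; exact hB1, B, hB, fun w hw => hw, ?_⟩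
      have : g * B = F * B := by
        funext w
        by_cases hw : g w = F w
        · rw [Pi.mul_apply, Pi.mul_apply, hw]
        · rw [Pi.mul_apply, Pi.mul_apply, hB0 w hw, mul_zero, mul_zero]
      rw [this]
      exact mul_mem hF hB
  obtain ⟨B, -, hB1, hgB⟩ := key
  have : g * B = g := by
    funext w
    rw [Pi.mul_apply, hB1 w trivial, mul_one]
  rwa [this] at hgB

/-! ### Systems of arcs -/

/-- The properties of a convex arc, parametrized by `[0, 1]`, on which the comparison of variations
rests. They do not involve derivatives, and they pass to affinely reparametrized subarcs.
`chart` says that near each parameter the arc is a bi-Lipschitz graph over some direction `u`. -/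
structure IsArc {σ : Set ℂ} (α : ℝ → σ) : Prop where
  lipschitz : ∃ K, LipschitzOnWith K α (Icc 0 1)
  injOn : InjOn α (Icc 0 1)
  chart : ∀ t₀ ∈ Icc (0 : ℝ) 1, ∃ u : ℂ, ∃ c > 0, ∃ δ > 0, ∀ s ∈ Icc (0 : ℝ) 1,
    ∀ t ∈ Icc (0 : ℝ) 1, |s - t₀| < δ → |t - t₀| < δ → s ≤ t →
      c * (t - s) ≤ inner ℝ u (α t : ℂ) - inner ℝ u (α s : ℂ)
  support : ∀ t ∈ Icc (0 : ℝ) 1, ∃ u : ℂ, u ≠ 0 ∧ ∀ s ∈ Icc (0 : ℝ) 1,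
    inner ℝ u (α s : ℂ) ≤ inner ℝ u (α t : ℂ)

/-- A finite decomposition of `σ` into arcs that meet only at their ends. Where two arcs meet, some
line through the common point separates them locally and contains no other point of them. -/
structure ArcSystem {σ : Set ℂ} {J : Type*} (α : J → ℝ → σ) : Prop where
  arc : ∀ j, IsArc (α j)
  cover : ∀ z : σ, ∃ j, ∃ t ∈ Icc (0 : ℝ) 1, α j t = z
  meet : ∀ j k, j ≠ k → ∀ s ∈ Icc (0 : ℝ) 1, ∀ t ∈ Icc (0 : ℝ) 1, α j s = α k t →
    (s = 0 ∨ s = 1) ∧ (t = 0 ∨ t = 1)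
  sep : ∀ j k, j ≠ k → ∀ s ∈ Icc (0 : ℝ) 1, ∀ t ∈ Icc (0 : ℝ) 1, α j s = α k t →
    ∃ u : ℂ, u ≠ 0 ∧ ∃ c : ℝ, lineFun u c (α j s) = 0 ∧
      (∀ᶠ s' in 𝓝[Icc 0 1] s, s' ≠ s → lineFun u c (α j s') < 0) ∧
      ∀ᶠ t' in 𝓝[Icc 0 1] t, t' ≠ t → 0 < lineFun u c (α k t')

theorem IsArc.continuousOn {σ : Set ℂ} {α : ℝ → σ} (h : IsArc α) : ContinuousOn α (Icc 0 1) := by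
  obtain ⟨K, hK⟩ := h.lipschitz
  exact hK.continuousOn

theorem ArcSystem.isCompact {σ : Set ℂ} {J : Type*} [Finite J] {α : J → ℝ → σ}
    (h : ArcSystem α) : IsCompact σ := by
  have h1 : σ = ⋃ j, (fun t => (α j t : ℂ)) '' Icc 0 1 := by
    ext z
    simp only [mem_iUnion, mem_image]
    constructor
    · intro hz
      obtain ⟨j, t, ht, hjt⟩ := h.cover ⟨z, hz⟩
      exact ⟨j, t, ht, by rw [hjt]⟩
    · rintro ⟨j, t, -, rfl⟩
      exact (α j t).2
  rw [h1]
  exact isCompact_iUnion fun j => isCompact_Icc.image_of_continuousOn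
    (continuous_subtype_val.comp_continuousOn (h.arc j).continuousOn)

/-- The norm that a system of arcs gives: supremum norm plus the variations along the arcs. -/
noncomputable def pathNorm {σ : Set ℂ} {J : Type*} [Fintype J] (α : J → ℝ → σ) (f : σ → ℂ) :
    ℝ≥0∞ :=
  supNorm f + ∑ j, eVariationOn (fun t => f (α j t)) (Icc 0 1)

theorem eVariationOn_le_pathNorm {σ : Set ℂ} {J : Type*} [Fintype J] (α : J → ℝ → σ) (f : σ → ℂ)
    (j : J) : eVariationOn (fun t => f (α j t)) (Icc 0 1) ≤ pathNorm α f :=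
  (Finset.single_le_sum (f := fun j => eVariationOn (fun t => f (α j t)) (Icc 0 1))
    (fun _ _ => zero_le) (Finset.mem_univ j)).trans le_add_self

/-! ### The variation norm is bounded by the norm along the arcs -/

theorem one_le_variationFactor (n : ℕ) (x : ℕ → ℂ) : (1 : ℝ≥0∞) ≤ variationFactor n x := by
  classical
  have h0 : lineFun 1 (inner ℝ (1 : ℂ) (x 0)) (x 0) = 0 := sub_self _
  have h1 : 1 ≤ crossingCount n x 1 (inner ℝ (1 : ℂ) (x 0)) := by
    unfold crossingCount
    split_ifs with hn
    · exact le_rfl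
    · refine Finset.card_pos.2 ⟨0, Finset.mem_filter.2 ⟨Finset.mem_range.2 (by omega), ?_⟩⟩
      exact Or.inr (Or.inl ⟨rfl, h0⟩)
  have h2 : (crossingCount n x 1 (inner ℝ (1 : ℂ) (x 0)) : ℕ∞) ≤ variationFactor n x :=
    le_iSup_of_le 1 (le_iSup_of_le one_ne_zero (le_iSup_of_le _ le_rfl))
  have h3 : ((1 : ℕ) : ℕ∞) ≤ variationFactor n x := le_trans (by exact_mod_cast h1) h2
  have h4 := ENat.toENNReal_le.2 h3
  simpa using h4

/-- The jumps from `z` to `w` with `(z, w) ∈ W` contribute to the curve variation of a function on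
a list at most a multiple of the variation factor times the norm along the arcs. -/
def JumpBound {σ : Set ℂ} {J : Type*} [Fintype J] (α : J → ℝ → σ) (W : Set (σ × σ)) : Prop :=
  ∃ C : ℝ≥0∞, C ≠ ∞ ∧ ∀ (f : σ → ℂ) (n : ℕ) (x : ℕ → σ), (∀ i < n, x i ≠ x (i + 1)) →
    ∀ I ⊆ Finset.range n, (∀ i ∈ I, (x i, x (i + 1)) ∈ W) →
      ∑ i ∈ I, ‖f (x (i + 1)) - f (x i)‖ₑ ≤
        C * pathNorm α f * (variationFactor n (fun i => (x i : ℂ)) : ℝ≥0∞)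

section JumpBound

variable {σ : Set ℂ} {J : Type*} [Fintype J] {α : J → ℝ → σ}

theorem JumpBound.mono {W W' : Set (σ × σ)} (h : JumpBound α W') (hW : W ⊆ W') :
    JumpBound α W := by
  obtain ⟨C, hC, h⟩ := h
  exact ⟨C, hC, fun f n x hx I hI hIW => h f n x hx I hI fun i hi => hW (hIW i hi)⟩

theorem JumpBound.empty : JumpBound α (∅ : Set (σ × σ)) :=
  ⟨0, ENNReal.zero_ne_top, fun f n x _ I _ hIW => by
    have : I = ∅ := Finset.eq_empty_of_forall_notMem fun i hi => hIW i hi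
    simp [this]⟩

theorem JumpBound.union {W W' : Set (σ × σ)} (h : JumpBound α W) (h' : JumpBound α W') :
    JumpBound α (W ∪ W') := by
  classical
  obtain ⟨C, hC, h⟩ := h
  obtain ⟨C', hC', h'⟩ := h'
  refine ⟨C + C', ENNReal.add_ne_top.2 ⟨hC, hC'⟩, fun f n x hx I hI hIW => ?_⟩
  rw [← Finset.sum_filter_add_sum_filter_not I (fun i => (x i, x (i + 1)) ∈ W), add_mul, add_mul]
  refine add_le_add (h f n x hx _ ((Finset.filter_subset _ _).trans hI) fun i hi =>
    (Finset.mem_filter.1 hi).2) (h' f n x hx _ ((Finset.filter_subset _ _).trans hI) fun i hi => ?_)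
  obtain ⟨hi, hn⟩ := Finset.mem_filter.1 hi
  exact (hIW i hi).resolve_left hn

theorem JumpBound.iUnion {ι : Type*} [Finite ι] {W : ι → Set (σ × σ)}
    (h : ∀ i, JumpBound α (W i)) : JumpBound α (⋃ i, W i) := by
  classical
  have := Fintype.ofFinite ι
  have key : ∀ s : Finset ι, JumpBound α (⋃ i ∈ s, W i) := by
    intro s
    induction s using Finset.induction_on with
    | empty => simpa using JumpBound.empty
    | insert a s _ ih =>
      rw [Finset.set_biUnion_insert]
      exact (h a).union ih
  simpa using key Finset.univ

theorem enorm_sub_le_two_mul_pathNorm (f : σ → ℂ) (z w : σ) : ‖f z - f w‖ₑ ≤ 2 * pathNorm α f := by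
  have h : ∀ z, ‖f z‖ₑ ≤ pathNorm α f := fun z => (le_supNorm f z).trans le_self_add
  rw [sub_eq_add_neg, two_mul]
  refine (enorm_add_le _ _).trans (add_le_add (h z) ?_)
  rw [enorm_neg]
  exact h w

/-- Jumps whose number is a bounded multiple of the variation factor are harmless, since each of them
is at most twice the supremum norm. -/
theorem jumpBound_of_card {W : Set (σ × σ)} {C : ℝ≥0∞} (hC : C ≠ ∞)
    (h : ∀ (n : ℕ) (x : ℕ → σ), (∀ i < n, x i ≠ x (i + 1)) →
      ∀ I ⊆ Finset.range n, (∀ i ∈ I, (x i, x (i + 1)) ∈ W) →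
        ((I.card : ℕ∞) : ℝ≥0∞) ≤ C * (variationFactor n (fun i => (x i : ℂ)) : ℝ≥0∞)) :
    JumpBound α W := by
  refine ⟨2 * C, ENNReal.mul_ne_top (by simp) hC, fun f n x hx I hI hIW => ?_⟩
  refine (Finset.sum_le_sum fun i _ => enorm_sub_le_two_mul_pathNorm (α := α) f _ _).trans ?_
  rw [Finset.sum_const, nsmul_eq_mul]
  have := h n x hx I hI hIW
  calc (I.card : ℝ≥0∞) * (2 * pathNorm α f)
      ≤ (C * (variationFactor n (fun i => (x i : ℂ)) : ℝ≥0∞)) * (2 * pathNorm α f) :=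
        mul_le_mul' (by simpa using this) le_rfl
    _ = _ := by ring

/-- Long jumps are few, because the coordinates have bounded variation. -/
theorem jumpBound_of_dist (hσ : Bornology.IsBounded σ) {W : Set (σ × σ)} {d : ℝ} (hd : 0 < d)
    (hW : ∀ p ∈ W, d ≤ dist p.1 p.2) : JumpBound α W := by
  obtain ⟨a, b, -, hab⟩ := isBounded_heights hσ 1
  obtain ⟨a', b', -, hab'⟩ := isBounded_heights hσ Complex.I
  refine jumpBound_of_card (C := (ENNReal.ofReal d)⁻¹ * (ENNReal.ofReal (b - a) +
    ENNReal.ofReal (b' - a'))) (ENNReal.mul_ne_top (ENNReal.inv_ne_top.2 (by simpa using hd))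
      (by simp)) fun n x hx I hI hIW => ?_
  have h1 := sum_abs_sub_le (x := fun i => (x i : ℂ)) one_ne_zero hI
    (v := fun i => inner ℝ 1 (x i : ℂ)) (N := univ) (fun _ _ => ⟨trivial, trivial⟩)
    (fun i _ => hab (x i)) fun _ _ _ _ h => h
  have h2 := sum_abs_sub_le (x := fun i => (x i : ℂ)) Complex.I_ne_zero hI
    (v := fun i => inner ℝ Complex.I (x i : ℂ)) (N := univ) (fun _ _ => ⟨trivial, trivial⟩)
    (fun i _ => hab' (x i)) fun _ _ _ _ h => h
  have h3 := add_le_add h1 h2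
  rw [← Finset.sum_add_distrib, ← add_mul] at h3
  have h4 : ((I.card : ℕ∞) : ℝ≥0∞) * ENNReal.ofReal d ≤ (ENNReal.ofReal (b - a) +
      ENNReal.ofReal (b' - a')) * (variationFactor n (fun i => (x i : ℂ)) : ℝ≥0∞) := by
    refine le_trans ?_ h3
    rw [ENat.toENNReal_coe, ← nsmul_eq_mul, ← Finset.sum_const]
    refine Finset.sum_le_sum fun i hi => ?_
    rw [← ENNReal.ofReal_add (abs_nonneg _) (abs_nonneg _)]
    refine ENNReal.ofReal_le_ofReal ((hW _ (hIW i hi)).trans ?_)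
    rw [dist_comm, Subtype.dist_eq, dist_eq_norm]
    refine (Complex.norm_le_abs_re_add_abs_im _).trans (le_of_eq ?_)
    simp
  rw [mul_assoc, ← ENNReal.div_eq_inv_mul]
  exact (ENNReal.le_div_iff_mul_le (Or.inl (by simpa using hd))
    (Or.inl ENNReal.ofReal_ne_top)).2 h4

/-- The variation function of a function of bounded variation on `[0, 1]`. -/
theorem exists_monotoneOn_dominating {g : ℝ → ℂ} (hg : eVariationOn g (Icc 0 1) ≠ ∞) :
    ∃ V : ℝ → ℝ, MonotoneOn V (Icc 0 1) ∧
      (∀ s ∈ Icc (0 : ℝ) 1, V s ∈ Icc 0 (eVariationOn g (Icc 0 1)).toReal) ∧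
      ∀ s ∈ Icc (0 : ℝ) 1, ∀ t ∈ Icc (0 : ℝ) 1, ‖g s - g t‖ ≤ |V s - V t| := by
  have hfin : ∀ t ∈ Icc (0 : ℝ) 1, eVariationOn g (Icc 0 t) ≠ ∞ := fun t ht =>
    ne_top_of_le_ne_top hg (eVariationOn.mono g (Icc_subset_Icc_right ht.2))
  have key : ∀ s ∈ Icc (0 : ℝ) 1, ∀ t ∈ Icc (0 : ℝ) 1, s ≤ t → ‖g s - g t‖ ≤
      (eVariationOn g (Icc 0 t)).toReal - (eVariationOn g (Icc 0 s)).toReal := by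
    intro s hs t ht hst
    have h1 := eVariationOn.Icc_add_Icc g hs.1 hst (mem_univ s)
    simp only [univ_inter] at h1
    have h2 : eVariationOn g (Icc s t) ≠ ∞ :=
      ne_top_of_le_ne_top hg (eVariationOn.mono g (Icc_subset_Icc hs.1 ht.2))
    rw [← h1, ENNReal.toReal_add (hfin s hs) h2, add_sub_cancel_left, ← dist_eq_norm,
      dist_edist]
    exact ENNReal.toReal_mono h2 (eVariationOn.edist_le g (left_mem_Icc.2 hst)
      (right_mem_Icc.2 hst))
  refine ⟨fun t => (eVariationOn g (Icc 0 t)).toReal, fun s hs t ht hst =>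
    sub_nonneg.1 ((norm_nonneg _).trans (key s hs t ht hst)), fun s hs =>
    ⟨ENNReal.toReal_nonneg, ENNReal.toReal_mono hg
      (eVariationOn.mono g (Icc_subset_Icc_right hs.2))⟩, fun s hs t ht => ?_⟩
  rcases le_total s t with h | h
  · rw [abs_sub_comm]
    exact (key s hs t ht h).trans (le_abs_self _)
  · rw [norm_sub_rev]
    exact (key t ht s hs h).trans (le_abs_self _)

/-- On a part of an arc that is a graph over some direction, the jumps of a function are controlled
by its variation along the arc. -/
theorem jumpBound_of_chart (j : J) {S : Set ℝ} (hS : S ⊆ Icc 0 1) {u : ℂ}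
    (hu : StrictMonoOn (fun t => inner ℝ u (α j t : ℂ)) S) :
    JumpBound α ((α j '' S) ×ˢ (α j '' S)) := by
  classical
  rcases S.subsingleton_or_nontrivial with hsub | ⟨p, hp, q, hq, hpq⟩
  · refine jumpBound_of_card ENNReal.zero_ne_top fun n x hx I hI hIW => ?_
    have : I = ∅ := Finset.eq_empty_of_forall_notMem fun i hi => by
      obtain ⟨⟨s, hs, h1⟩, ⟨t, ht, h2⟩⟩ := hIW i hi
      exact hx i (Finset.mem_range.1 (hI hi)) (h1.symm.trans ((congrArg (α j) (hsub hs ht)).trans h2))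
    simp [this]
  have hu0 : u ≠ 0 := by
    rintro rfl
    rcases lt_or_gt_of_ne hpq with h | h
    · simpa using hu hp hq h
    · simpa using hu hq hp h
  refine ⟨1, ENNReal.one_ne_top, fun f n x hx I hI hIW => ?_⟩
  rw [one_mul]
  by_cases hf : eVariationOn (fun t => f (α j t)) (Icc 0 1) = ∞
  · have h1 := eVariationOn_le_pathNorm α f j
    rw [hf, top_le_iff] at h1
    have h2 := one_le_variationFactor n (fun i => (x i : ℂ))
    rw [h1, ENNReal.top_mul (by intro h; rw [h] at h2; exact absurd h2 (by simp))]
    exact le_top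
  obtain ⟨V, hV, hVb, hVf⟩ := exists_monotoneOn_dominating hf
  have hex : ∀ i, ∃ s, x i ∈ α j '' S → s ∈ S ∧ α j s = x i := by
    intro i
    by_cases h : x i ∈ α j '' S
    · obtain ⟨s, hs, hsx⟩ := h
      exact ⟨s, fun _ => ⟨hs, hsx⟩⟩
    · exact ⟨0, fun h' => absurd h' h⟩
  choose s hs using hex
  have h1 := sum_abs_sub_le (x := fun i => (x i : ℂ)) hu0 hI (v := fun i => V (s i))
    (N := {i | x i ∈ α j '' S}) (fun i hi => hIW i hi) (fun i hi => hVb _ (hS (hs i hi).1)) ?_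
  · refine le_trans (Finset.sum_le_sum fun i hi => ?_) (h1.trans (mul_le_mul' ?_ le_rfl))
    · obtain ⟨a1, a2⟩ := hs i (hIW i hi).1
      obtain ⟨b1, b2⟩ := hs (i + 1) (hIW i hi).2
      rw [← ofReal_norm, ← a2, ← b2]
      exact ENNReal.ofReal_le_ofReal (hVf _ (hS b1) _ (hS a1))
    · rw [sub_zero, ENNReal.ofReal_toReal hf]
      exact eVariationOn_le_pathNorm α f j
  · intro i hi k hk hik
    obtain ⟨a1, a2⟩ := hs i hi
    obtain ⟨b1, b2⟩ := hs k hk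
    have hlt : s i < s k := by
      by_contra hle
      exact absurd (hV (hS b1) (hS a1) (not_lt.1 hle)) (not_le.2 hik)
    have := hu a1 b1 hlt
    simpa only [a2, b2] using this

/-- Jumps between two sets that a line separates, except for one common point on it, are few. -/
theorem jumpBound_of_separated {A B : Set σ} {u : ℂ} (hu : u ≠ 0) {c : ℝ} {p : σ}
    (hp : lineFun u c p = 0) (hA : ∀ z ∈ A, z ≠ p → lineFun u c z < 0)
    (hB : ∀ z ∈ B, z ≠ p → 0 < lineFun u c z) : JumpBound α (A ×ˢ B) := by
  refine jumpBound_of_card (C := 2) (by simp) fun n x hx I hI hIW =>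
    card_le_two_mul_variationFactor hu c hI fun i hi => ?_
  have hne := hx i (Finset.mem_range.1 (hI hi))
  obtain ⟨h1, h2⟩ := hIW i hi
  by_cases ha : x i = p
  · have hb := hB _ h2 (by rw [← ha]; exact hne.symm)
    simp only [ha, hp, zero_mul, le_refl, true_and]
    exact hb.ne'
  · have ha' := hA _ h1 ha
    refine ⟨?_, fun h => ha'.ne h.1⟩
    by_cases hb : x (i + 1) = p
    · simp only [hb, hp, mul_zero, le_refl]
    · exact (mul_neg_of_neg_of_pos ha' (hB _ h2 hb)).le

end JumpBound

/-- By compactness it is enough to bound the jumps between small pieces of two arcs. The pieces are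
far apart, or belong to a chart of one arc, or are separated by a line through a common end. -/
theorem ArcSystem.jumpBound_univ {σ : Set ℂ} {J : Type*} [Fintype J] {α : J → ℝ → σ}
    (h : ArcSystem α) : JumpBound α univ := by
  have hpair : ∀ j k, JumpBound α ((fun q : ℝ × ℝ => (α j q.1, α k q.2)) ''
      (Icc 0 1 ×ˢ Icc 0 1)) := by
    intro j k
    have hK : IsCompact (Icc (0 : ℝ) 1 ×ˢ Icc (0 : ℝ) 1) := isCompact_Icc.prod isCompact_Icc
    have key := hK.induction_on (p := fun A => JumpBound α
      ((fun q : ℝ × ℝ => (α j q.1, α k q.2)) '' (A ∩ (Icc 0 1 ×ˢ Icc 0 1)))) ?_ ?_ ?_ ?_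
    · rwa [inter_self] at key
    · simpa using JumpBound.empty
    · intro A A' hA hb
      exact hb.mono (image_mono (inter_subset_inter_left _ hA))
    · intro A A' hb hb'
      rw [union_inter_distrib_right, image_union]
      exact hb.union hb'
    · rintro ⟨s, t⟩ ⟨hs, ht⟩
      change s ∈ Icc (0 : ℝ) 1 at hs
      change t ∈ Icc (0 : ℝ) 1 at ht
      by_cases hst : α j s = α k t
      -- coincident points: the same parameter of one arc, or the ends of two arcs
      · by_cases hjk : j = k
        · subst hjk
          obtain rfl := (h.arc j).injOn hs ht hst
          obtain ⟨u, c, hc, δ, hδ, hchart⟩ := (h.arc j).chart s hs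
          refine ⟨Metric.ball s δ ×ˢ Metric.ball s δ, mem_nhdsWithin_of_mem_nhds
            (prod_mem_nhds (Metric.ball_mem_nhds _ hδ) (Metric.ball_mem_nhds _ hδ)), ?_⟩
          refine (jumpBound_of_chart j (S := Metric.ball s δ ∩ Icc 0 1) inter_subset_right
            (u := u) ?_).mono ?_
          · intro a ha b hb hab
            have h1 := hchart a ha.2 b hb.2 ha.1 hb.1 hab.le
            have h2 := mul_pos hc (sub_pos.2 hab)
            simp only
            linarith
          · rintro _ ⟨q, hq, rfl⟩
            exact ⟨⟨q.1, ⟨hq.1.1, hq.2.1⟩, rfl⟩, ⟨q.2, ⟨hq.1.2, hq.2.2⟩, rfl⟩⟩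
        · obtain ⟨u, hu, c, h0, h1, h2⟩ := h.sep j k hjk s hs t ht hst
          refine ⟨_, ?_, (jumpBound_of_separated (A := α j '' {s' | s' ≠ s → lineFun u c (α j s') < 0})
            (B := α k '' {t' | t' ≠ t → 0 < lineFun u c (α k t')}) hu h0 ?_ ?_).mono
            (W := (fun q : ℝ × ℝ => (α j q.1, α k q.2)) ''
              (({s' | s' ≠ s → lineFun u c (α j s') < 0} ×ˢ
              {t' | t' ≠ t → 0 < lineFun u c (α k t')}) ∩ (Icc 0 1 ×ˢ Icc 0 1))) ?_⟩
          · rw [nhdsWithin_prod_eq]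
            exact prod_mem_prod h1 h2
          · rintro _ ⟨s', hs', rfl⟩ hne
            exact hs' fun h => hne (by rw [h])
          · rintro _ ⟨t', ht', rfl⟩ hne
            exact ht' fun h => hne (by rw [h, hst])
          · rintro _ ⟨q, hq, rfl⟩
            exact ⟨⟨q.1, hq.1.1, rfl⟩, ⟨q.2, hq.1.2, rfl⟩⟩
      -- different points: nearby jumps are long
      · have hpos : 0 < dist (α j s) (α k t) := dist_pos.2 hst
        have hcont : ContinuousWithinAt (fun q : ℝ × ℝ => dist (α j q.1) (α k q.2))
            (Icc 0 1 ×ˢ Icc 0 1) (s, t) := by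
          refine Filter.Tendsto.dist (f := fun q : ℝ × ℝ => α j q.1) (g := fun q : ℝ × ℝ => α k q.2)
            ?_ ?_
          · exact ContinuousWithinAt.comp (t := Icc 0 1) (x := ((s, t) : ℝ × ℝ))
              ((h.arc j).continuousOn s hs) continuousWithinAt_fst fun q hq => hq.1
          · exact ContinuousWithinAt.comp (t := Icc 0 1) (x := ((s, t) : ℝ × ℝ))
              ((h.arc k).continuousOn t ht) continuousWithinAt_snd fun q hq => hq.2
        have hev := hcont.eventually (lt_mem_nhds (half_lt_self hpos))
        refine ⟨_, hev, jumpBound_of_dist h.isCompact.isBounded (half_pos hpos) ?_⟩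
        rintro _ ⟨q, hq, rfl⟩
        exact le_of_lt hq.1
  have hall : JumpBound α (⋃ p : J × J, (fun q : ℝ × ℝ => (α p.1 q.1, α p.2 q.2)) ''
      (Icc 0 1 ×ˢ Icc 0 1)) := JumpBound.iUnion fun p => hpair p.1 p.2
  refine hall.mono fun ⟨z, w⟩ _ => ?_
  obtain ⟨j, s, hs, rfl⟩ := h.cover z
  obtain ⟨k, t, ht, rfl⟩ := h.cover w
  exact mem_iUnion.2 ⟨(j, k), (s, t), ⟨hs, ht⟩, rfl⟩

/-- The norm along the arcs dominates the variation norm. -/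
theorem ArcSystem.exists_bvNorm_le {σ : Set ℂ} {J : Type*} [Fintype J] {α : J → ℝ → σ}
    (h : ArcSystem α) : ∃ C : ℝ≥0∞, C ≠ ∞ ∧ ∀ f, bvNorm f ≤ C * pathNorm α f := by
  obtain ⟨C, hC, hb⟩ := h.jumpBound_univ
  refine ⟨1 + C, ENNReal.add_ne_top.2 ⟨ENNReal.one_ne_top, hC⟩, fun f => ?_⟩
  rw [add_mul, one_mul]
  refine add_le_add le_self_add (iSup_le fun n => iSup_le fun x => iSup_le fun hx =>
    ENNReal.div_le_of_le_mul ?_)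
  exact hb f n x hx _ (Finset.Subset.refl _) fun _ _ => mem_univ _

/-! ### Variation along an arc is bounded by the two-dimensional variation -/

/-- In the coordinates `X`, `H` the four points lie one in each open quadrant, and no nonzero linear
functional is nonpositive on such points. -/
theorem eq_zero_of_four_quadrants {A B X₁ X₂ X₃ X₄ H₁ H₂ H₃ H₄ : ℝ} (hX₁ : X₁ < 0) (hX₂ : X₂ < 0)
    (hX₃ : 0 < X₃) (hX₄ : 0 < X₄) (h₁₂ : H₁ * H₂ < 0) (h₂₃ : H₂ * H₃ < 0) (h₃₄ : H₃ * H₄ < 0)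
    (h₁ : A * X₁ + B * H₁ ≤ 0) (h₂ : A * X₂ + B * H₂ ≤ 0) (h₃ : A * X₃ + B * H₃ ≤ 0)
    (h₄ : A * X₄ + B * H₄ ≤ 0) : A = 0 ∧ B = 0 := by
  have aux : ∀ {X H : ℝ}, X ≠ 0 → H ≠ 0 → 0 ≤ A * X → 0 ≤ B * H → A * X + B * H ≤ 0 →
      A = 0 ∧ B = 0 := fun hX hH h1 h2 h3 =>
    ⟨(mul_eq_zero.1 (show A * _ = 0 by linarith)).resolve_right hX,
      (mul_eq_zero.1 (show B * _ = 0 by linarith)).resolve_right hH⟩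
  rcases mul_neg_iff.1 h₁₂ with ⟨p1, p2⟩ | ⟨p1, p2⟩
  · have p3 : 0 < H₃ := by nlinarith
    have p4 : H₄ < 0 := by nlinarith
    rcases le_total 0 A with hA | hA <;> rcases le_total 0 B with hB | hB
    · exact aux hX₃.ne' p3.ne' (by positivity) (by positivity) h₃
    · exact aux hX₄.ne' p4.ne (by positivity) (mul_nonneg_of_nonpos_of_nonpos hB p4.le) h₄
    · exact aux hX₁.ne p1.ne' (mul_nonneg_of_nonpos_of_nonpos hA hX₁.le) (by positivity) h₁
    · exact aux hX₂.ne p2.ne (mul_nonneg_of_nonpos_of_nonpos hA hX₂.le)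
        (mul_nonneg_of_nonpos_of_nonpos hB p2.le) h₂
  · have p3 : H₃ < 0 := by nlinarith
    have p4 : 0 < H₄ := by nlinarith
    rcases le_total 0 A with hA | hA <;> rcases le_total 0 B with hB | hB
    · exact aux hX₄.ne' p4.ne' (by positivity) (by positivity) h₄
    · exact aux hX₃.ne' p3.ne (by positivity) (mul_nonneg_of_nonpos_of_nonpos hB p3.le) h₃
    · exact aux hX₂.ne p2.ne' (mul_nonneg_of_nonpos_of_nonpos hA hX₂.le) (by positivity) h₂
    · exact aux hX₁.ne p1.ne (mul_nonneg_of_nonpos_of_nonpos hA hX₁.le)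
        (mul_nonneg_of_nonpos_of_nonpos hB p1.le) h₁

/-- A part of a convex arc that is a graph over some direction changes sides of a line at most
twice. Otherwise the point where it crosses the line between the second and the third of four
alternating points would be interior to the convex hull of these four points. -/
theorem IsArc.not_four_alternating {σ : Set ℂ} {α : ℝ → σ} (hα : IsArc α) {S : Set ℝ}
    (hS : S ⊆ Icc 0 1) (hSc : S.OrdConnected) {u : ℂ}
    (hu : StrictMonoOn (fun t => inner ℝ u (α t : ℂ)) S) {w : ℂ} {c : ℝ} {t₁ t₂ t₃ t₄ : ℝ}
    (m₁ : t₁ ∈ S) (m₂ : t₂ ∈ S) (m₃ : t₃ ∈ S) (m₄ : t₄ ∈ S)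
    (h₁₂ : t₁ < t₂) (h₂₃ : t₂ < t₃) (h₃₄ : t₃ < t₄)
    (s₁₂ : lineFun w c (α t₁) * lineFun w c (α t₂) < 0)
    (s₂₃ : lineFun w c (α t₂) * lineFun w c (α t₃) < 0)
    (s₃₄ : lineFun w c (α t₃) * lineFun w c (α t₄) < 0) : False := by
  have hcont : ContinuousOn (fun t => lineFun w c (α t)) (uIcc t₂ t₃) := by
    refine ContinuousOn.sub (ContinuousOn.inner (𝕜 := ℝ) continuousOn_const ?_) continuousOn_const
    exact continuous_subtype_val.comp_continuousOn
      (hα.continuousOn.mono ((hSc.uIcc_subset m₂ m₃).trans hS))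
  have h0 : (0 : ℝ) ∈ uIcc (lineFun w c (α t₂)) (lineFun w c (α t₃)) := by
    rcases mul_neg_iff.1 s₂₃ with ⟨h, h'⟩ | ⟨h, h'⟩
    · exact mem_uIcc.2 (Or.inr ⟨h'.le, h.le⟩)
    · exact mem_uIcc.2 (Or.inl ⟨h.le, h'.le⟩)
  obtain ⟨t, ht, ht0⟩ := intermediate_value_uIcc hcont h0
  rw [uIcc_of_le h₂₃.le] at ht
  have ht2 : t₂ < t := lt_of_le_of_ne ht.1 fun h => by
    rw [h] at s₂₃
    simp only at ht0
    rw [ht0, zero_mul] at s₂₃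
    exact lt_irrefl _ s₂₃
  have ht3 : t < t₃ := lt_of_le_of_ne ht.2 fun h => by
    rw [← h] at s₂₃
    simp only at ht0
    rw [ht0, mul_zero] at s₂₃
    exact lt_irrefl _ s₂₃
  have mt : t ∈ S := hSc.out m₂ m₃ ht
  obtain ⟨N, hN, hsupp⟩ := hα.support t (hS mt)
  have a1 := hu m₁ mt (h₁₂.trans ht2)
  have a2 := hu m₂ mt ht2
  have a3 := hu mt m₃ ht3
  have a4 := hu mt m₄ (ht3.trans h₃₄)
  have b1 := hsupp t₁ (hS m₁)
  have b2 := hsupp t₂ (hS m₂)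
  have b3 := hsupp t₃ (hS m₃)
  have b4 := hsupp t₄ (hS m₄)
  simp only [lineFun, inner_eq_re_im] at *
  set D := u.re * w.im - u.im * w.re with hD
  -- if the line is parallel to the level lines of `u`, then heights and sides agree
  rcases eq_or_ne D 0 with hD0 | hD0
  · set p := (α t₁ : ℂ)
    set q := (α t₂ : ℂ)
    set z := (α t : ℂ)
    have e1 : w.re * p.re + w.im * p.im - c = w.re * (p.re - z.re) + w.im * (p.im - z.im) := by
      linarith
    have e2 : w.re * q.re + w.im * q.im - c = w.re * (q.re - z.re) + w.im * (q.im - z.im) := by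
      linarith
    rw [e1, e2] at s₁₂
    have hdet : (u.re * (p.re - z.re) + u.im * (p.im - z.im)) *
        (w.re * (q.re - z.re) + w.im * (q.im - z.im)) =
        (u.re * (q.re - z.re) + u.im * (q.im - z.im)) *
        (w.re * (p.re - z.re) + w.im * (p.im - z.im)) := by
      linear_combination ((p.re - z.re) * (q.im - z.im) - (p.im - z.im) * (q.re - z.re)) * hD0
    have c1 : u.re * (p.re - z.re) + u.im * (p.im - z.im) < 0 := by linarith
    have c2 : u.re * (q.re - z.re) + u.im * (q.im - z.im) < 0 := by linarith
    rcases mul_neg_iff.1 s₁₂ with ⟨h, h'⟩ | ⟨h, h'⟩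
    · have := mul_pos_of_neg_of_neg c1 h'
      have := mul_neg_of_neg_of_pos c2 h
      linarith
    · have := mul_neg_of_neg_of_pos c1 h'
      have := mul_pos_of_neg_of_neg c2 h
      linarith
  -- otherwise the outer normal `N` is the combination `A * u + B * w`
  · set A := (N.re * w.im - N.im * w.re) / D with hA
    set B := (u.re * N.im - u.im * N.re) / D with hB
    have hNre : N.re = A * u.re + B * w.re := by
      rw [hA, hB]; field_simp; rw [hD]; ring
    have hNim : N.im = A * u.im + B * w.im := by
      rw [hA, hB]; field_simp; rw [hD]; ring
    rw [hNre, hNim] at b1 b2 b3 b4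
    clear_value A B D
    have hAB : A = 0 ∧ B = 0 :=
      eq_zero_of_four_quadrants (sub_neg.2 a1) (sub_neg.2 a2) (sub_pos.2 a3)
        (sub_pos.2 a4) s₁₂ s₂₃ s₃₄ (by linear_combination b1 + B * ht0)
        (by linear_combination b2 + B * ht0) (by linear_combination b3 + B * ht0)
        (by linear_combination b4 + B * ht0)
    apply hN
    refine Complex.ext ?_ ?_
    · rw [hNre, hAB.1, hAB.2]; simp
    · rw [hNim, hAB.1, hAB.2]; simp

/-- A sequence without four terms of alternating signs changes its sign strictly at most twice
between consecutive terms. -/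
theorem card_le_two_of_not_alternating {H : ℕ → ℝ} {n : ℕ} {I : Finset ℕ} (hI : I ⊆ Finset.range n)
    (hneg : ∀ i ∈ I, H i * H (i + 1) < 0)
    (hH : ∀ a b c d, a < b → b < c → c < d → d ≤ n → H a * H b < 0 → H b * H c < 0 →
      H c * H d < 0 → False) : I.card ≤ 2 := by
  by_contra hcard
  rw [not_le] at hcard
  set f := I.orderEmbOfFin rfl
  set i := f ⟨0, by omega⟩
  set j := f ⟨1, by omega⟩
  set k := f ⟨2, by omega⟩
  have hij : i < j := f.strictMono (by simp [Fin.lt_def])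
  have hjk : j < k := f.strictMono (by simp [Fin.lt_def])
  have hi := hneg i (I.orderEmbOfFin_mem rfl _)
  have hj := hneg j (I.orderEmbOfFin_mem rfl _)
  have hk := hneg k (I.orderEmbOfFin_mem rfl _)
  have hkn : k < n := Finset.mem_range.1 (hI (I.orderEmbOfFin_mem rfl _))
  have hne : ∀ {a b : ℝ}, a * b < 0 → a ≠ 0 ∧ b ≠ 0 := fun h =>
    ⟨fun h0 => by rw [h0, zero_mul] at h; exact lt_irrefl _ h,
      fun h0 => by rw [h0, mul_zero] at h; exact lt_irrefl _ h⟩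
  have same : ∀ {a b c : ℝ}, a * b < 0 → 0 < b * c → a * c < 0 := fun {a b c} h h' => by
    have h2 : (a * c) * (b * b) < 0 := by
      have := mul_neg_of_neg_of_pos h h'
      linarith
    exact neg_of_mul_neg_left h2 (mul_self_nonneg b)
  rcases lt_or_gt_of_ne (mul_ne_zero (hne hi).2 (hne hj).1) with h1 | h1
  · have hlt : i + 1 < j := lt_of_le_of_ne hij fun h => by
      rw [← h] at h1
      exact absurd h1 (not_lt.2 (mul_self_nonneg _))
    exact hH i (i + 1) j (j + 1) (by omega) hlt (by omega) (by omega) hi h1 hj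
  · have hij' : H i * H j < 0 := same hi h1
    rcases lt_or_gt_of_ne (mul_ne_zero (hne hj).2 (hne hk).1) with h2 | h2
    · have hlt : j + 1 < k := lt_of_le_of_ne hjk fun h => by
        rw [← h] at h2
        exact absurd h2 (not_lt.2 (mul_self_nonneg _))
      exact hH i j (j + 1) k hij (by omega) hlt (by omega) hij' hj h2
    · have h3 : H (j + 1) * H (k + 1) < 0 := by
        rw [mul_comm]
        refine same (b := H k) (by rw [mul_comm]; exact hk) (by rw [mul_comm]; exact h2)
      exact hH i j (j + 1) (k + 1) hij (by omega) (by omega) (by omega) hij' hj h3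

/-- A list that runs monotonically through a chart has a bounded variation factor: at most two
strict crossings on each of two parallel lines near a given one, and the first segment. -/
theorem IsArc.variationFactor_le {σ : Set ℂ} {α : ℝ → σ} (hα : IsArc α) {S : Set ℝ}
    (hS : S ⊆ Icc 0 1) (hSc : S.OrdConnected) {u : ℂ}
    (hu : StrictMonoOn (fun t => inner ℝ u (α t : ℂ)) S) {n : ℕ} {s : ℕ → ℝ}
    (hs : StrictMonoOn s (Iic n)) (hsS : ∀ i ∈ Iic n, s i ∈ S) :
    variationFactor n (fun i => (α (s i) : ℂ)) ≤ 5 := by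
  classical
  refine iSup_le fun w => iSup_le fun hw => iSup_le fun c => ?_
  have hstrict : ∀ (c : ℝ) (I : Finset ℕ), I ⊆ Finset.range n →
      (∀ i ∈ I, lineFun w c (α (s i)) * lineFun w c (α (s (i + 1))) < 0) → I.card ≤ 2 := by
    intro c I hI hneg
    refine card_le_two_of_not_alternating hI (H := fun i => lineFun w c (α (s i))) hneg ?_
    intro a b d e hab hbd hde hen h1 h2 h3
    have he : e ∈ Iic n := hen
    have hd : d ∈ Iic n := (hde.trans_le hen).le
    have hb : b ∈ Iic n := (hbd.trans (hde.trans_le hen)).le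
    have ha : a ∈ Iic n := (hab.trans (hbd.trans (hde.trans_le hen))).le
    exact hα.not_four_alternating hS hSc hu (hsS a ha) (hsS b hb) (hsS d hd) (hsS e he)
      (hs ha hb hab) (hs hb hd hbd) (hs hd he hde) h1 h2 h3
  have hmain : crossingCount n (fun i => (α (s i) : ℂ)) w c ≤ 5 := by
    unfold crossingCount
    split_ifs with h0 h1
    · norm_num
    · norm_num
    · obtain ⟨ε, -, hε⟩ := exists_strict_of_weak n (fun i => (α (s i) : ℂ)) w c
      set F : ℝ → Finset ℕ := fun c' => (Finset.range n).filter fun i =>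
        lineFun w c' (α (s i)) * lineFun w c' (α (s (i + 1))) < 0
      have hF : ∀ c', (F c').card ≤ 2 := fun c' =>
        hstrict c' _ (Finset.filter_subset _ _) fun i hi => (Finset.mem_filter.1 hi).2
      have hsub : (Finset.range n).filter (IsCrossing (fun i => (α (s i) : ℂ)) w c) ⊆
          {0} ∪ (F (c + ε) ∪ F (c + -ε)) := by
        intro i hi
        obtain ⟨hin, hcr⟩ := Finset.mem_filter.1 hi
        have hweak : i = 0 ∨ (lineFun w c (α (s i)) * lineFun w c (α (s (i + 1))) ≤ 0 ∧
            ¬ (lineFun w c (α (s i)) = 0 ∧ lineFun w c (α (s (i + 1))) = 0)) := by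
          rcases hcr with h | h | h
          · exact Or.inr ⟨h.le, fun h' => by simp only [h'.1, zero_mul, lt_irrefl] at h⟩
          · exact Or.inl h.1
          · exact Or.inr ⟨by rw [h.2, mul_zero], fun h' => h.1 h'.1⟩
        simp only [Finset.mem_union, Finset.mem_singleton, F, Finset.mem_filter]
        rcases hweak with h | h
        · exact Or.inl h
        · rcases hε i (Finset.mem_range.1 hin) h.1 h.2 with h' | h'
          · exact Or.inr (Or.inl ⟨hin, h'⟩)
          · exact Or.inr (Or.inr ⟨hin, h'⟩)
      have h1 := Finset.card_le_card hsub
      have h2 := Finset.card_union_le {0} (F (c + ε) ∪ F (c + -ε))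
      have h3 := Finset.card_union_le (F (c + ε)) (F (c + -ε))
      have h4 := hF (c + ε)
      have h5 := hF (c + -ε)
      rw [Finset.card_singleton] at h2
      omega
  exact_mod_cast hmain

/-- Monotone lists in a chart bound the one-dimensional variation by the two-dimensional one. -/
theorem IsArc.eVariationOn_chart_le {σ : Set ℂ} {α : ℝ → σ} (hα : IsArc α) {S : Set ℝ}
    (hS : S ⊆ Icc 0 1) (hSc : S.OrdConnected) {u : ℂ}
    (hu : StrictMonoOn (fun t => inner ℝ u (α t : ℂ)) S) (f : σ → ℂ) :
    eVariationOn (fun t => f (α t)) S ≤ 5 * variation f := by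
  rw [eVariationOn.eVariationOn_eq_strictMonoOn]
  refine iSup_le ?_
  rintro ⟨n, s, hs, hsS⟩
  have hvf := hα.variationFactor_le hS hSc hu hs hsS
  have hvf' : (variationFactor n (fun i => (α (s i) : ℂ)) : ℝ≥0∞) ≤ 5 := by
    simpa using ENat.toENNReal_le.2 hvf
  have h1 := le_variation f n (fun i => α (s i)) fun i hi heq => by
    have hi0 : i ∈ Iic n := le_of_lt hi
    have hi1 : i + 1 ∈ Iic n := Nat.succ_le_of_lt hi
    exact (hs hi0 hi1 (Nat.lt_succ_self i)).ne (hα.injOn (hS (hsS i hi0)) (hS (hsS _ hi1)) heq)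
  have h2 := one_le_variationFactor n (fun i => (α (s i) : ℂ))
  rw [ENNReal.div_le_iff (fun h => by rw [h] at h2; exact absurd h2 (by simp))
    (ne_top_of_le_ne_top (by simp) hvf'), mul_comm] at h1
  refine le_trans (le_of_eq ?_) (h1.trans (mul_le_mul' hvf' le_rfl))
  refine Finset.sum_congr rfl fun i _ => ?_
  rw [edist_eq_enorm_sub]

theorem eVariationOn_uIcc_le (g : ℝ → ℂ) (a b c : ℝ) :
    eVariationOn g (uIcc a c) ≤ eVariationOn g (uIcc a b) + eVariationOn g (uIcc b c) := by
  have key : ∀ a b c : ℝ, a ≤ c →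
      eVariationOn g (uIcc a c) ≤ eVariationOn g (uIcc a b) + eVariationOn g (uIcc b c) := by
    intro a b c hac
    rw [uIcc_of_le hac]
    rcases le_total b a with h | h
    · refine (eVariationOn.mono g ?_).trans le_add_self
      rw [uIcc_of_le (h.trans hac)]
      exact Icc_subset_Icc_left h
    rcases le_total c b with h' | h'
    · refine (eVariationOn.mono g ?_).trans le_self_add
      rw [uIcc_of_le (hac.trans h')]
      exact Icc_subset_Icc_right h'
    · rw [uIcc_of_le h, uIcc_of_le h']
      have := eVariationOn.Icc_add_Icc g h h' (mem_univ b)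
      simp only [univ_inter] at this
      exact this.ge
  rcases le_total a c with h | h
  · exact key a b c h
  · have := key c b a h
    rwa [uIcc_comm, add_comm, uIcc_comm c b, uIcc_comm b a] at this

/-- The bounds in the charts add up along the arc, by connectedness of the parameter interval. -/
theorem IsArc.exists_eVariationOn_le {σ : Set ℂ} {α : ℝ → σ} (hα : IsArc α) :
    ∃ C : ℝ≥0∞, C ≠ ∞ ∧ ∀ f : σ → ℂ, eVariationOn (fun t => f (α t)) (Icc 0 1) ≤
      C * variation f := by
  have key := isPreconnected_Icc.induction₂ (s := Icc (0 : ℝ) 1) (fun s t : ℝ => ∃ C : ℝ≥0∞, C ≠ ∞ ∧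
    ∀ f : σ → ℂ, eVariationOn (fun t => f (α t)) (uIcc s t) ≤ C * variation f)
    ?_ ?_ ?_ (left_mem_Icc.2 zero_le_one) (right_mem_Icc.2 zero_le_one)
  · rwa [uIcc_of_le zero_le_one] at key
  · intro t₀ ht₀
    obtain ⟨u, c, hc, δ, hδ, hchart⟩ := hα.chart t₀ ht₀
    filter_upwards [self_mem_nhdsWithin, mem_nhdsWithin_of_mem_nhds (Metric.ball_mem_nhds t₀ hδ)]
      with t ht htδ
    have hoc : (Icc 0 1 ∩ Metric.ball t₀ δ).OrdConnected := by
      rw [Real.ball_eq_Ioo]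
      exact ordConnected_Icc.inter ordConnected_Ioo
    refine ⟨5, by simp, fun f => ?_⟩
    refine (eVariationOn.mono _ (hoc.uIcc_subset ⟨ht₀, Metric.mem_ball_self hδ⟩
      ⟨ht, htδ⟩)).trans (hα.eVariationOn_chart_le inter_subset_left hoc (u := u) ?_ f)
    intro a ha b hb hab
    have h1 := hchart a ha.1 b hb.1 ha.2 hb.2 hab.le
    have h2 := mul_pos hc (sub_pos.2 hab)
    simp only
    linarith
  · intro a b c _ _ _ ⟨C, hC, h⟩ ⟨C', hC', h'⟩
    refine ⟨C + C', ENNReal.add_ne_top.2 ⟨hC, hC'⟩, fun f => ?_⟩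
    rw [add_mul]
    exact (eVariationOn_uIcc_le _ a b c).trans (add_le_add (h f) (h' f))
  · intro a b _ _ ⟨C, hC, h⟩
    exact ⟨C, hC, fun f => by rw [uIcc_comm]; exact h f⟩

/-- The variation norm dominates the norm along the arcs. -/
theorem ArcSystem.exists_pathNorm_le {σ : Set ℂ} {J : Type*} [Fintype J] {α : J → ℝ → σ}
    (h : ArcSystem α) : ∃ C : ℝ≥0∞, C ≠ ∞ ∧ ∀ f, pathNorm α f ≤ C * bvNorm f := by
  choose C hC hb using fun j => (h.arc j).exists_eVariationOn_le
  refine ⟨1 + ∑ j, C j, ENNReal.add_ne_top.2 ⟨ENNReal.one_ne_top,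
    (ENNReal.sum_ne_top.2 fun j _ => hC j)⟩, fun f => ?_⟩
  rw [add_mul, one_mul, Finset.sum_mul]
  exact add_le_add le_self_add (Finset.sum_le_sum fun j _ =>
    (hb j f).trans (mul_le_mul' le_rfl le_add_self))

/-! ### Absolutely continuous functions on `[0, 1]` -/

/-- The absolutely continuous functions on `[0, 1]`, as the closure of the Lipschitz functions in
the variation seminorm. -/
def IsACPath (φ : ℝ → ℂ) : Prop :=
  ∀ ε : ℝ, 0 < ε → ∃ (g : ℝ → ℂ) (K : NNReal), LipschitzOnWith K g (Icc 0 1) ∧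
    eVariationOn (φ - g) (Icc 0 1) ≤ ENNReal.ofReal ε

theorem eVariationOn_add_le (f g : ℝ → ℂ) (s : Set ℝ) :
    eVariationOn (f + g) s ≤ eVariationOn f s + eVariationOn g s := by
  refine iSup_le fun p => ?_
  refine le_trans (Finset.sum_le_sum fun i _ => ?_) ((Finset.sum_add_distrib).le.trans
    (add_le_add (le_iSup (fun p : ℕ × { u : ℕ → ℝ // Monotone u ∧ ∀ i, u i ∈ s } =>
      ∑ i ∈ Finset.range p.1, edist (f (p.2.1 (i + 1))) (f (p.2.1 i))) p)
      (le_iSup (fun p : ℕ × { u : ℕ → ℝ // Monotone u ∧ ∀ i, u i ∈ s } =>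
      ∑ i ∈ Finset.range p.1, edist (g (p.2.1 (i + 1))) (g (p.2.1 i))) p)))
  exact edist_add_add_le _ _ _ _

theorem eVariationOn_Icc_le_of_lipschitzOnWith {g : ℝ → ℂ} {K : NNReal} {a b : ℝ} (hab : a ≤ b)
    (hg : LipschitzOnWith K g (Icc a b)) :
    eVariationOn g (Icc a b) ≤ ENNReal.ofReal (K * (b - a)) := by
  have h1 := hg.comp_eVariationOn_le (g := id) (s := Icc a b) (mapsTo_id _)
  have h2 := ((monotone_id.monotoneOn (Icc a b)).eVariationOn_eq (left_mem_Icc.2 hab)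
    (right_mem_Icc.2 hab)).le
  rw [inter_self] at h2
  rw [ENNReal.ofReal_mul K.coe_nonneg, ENNReal.ofReal_coe_nnreal]
  exact h1.trans (mul_le_mul' le_rfl h2)

theorem LipschitzOnWith.sub_of_normed {f g : ℝ → ℂ} {K L : NNReal} {s : Set ℝ}
    (hf : LipschitzOnWith K f s) (hg : LipschitzOnWith L g s) :
    LipschitzOnWith (K + L) (f - g) s := LipschitzOnWith.of_dist_le_mul fun x hx y hy => by
  refine (dist_sub_sub_le _ _ _ _).trans ?_
  have h1 := hf.dist_le_mul x hx y hy
  have h2 := hg.dist_le_mul x hx y hy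
  push_cast
  rw [add_mul]
  exact add_le_add h1 h2

/-- A `2`-Lipschitz reparametrization of `[0, 1]` which is constant near both ends, and the
identity away from them. -/
theorem exists_flattening {η : ℝ} (hη : 0 < η) (hη4 : η ≤ 1 / 4) :
    ∃ ψ : ℝ → ℝ, LipschitzWith 2 ψ ∧ (∀ t, ψ t ∈ Icc (0 : ℝ) 1) ∧ (∀ t ≤ η, ψ t = 0) ∧
      (∀ t, 1 - η ≤ t → ψ t = 1) ∧ ∀ t ∈ Icc (2 * η) (1 - 2 * η), ψ t = t := by
  have h2 : ∀ b : ℝ, LipschitzWith 2 fun t : ℝ => 2 * t + b := fun b =>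
    LipschitzWith.of_dist_le_mul fun x y => by
      rw [Real.dist_eq, Real.dist_eq, show 2 * x + b - (2 * y + b) = 2 * (x - y) by ring, abs_mul]
      simp
  have hid : LipschitzWith 2 fun t : ℝ => t := LipschitzWith.id.weaken (by norm_num)
  have hψ := ((((hid.min (h2 (-2 * η))).max (h2 (2 * η - 1))).const_max 0).const_min 1)
  simp only [max_self] at hψ
  refine ⟨_, hψ, fun t => ⟨le_min zero_le_one (le_max_left _ _), min_le_left _ _⟩, fun t ht => ?_,
    fun t ht => ?_, fun t ht => ?_⟩
  · rw [max_eq_left (b := max _ _), min_eq_right zero_le_one]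
    exact max_le ((min_le_right _ _).trans (by linarith)) (by linarith)
  · rw [min_eq_left]
    exact le_max_of_le_right (le_max_of_le_right (by linarith))
  · rw [min_eq_left (a := t) (by linarith [ht.1]), max_eq_left (a := t) (by linarith [ht.2]),
      max_eq_right (by linarith [ht.1]), min_eq_right (by linarith [ht.2])]

/-- The Lipschitz approximations can be taken constant near both ends, with the right end values:
then approximations on different arcs fit together, and are locally constant where arcs meet. -/
theorem IsACPath.exists_flat_approx {φ : ℝ → ℂ} (hφ : IsACPath φ) {ε : ℝ} (hε : 0 < ε) :
    ∃ (g : ℝ → ℂ) (K : NNReal) (η : ℝ), 0 < η ∧ η < 1 ∧ LipschitzOnWith K g (Icc 0 1) ∧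
      (∀ t ≤ η, g t = φ 0) ∧ (∀ t, 1 - η ≤ t → g t = φ 1) ∧
      eVariationOn (φ - g) (Icc 0 1) ≤ ENNReal.ofReal ε := by
  obtain ⟨g₀, K₀, hg₀, hvar₀⟩ := hφ (ε / 4) (by linarith)
  set d : ℝ → ℂ := φ - g₀ with hd
  -- an affine correction gives the approximation the right values at `0` and `1`
  set l : ℝ → ℂ := fun t => -(d 0 + t * (d 1 - d 0)) with hl
  have h01 : ‖d 1 - d 0‖ ≤ ε / 4 := by
    have h := (eVariationOn.edist_le d (right_mem_Icc.2 zero_le_one)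
      (left_mem_Icc.2 zero_le_one)).trans hvar₀
    rw [edist_dist, dist_eq_norm] at h
    exact (ENNReal.ofReal_le_ofReal_iff (by linarith)).1 h
  have hlip : LipschitzOnWith ‖d 1 - d 0‖₊ l (Icc 0 1) := LipschitzOnWith.of_dist_le_mul
    fun x _ y _ => by
      rw [dist_eq_norm, show l x - l y = ((y - x : ℝ) : ℂ) * (d 1 - d 0) by
        simp only [hl]; push_cast; ring, norm_mul, Complex.norm_real, mul_comm, dist_comm,
        dist_eq_norm]
      rfl
  set g₁ : ℝ → ℂ := g₀ - l
  set K : NNReal := K₀ + ‖d 1 - d 0‖₊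
  have hg₁ : LipschitzOnWith K g₁ (Icc 0 1) := LipschitzOnWith.sub_of_normed hg₀ hlip
  have hg10 : g₁ 0 = φ 0 := by simp [g₁, hl, hd]
  have hg11 : g₁ 1 = φ 1 := by simp [g₁, hl, hd]; ring
  have hvar₁ : eVariationOn (φ - g₁) (Icc 0 1) ≤ ENNReal.ofReal (ε / 2) := by
    have : φ - g₁ = d + l := by simp only [g₁, hd]; ring
    rw [this]
    refine (eVariationOn_add_le _ _ _).trans ((add_le_add hvar₀
      ((eVariationOn_Icc_le_of_lipschitzOnWith zero_le_one hlip).trans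
        (ENNReal.ofReal_le_ofReal (q := ε / 4) ?_))).trans ?_)
    · rw [sub_zero, mul_one]; exact h01
    · rw [← ENNReal.ofReal_add (by linarith) (by linarith)]
      exact ENNReal.ofReal_le_ofReal (by linarith)
  set L : NNReal := K + K * 2
  set η : ℝ := min (1 / 4) (ε / (8 * (L + 1)))
  have hη : 0 < η := lt_min (by norm_num) (by positivity)
  have hη4 : η ≤ 1 / 4 := min_le_left _ _
  obtain ⟨ψ, hψ, hψm, hψ0, hψ1, hψid⟩ := exists_flattening hη hη4
  have hg₂ : LipschitzOnWith (K * 2) (g₁ ∘ ψ) (Icc 0 1) :=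
    hg₁.comp (hψ.lipschitzOnWith) fun t _ => hψm t
  refine ⟨g₁ ∘ ψ, K * 2, η, hη, by linarith, hg₂, fun t ht => ?_, fun t ht => ?_, ?_⟩
  · rw [Function.comp_apply, hψ0 t ht, hg10]
  · rw [Function.comp_apply, hψ1 t ht, hg11]
  · set k : ℝ → ℂ := g₁ - g₁ ∘ ψ
    have hk : LipschitzOnWith L k (Icc 0 1) := LipschitzOnWith.sub_of_normed hg₁ hg₂
    have e1 : eVariationOn k (Icc 0 (2 * η)) ≤ ENNReal.ofReal (ε / 4) := by
      refine (eVariationOn_Icc_le_of_lipschitzOnWith (by linarith)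
        (hk.mono (Icc_subset_Icc_right (by linarith)))).trans (ENNReal.ofReal_le_ofReal ?_)
      have h1 : η ≤ ε / (8 * (L + 1)) := min_le_right _ _
      rw [le_div_iff₀ (by positivity)] at h1
      nlinarith [L.coe_nonneg]
    have e3 : eVariationOn k (Icc (1 - 2 * η) 1) ≤ ENNReal.ofReal (ε / 4) := by
      refine (eVariationOn_Icc_le_of_lipschitzOnWith (by linarith)
        (hk.mono (Icc_subset_Icc_left (by linarith)))).trans (ENNReal.ofReal_le_ofReal ?_)
      have h1 : η ≤ ε / (8 * (L + 1)) := min_le_right _ _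
      rw [le_div_iff₀ (by positivity)] at h1
      nlinarith [L.coe_nonneg]
    have e2 : eVariationOn k (Icc (2 * η) (1 - 2 * η)) = 0 := by
      refine eVariationOn.constant_on ?_
      rintro _ ⟨s, hs, rfl⟩ _ ⟨t, ht, rfl⟩
      simp [k, hψid s hs, hψid t ht]
    have hsplit1 := eVariationOn.Icc_add_Icc k (a := 0) (b := 2 * η) (c := 1) (by linarith)
      (by linarith) (mem_univ _)
    have hsplit2 := eVariationOn.Icc_add_Icc k (a := 2 * η) (b := 1 - 2 * η) (c := 1) (by linarith)
      (by linarith) (mem_univ _)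
    simp only [univ_inter] at hsplit1 hsplit2
    have : φ - g₁ ∘ ψ = (φ - g₁) + k := by simp only [k]; ring
    rw [this]
    refine (eVariationOn_add_le _ _ _).trans ?_
    rw [← hsplit1, ← hsplit2, e2, zero_add]
    refine (add_le_add hvar₁ (add_le_add e1 e3)).trans ?_
    rw [← ENNReal.ofReal_add (by linarith) (by linarith),
      ← ENNReal.ofReal_add (by linarith) (by linarith)]
    exact ENNReal.ofReal_le_ofReal (by linarith)

/-! ### Absolute continuity along the arcs -/

/-- The inverse of an arc is continuous, by compactness. -/
theorem IsArc.eventually_mem {σ : Set ℂ} {α : ℝ → σ} (hα : IsArc α) {O : Set ℝ} (hO : IsOpen O)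
    {z : σ} (hz : ∀ t ∈ Icc (0 : ℝ) 1, α t = z → t ∈ O) :
    ∀ᶠ w in 𝓝 z, ∀ t ∈ Icc (0 : ℝ) 1, α t = w → t ∈ O := by
  have hc : IsCompact (α '' (Icc 0 1 \ O)) :=
    (isCompact_Icc.diff hO).image_of_continuousOn (hα.continuousOn.mono sdiff_subset)
  have hzc : z ∈ (α '' (Icc 0 1 \ O))ᶜ := by
    rintro ⟨t, ht, rfl⟩
    exact ht.2 (hz t ht.1 rfl)
  filter_upwards [hc.isClosed.isOpen_compl.mem_nhds hzc] with w hw t ht htw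
  by_contra hn
  exact hw ⟨t, ⟨ht, hn⟩, htw⟩

/-- Functions on the arcs that agree at coincident points define a function on the set. -/
theorem ArcSystem.exists_glue {σ : Set ℂ} {J : Type*} {α : J → ℝ → σ} (h : ArcSystem α)
    {X : Type*} (G : J → ℝ → X) (hG : ∀ j k, ∀ s ∈ Icc (0 : ℝ) 1, ∀ t ∈ Icc (0 : ℝ) 1,
      α j s = α k t → G j s = G k t) :
    ∃ g : σ → X, ∀ j, ∀ t ∈ Icc (0 : ℝ) 1, g (α j t) = G j t := by
  choose j t ht hjt using h.cover
  exact ⟨fun z => G (j z) (t z), fun k s hs => hG _ _ _ (ht _) _ hs (hjt _)⟩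

theorem IsArc.lipschitz_polynomial {σ : Set ℂ} {α : ℝ → σ} (hα : IsArc α) {p : σ → ℂ}
    (hp : p ∈ polynomialFunctions σ) : ∃ K, LipschitzOnWith K (fun t => p (α t)) (Icc 0 1) := by
  obtain ⟨K, hK⟩ := hα.lipschitz
  obtain ⟨q, rfl⟩ := hp
  change ∃ K, LipschitzOnWith K (fun t => (MvPolynomial.aeval _ q : σ → ℂ) (α t)) (Icc 0 1)
  have bdd : ∀ {g : ℝ → ℂ} {L : NNReal}, LipschitzOnWith L g (Icc 0 1) →
      ∃ B, 0 ≤ B ∧ ∀ t ∈ Icc (0 : ℝ) 1, ‖g t‖ ≤ B := fun {g L} hg => by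
    obtain ⟨B, hB⟩ := isCompact_Icc.exists_bound_of_continuousOn hg.continuousOn
    exact ⟨B, (norm_nonneg _).trans (hB 0 (left_mem_Icc.2 zero_le_one)), hB⟩
  induction q using MvPolynomial.induction_on with
  | C a => exact ⟨0, by simp⟩
  | add p q hp hq =>
    obtain ⟨A, hA⟩ := hp
    obtain ⟨B, hB⟩ := hq
    refine ⟨A + B, LipschitzOnWith.of_dist_le_mul fun s hs t ht => ?_⟩
    simp only [map_add, Pi.add_apply]
    refine (dist_add_add_le _ _ _ _).trans ?_
    push_cast
    rw [add_mul]
    exact add_le_add (hA.dist_le_mul s hs t ht) (hB.dist_le_mul s hs t ht)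
  | mul_X p i hp =>
    obtain ⟨A, hA⟩ := hp
    set c : σ → ℂ := ![(fun z : σ => ((z : ℂ).re : ℂ)), (fun z : σ => ((z : ℂ).im : ℂ))] i with hc
    have hcd : ∀ z w : σ, dist (c z) (c w) ≤ dist z w := by
      intro z w
      rw [Subtype.dist_eq, dist_eq_norm, dist_eq_norm, hc]
      fin_cases i
      · refine le_trans (le_of_eq ?_) (Complex.abs_re_le_norm ((z : ℂ) - w))
        rw [Complex.sub_re, ← Real.norm_eq_abs, ← Complex.norm_real, Complex.ofReal_sub]
        rfl
      · refine le_trans (le_of_eq ?_) (Complex.abs_im_le_norm ((z : ℂ) - w))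
        rw [Complex.sub_im, ← Real.norm_eq_abs, ← Complex.norm_real, Complex.ofReal_sub]
        rfl
    have hX : LipschitzOnWith K (fun t => c (α t)) (Icc 0 1) :=
      LipschitzOnWith.of_dist_le_mul fun s hs t ht =>
        (hcd _ _).trans (hK.dist_le_mul s hs t ht)
    obtain ⟨M, hM0, hM⟩ := bdd hA
    obtain ⟨N, hN0, hN⟩ := bdd hX
    refine ⟨M.toNNReal * K + N.toNNReal * A, LipschitzOnWith.of_dist_le_mul fun s hs t ht => ?_⟩
    simp only [map_mul, MvPolynomial.aeval_X, Pi.mul_apply]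
    rw [← hc]
    set P := MvPolynomial.aeval (S₁ := σ → ℂ) (R := ℂ)
      ![(fun z : σ => ((z : ℂ).re : ℂ)), (fun z : σ => ((z : ℂ).im : ℂ))] p
    have h1 := hA.dist_le_mul s hs t ht
    have h2 := hX.dist_le_mul s hs t ht
    rw [dist_eq_norm] at h1 h2 ⊢
    rw [show P (α s) * c (α s) - P (α t) * c (α t) =
      P (α s) * (c (α s) - c (α t)) + c (α t) * (P (α s) - P (α t)) by ring]
    refine (norm_add_le _ _).trans ?_
    rw [norm_mul, norm_mul]
    push_cast
    rw [Real.coe_toNNReal M hM0, Real.coe_toNNReal N hN0, add_mul, mul_assoc, mul_assoc]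
    exact add_le_add (mul_le_mul (hM s hs) h2 (norm_nonneg _) hM0)
      (mul_le_mul (hN t ht) h1 (norm_nonneg _) hN0)

/-- A function which is Lipschitz along each arc and constant near the ends of each arc belongs
to `AC(σ)`: locally it is constant, or a Lipschitz function of one linear coordinate. -/
theorem ArcSystem.mem_acFun_of_lipschitz {σ : Set ℂ} {J : Type*} [Finite J] {α : J → ℝ → σ}
    (h : ArcSystem α) {g : σ → ℂ} {G : J → ℝ → ℂ} {f : σ → ℂ}
    (hg : ∀ j, ∀ t ∈ Icc (0 : ℝ) 1, g (α j t) = G j t) {K : J → NNReal} {η : J → ℝ}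
    (hη : ∀ j, 0 < η j) (hG : ∀ j, LipschitzOnWith (K j) (G j) (Icc 0 1))
    (hG0 : ∀ j, ∀ t ≤ η j, G j t = f (α j 0)) (hG1 : ∀ j, ∀ t, 1 - η j ≤ t → G j t = f (α j 1)) :
    g ∈ acFun σ := by
  have hb := h.isCompact.isBounded
  refine mem_acFun_of_locally h.isCompact fun z => ?_
  by_cases hz : ∀ j, ∀ t ∈ Icc (0 : ℝ) 1, α j t = z → t = 0 ∨ t = 1
  · refine ⟨fun _ => f z, Subalgebra.algebraMap_mem (acFun σ) (f z), ?_⟩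
    have hev : ∀ j, ∀ᶠ w in 𝓝 z, ∀ t ∈ Icc (0 : ℝ) 1, α j t = w →
        t ∈ {t | (t < η j ∧ α j 0 = z) ∨ (1 - η j < t ∧ α j 1 = z)} := by
      intro j
      refine (h.arc j).eventually_mem ?_ fun t ht htz => ?_
      · rw [ofPred_or, ofPred_and, ofPred_and]
        exact ((isOpen_gt' _).inter isOpen_const).union ((isOpen_lt' _).inter isOpen_const)
      · rcases hz j t ht htz with rfl | rfl
        · exact Or.inl ⟨hη j, htz⟩
        · exact Or.inr ⟨by linarith [hη j], htz⟩
    filter_upwards [eventually_all.2 hev] with w hw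
    obtain ⟨j, t, ht, rfl⟩ := h.cover w
    rw [hg j t ht]
    rcases hw j t ht rfl with ⟨h1, h2⟩ | ⟨h1, h2⟩
    · rw [hG0 j t h1.le, h2]
    · rw [hG1 j t h1.le, h2]
  · push Not at hz
    obtain ⟨j, t₀, ht₀, rfl, hne0, hne1⟩ := hz
    obtain ⟨u, c, hc, δ, hδ, hchart⟩ := (h.arc j).chart t₀ ht₀
    set S : Set ℝ := Icc 0 1 ∩ Metric.ball t₀ δ
    set φ : ℝ → ℝ := fun t => inner ℝ u (α j t : ℂ)
    have hφ : ∀ s ∈ S, ∀ t ∈ S, c * |s - t| ≤ |φ s - φ t| := by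
      intro s hs t ht
      rcases le_total s t with hst | hst
      · rw [abs_sub_comm, abs_of_nonneg (sub_nonneg.2 hst), abs_sub_comm]
        exact (hchart s hs.1 t ht.1 hs.2 ht.2 hst).trans (le_abs_self _)
      · rw [abs_of_nonneg (sub_nonneg.2 hst)]
        exact (hchart t ht.1 s hs.1 ht.2 hs.2 hst).trans (le_abs_self _)
    have hφinj : InjOn φ S := fun s hs t ht hst => by
      have := hφ s hs t ht
      rw [hst, sub_self, abs_zero] at this
      have h0 : |s - t| ≤ 0 := by nlinarith [abs_nonneg (s - t)]
      exact sub_eq_zero.1 (abs_nonpos_iff.1 h0)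
    have hlip : LipschitzOnWith (K j / c.toNNReal) (G j ∘ Function.invFunOn φ S) (φ '' S) := by
      refine LipschitzOnWith.of_dist_le_mul ?_
      rintro _ ⟨s, hs, rfl⟩ _ ⟨t, ht, rfl⟩
      rw [Function.comp_apply, Function.comp_apply, hφinj.leftInvOn_invFunOn hs,
        hφinj.leftInvOn_invFunOn ht]
      refine ((hG j).dist_le_mul s hs.1 t ht.1).trans ?_
      rw [NNReal.coe_div, Real.coe_toNNReal c hc.le, div_mul_eq_mul_div, mul_div_assoc]
      refine mul_le_mul_of_nonneg_left ?_ (K j).coe_nonneg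
      refine (le_div_iff₀ hc).2 ?_
      rw [mul_comm, Real.dist_eq, Real.dist_eq]
      exact hφ s hs t ht
    obtain ⟨H, hH, hHeq⟩ := hlip.extend_finite_dimension
    refine ⟨_, lipschitz_complex_comp_inner_mem_acFun hb u hH, ?_⟩
    have hev : ∀ k, ∀ᶠ w in 𝓝 (α j t₀), ∀ t ∈ Icc (0 : ℝ) 1, α k t = w →
        t ∈ {t | k = j ∧ t ∈ Metric.ball t₀ δ} := by
      intro k
      refine (h.arc k).eventually_mem ?_ fun t ht htz => ?_
      · rw [ofPred_and]
        exact isOpen_const.inter Metric.isOpen_ball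
      · have hkj : k = j := by
          by_contra hkj
          rcases (h.meet k j hkj t ht t₀ ht₀ htz).2 with h | h
          · exact hne0 h
          · exact hne1 h
        subst hkj
        obtain rfl := (h.arc k).injOn ht ht₀ htz
        exact ⟨rfl, Metric.mem_ball_self hδ⟩
    filter_upwards [eventually_all.2 hev] with w hw
    obtain ⟨k, t, ht, rfl⟩ := h.cover w
    obtain ⟨rfl, h2⟩ := hw k t ht rfl
    rw [hg k t ht]
    have hHt : H (φ t) = G k (Function.invFunOn φ S (φ t)) := (hHeq ⟨t, ⟨ht, h2⟩, rfl⟩).symm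
    rw [hφinj.leftInvOn_invFunOn (show t ∈ S from ⟨ht, h2⟩)] at hHt
    exact hHt.symm

/-- Membership in `AC(σ)` is absolute continuity along each arc. -/
theorem ArcSystem.mem_acFun_iff {σ : Set ℂ} {J : Type*} [Fintype J] {α : J → ℝ → σ}
    (h : ArcSystem α) {f : σ → ℂ} : f ∈ acFun σ ↔ ∀ j, IsACPath fun t => f (α j t) := by
  constructor
  · intro hf j ε hε
    obtain ⟨C, hC, hb⟩ := h.exists_pathNorm_le
    lift C to NNReal using hC
    have hC0 : 0 < (C : ℝ) + 1 := by positivity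
    obtain ⟨p, hp, hfp⟩ := exists_polynomial_approx hf (div_pos hε hC0)
    obtain ⟨K, hK⟩ := (h.arc j).lipschitz_polynomial hp
    refine ⟨fun t => p (α j t), K, hK, ?_⟩
    refine (eVariationOn_le_pathNorm α (f - p) j).trans ((hb _).trans
      ((mul_le_mul' le_rfl hfp).trans ?_))
    rw [← ENNReal.ofReal_coe_nnreal, ← ENNReal.ofReal_mul C.coe_nonneg]
    refine ENNReal.ofReal_le_ofReal ?_
    rw [← mul_div_assoc, div_le_iff₀ hC0, mul_comm]
    exact mul_le_mul_of_nonneg_left (by linarith) hε.le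
  · intro hf
    refine mem_acFun_of_forall_approx fun ε hε => ?_
    obtain ⟨C, hC, hb⟩ := h.exists_bvNorm_le
    lift C to NNReal using hC
    set ε' : ℝ := ε / ((C + 1) * (1 + Fintype.card J))
    have hε' : 0 < ε' := by positivity
    choose G K η hη hη1 hG hG0 hG1 hvar using fun j => (hf j).exists_flat_approx hε'
    have hGend : ∀ j s, s = 0 ∨ s = 1 → G j s = f (α j s) := by
      rintro j s (rfl | rfl)
      · exact hG0 j 0 (hη j).le
      · exact hG1 j 1 (by linarith [hη j])
    obtain ⟨g, hg⟩ := h.exists_glue G fun j k s hs t ht hst => by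
      by_cases hjk : j = k
      · subst hjk
        rw [(h.arc j).injOn hs ht hst]
      · obtain ⟨h1, h2⟩ := h.meet j k hjk s hs t ht hst
        rw [hGend j s h1, hGend k t h2, hst]
    refine ⟨g, h.mem_acFun_of_lipschitz (f := f) hg hη hG hG0 hG1, ?_⟩
    have hvar' : ∀ j, eVariationOn (fun t => (f - g) (α j t)) (Icc 0 1) ≤ ENNReal.ofReal ε' := by
      intro j
      refine le_trans (le_of_eq (eVariationOn.congr fun t ht => ?_)) (hvar j)
      simp only [Pi.sub_apply]
      rw [hg j t ht]
    have hsup : supNorm (f - g) ≤ ENNReal.ofReal ε' := by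
      refine iSup_le fun z => ?_
      obtain ⟨j, t, ht, rfl⟩ := h.cover z
      have h0 : (f - g) (α j 0) = 0 := by
        rw [Pi.sub_apply, hg j 0 (left_mem_Icc.2 zero_le_one), hGend j 0 (Or.inl rfl), sub_self]
      have h1 := eVariationOn.edist_le (fun t => (f - g) (α j t)) ht (left_mem_Icc.2 zero_le_one)
      simp only [h0, edist_zero_right] at h1
      exact h1.trans (hvar' j)
    have hpath : pathNorm α (f - g) ≤ ENNReal.ofReal ((1 + Fintype.card J) * ε') := by
      refine (add_le_add hsup (Finset.sum_le_sum fun j _ => hvar' j)).trans (le_of_eq ?_)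
      rw [Finset.sum_const, nsmul_eq_mul, Finset.card_univ, ENNReal.ofReal_mul (by positivity),
        ENNReal.ofReal_add zero_le_one (by positivity), ENNReal.ofReal_one, ENNReal.ofReal_natCast]
      ring
    refine (hb _).trans ((mul_le_mul' le_rfl hpath).trans ?_)
    rw [← ENNReal.ofReal_coe_nnreal, ← ENNReal.ofReal_mul C.coe_nonneg]
    refine ENNReal.ofReal_le_ofReal ?_
    have h1 : (C + 1) * ((1 + Fintype.card J) * ε') = ε := by
      simp only [ε']; field_simp
    have h2 : 0 ≤ (1 + Fintype.card J) * ε' := by positivity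
    linarith

/-! ### Transport along bijections of arc systems -/

/-- Composition with a map that preserves absolute continuity is a homomorphism of algebras. -/
theorem exists_algHom_comp {σ τ : Set ℂ} (e : τ → σ)
    (he : ∀ f ∈ acFun σ, f ∘ e ∈ acFun τ) :
    ∃ Ψ : AC σ →ₐ[ℂ] AC τ, ∀ F : AC σ, BV.toFun τ (Ψ F) = BV.toFun σ F ∘ e := by
  have hex : ∀ F : AC σ, ∃ G : AC τ, BV.toFun τ G = BV.toFun σ F ∘ e := fun F => by
    obtain ⟨G, hG, hGe⟩ := he _ (toFun_mem_acFun F)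
    exact ⟨⟨G, hG⟩, hGe⟩
  choose Ψ hΨ using hex
  have hinj : ∀ G G' : AC τ, BV.toFun τ G = BV.toFun τ G' → G = G' := fun G G' h =>
    Subtype.ext (BV.toFun_injective τ h)
  refine ⟨{ toFun := Ψ, map_one' := ?_, map_mul' := ?_, map_zero' := ?_, map_add' := ?_,
            commutes' := ?_ }, hΨ⟩
  · exact hinj _ _ (hΨ 1)
  · intro F G
    refine hinj _ _ ((hΨ (F * G)).trans ?_)
    have h1 : BV.toFun τ ((Ψ F * Ψ G : AC τ) : BV τ) = BV.toFun τ (Ψ F) * BV.toFun τ (Ψ G) := rfl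
    rw [h1, hΨ, hΨ]
    rfl
  · exact hinj _ _ (hΨ 0)
  · intro F G
    refine hinj _ _ ((hΨ (F + G)).trans ?_)
    have h1 : BV.toFun τ ((Ψ F + Ψ G : AC τ) : BV τ) = BV.toFun τ (Ψ F) + BV.toFun τ (Ψ G) := rfl
    rw [h1, hΨ, hΨ]
    rfl
  · intro c
    exact hinj _ _ (hΨ _)

theorem continuous_of_comp {σ τ : Set ℂ} (e : τ → σ) (Ψ : AC σ →ₐ[ℂ] AC τ)
    (hΨ : ∀ F : AC σ, BV.toFun τ (Ψ F) = BV.toFun σ F ∘ e) {C : ℝ≥0∞} (hC : C ≠ ∞)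
    (hb : ∀ f : σ → ℂ, bvNorm (f ∘ e) ≤ C * bvNorm f) : Continuous Ψ := by
  refine AddMonoidHomClass.continuous_of_bound Ψ C.toReal fun F => ?_
  change (bvNorm (BV.toFun τ (Ψ F))).toReal ≤ C.toReal * (bvNorm (BV.toFun σ F)).toReal
  rw [hΨ, ← ENNReal.toReal_mul]
  exact ENNReal.toReal_mono (ENNReal.mul_ne_top hC (BV.bvNorm_ne_top _)) (hb _)

/-- Two systems of arcs with the same coincidences between their points give isomorphic algebras:
the bijection that identifies corresponding parameters preserves absolute continuity along the
arcs and the norm along the arcs. -/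
theorem ArcSystem.exists_algEquiv {σ τ : Set ℂ} {J : Type*} [Fintype J] {α : J → ℝ → σ}
    {β : J → ℝ → τ} (hα : ArcSystem α) (hβ : ArcSystem β)
    (hc : ∀ j k, ∀ s ∈ Icc (0 : ℝ) 1, ∀ t ∈ Icc (0 : ℝ) 1, α j s = α k t ↔ β j s = β k t) :
    ∃ Φ : AC σ ≃ₐ[ℂ] AC τ, Continuous Φ ∧ Continuous Φ.symm := by
  obtain ⟨e, he⟩ := hα.exists_glue β fun j k s hs t ht => (hc j k s hs t ht).1
  obtain ⟨e', he'⟩ := hβ.exists_glue α fun j k s hs t ht => (hc j k s hs t ht).2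
  have hee' : ∀ w, e (e' w) = w := fun w => by
    obtain ⟨j, t, ht, rfl⟩ := hβ.cover w
    rw [he' j t ht, he j t ht]
  have he'e : ∀ z, e' (e z) = z := fun z => by
    obtain ⟨j, t, ht, rfl⟩ := hα.cover z
    rw [he j t ht, he' j t ht]
  -- the same argument serves for both directions
  have main : ∀ {σ τ : Set ℂ} {α : J → ℝ → σ} {β : J → ℝ → τ}, ArcSystem α → ArcSystem β →
      ∀ e' : τ → σ, (∀ j, ∀ t ∈ Icc (0 : ℝ) 1, e' (β j t) = α j t) →
      ∃ Ψ : AC σ →ₐ[ℂ] AC τ, (∀ F : AC σ, BV.toFun τ (Ψ F) = BV.toFun σ F ∘ e') ∧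
        Continuous Ψ := by
    intro σ τ α β hα hβ e' he'
    have hmem : ∀ f ∈ acFun σ, f ∘ e' ∈ acFun τ := fun f hf => by
      rw [hβ.mem_acFun_iff]
      intro j ε hε
      obtain ⟨g, K, hg, hvar⟩ := (hα.mem_acFun_iff.1 hf) j ε hε
      refine ⟨g, K, hg, le_trans (le_of_eq (eVariationOn.congr fun t ht => ?_)) hvar⟩
      simp only [Pi.sub_apply, Function.comp_apply]
      rw [he' j t ht]
    obtain ⟨Ψ, hΨ⟩ := exists_algHom_comp e' hmem
    obtain ⟨C, hC, hCb⟩ := hα.exists_pathNorm_le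
    obtain ⟨D, hD, hDb⟩ := hβ.exists_bvNorm_le
    refine ⟨Ψ, hΨ, continuous_of_comp e' Ψ hΨ (ENNReal.mul_ne_top hD hC) fun f => ?_⟩
    refine (hDb _).trans ?_
    rw [mul_assoc]
    refine mul_le_mul' le_rfl (le_trans ?_ (hCb f))
    refine add_le_add (iSup_le fun w => le_supNorm f (e' w)) (Finset.sum_le_sum fun j _ => ?_)
    refine le_of_eq (eVariationOn.congr fun t ht => ?_)
    simp only [Function.comp_apply]
    rw [he' j t ht]
  obtain ⟨Ψ, hΨ, hΨc⟩ := main hα hβ e' he'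
  obtain ⟨Ψ', hΨ', hΨc'⟩ := main hβ hα e he
  refine ⟨AlgEquiv.ofAlgHom Ψ Ψ' (AlgHom.ext fun G => ?_) (AlgHom.ext fun F => ?_), hΨc, hΨc'⟩
  · refine Subtype.ext (BV.toFun_injective τ ((hΨ (Ψ' G)).trans ?_))
    rw [hΨ']
    funext w
    exact congrArg (BV.toFun τ G) (hee' w)
  · refine Subtype.ext (BV.toFun_injective σ ((hΨ' (Ψ F)).trans ?_))
    rw [hΨ]
    funext z
    exact congrArg (BV.toFun σ F) (he'e z)

/-! ### Subdivision of arc systems -/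

/-- The affine map of `[0, 1]` onto the interval with ends `a` and `b`. -/
def affineTo (a b t : ℝ) : ℝ := a + (b - a) * t

theorem affineTo_zero (a b : ℝ) : affineTo a b 0 = a := by simp [affineTo]

theorem affineTo_one (a b : ℝ) : affineTo a b 1 = b := by simp [affineTo]

theorem affineTo_sub (a b s t : ℝ) : affineTo a b s - affineTo a b t = (b - a) * (s - t) := by
  unfold affineTo; ring

theorem affineTo_injective {a b : ℝ} (hab : a ≠ b) : Function.Injective (affineTo a b) :=
  fun s t h => by
    have := affineTo_sub a b s t
    rw [h, sub_self] at this
    exact sub_eq_zero.1 ((mul_eq_zero.1 this.symm).resolve_left (sub_ne_zero.2 hab.symm))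

theorem continuous_affineTo (a b : ℝ) : Continuous (affineTo a b) := by
  unfold affineTo; fun_prop

theorem affineTo_image (a b : ℝ) : affineTo a b '' Icc 0 1 = uIcc a b := by
  rw [← segment_eq_uIcc, segment_eq_image']
  refine image_congr fun t _ => ?_
  simp [affineTo, mul_comm]

theorem affineTo_mem {a b t : ℝ} (ht : t ∈ Icc (0 : ℝ) 1) : affineTo a b t ∈ uIcc a b :=
  affineTo_image a b ▸ mem_image_of_mem _ ht

theorem uIcc_subset_unit {a b : ℝ} (ha : a ∈ Icc (0 : ℝ) 1) (hb : b ∈ Icc (0 : ℝ) 1) :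
    uIcc a b ⊆ Icc (0 : ℝ) 1 := ordConnected_Icc.uIcc_subset ha hb

theorem IsArc.comp_affineTo {σ : Set ℂ} {α : ℝ → σ} (hα : IsArc α) {a b : ℝ}
    (ha : a ∈ Icc (0 : ℝ) 1) (hb : b ∈ Icc (0 : ℝ) 1) (hab : a ≠ b) :
    IsArc fun t => α (affineTo a b t) := by
  have hm : ∀ t ∈ Icc (0 : ℝ) 1, affineTo a b t ∈ Icc (0 : ℝ) 1 := fun t ht =>
    uIcc_subset_unit ha hb (affineTo_mem ht)
  have hab' : 0 < |b - a| := abs_pos.2 (sub_ne_zero.2 hab.symm)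
  refine ⟨?_, ?_, ?_, ?_⟩
  · obtain ⟨K, hK⟩ := hα.lipschitz
    refine ⟨K * |b - a|.toNNReal, LipschitzOnWith.of_dist_le_mul fun s hs t ht => ?_⟩
    refine (hK.dist_le_mul _ (hm s hs) _ (hm t ht)).trans (le_of_eq ?_)
    rw [Real.dist_eq, affineTo_sub, abs_mul, NNReal.coe_mul, Real.coe_toNNReal _ (abs_nonneg _),
      mul_assoc, Real.dist_eq]
  · exact fun s hs t ht h => affineTo_injective hab (hα.injOn (hm s hs) (hm t ht) h)
  · intro t₀ ht₀
    obtain ⟨u, c, hc, δ, hδ, hchart⟩ := hα.chart _ (hm t₀ ht₀)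
    have hnear : ∀ s, |s - t₀| < δ / |b - a| → |affineTo a b s - affineTo a b t₀| < δ := by
      intro s hs
      rw [affineTo_sub, abs_mul, mul_comm]
      exact (lt_div_iff₀ hab').1 hs
    rcases lt_or_gt_of_ne hab with h | h
    · refine ⟨u, c * (b - a), mul_pos hc (sub_pos.2 h), δ / |b - a|, by positivity,
        fun s hs t ht hs' ht' hst => ?_⟩
      have h1 := affineTo_sub a b t s
      have h2 : 0 ≤ (b - a) * (t - s) := mul_nonneg (sub_pos.2 h).le (sub_nonneg.2 hst)
      have h3 := hchart _ (hm s hs) _ (hm t ht) (hnear s hs') (hnear t ht') (by linarith)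
      rwa [h1, ← mul_assoc] at h3
    · refine ⟨-u, c * (a - b), mul_pos hc (sub_pos.2 h), δ / |b - a|, by positivity,
        fun s hs t ht hs' ht' hst => ?_⟩
      have h1 := affineTo_sub a b s t
      have h2 : 0 ≤ (a - b) * (t - s) := mul_nonneg (sub_pos.2 h).le (sub_nonneg.2 hst)
      have h3 := hchart _ (hm t ht) _ (hm s hs) (hnear t ht') (hnear s hs') (by linarith)
      rw [h1] at h3
      rw [inner_neg_left, inner_neg_left]
      linarith
  · intro t ht
    obtain ⟨u, hu, hs⟩ := hα.support _ (hm t ht)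
    exact ⟨u, hu, fun s hs' => hs _ (hm s hs')⟩

/-- The direction of a chart is nonzero, since each parameter has other parameters close to it. -/
theorem IsArc.exists_chart_ne_zero {σ : Set ℂ} {α : ℝ → σ} (hα : IsArc α) {t₀ : ℝ}
    (ht₀ : t₀ ∈ Icc (0 : ℝ) 1) : ∃ u : ℂ, u ≠ 0 ∧ ∃ δ > 0, ∀ s ∈ Icc (0 : ℝ) 1,
      ∀ t ∈ Icc (0 : ℝ) 1, |s - t₀| < δ → |t - t₀| < δ → s < t →
        inner ℝ u (α s : ℂ) < inner ℝ u (α t : ℂ) := by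
  obtain ⟨u, c, hc, δ, hδ, hchart⟩ := hα.chart t₀ ht₀
  have hlt : ∀ s ∈ Icc (0 : ℝ) 1, ∀ t ∈ Icc (0 : ℝ) 1, |s - t₀| < δ → |t - t₀| < δ → s < t →
      inner ℝ u (α s : ℂ) < inner ℝ u (α t : ℂ) := fun s hs t ht hs' ht' hst => by
    have h1 := hchart s hs t ht hs' ht' hst.le
    have h2 := mul_pos hc (sub_pos.2 hst)
    linarith
  refine ⟨u, ?_, δ, hδ, hlt⟩
  rintro rfl
  have h0 : |t₀ - t₀| < δ := by simpa using hδ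
  rcases ht₀.2.lt_or_eq with h1 | h1
  · have hr : t₀ < min (t₀ + δ / 2) 1 := lt_min (by linarith) h1
    have := hlt t₀ ht₀ (min (t₀ + δ / 2) 1) ⟨ht₀.1.trans hr.le, min_le_right _ _⟩ h0 (by
      rw [abs_of_pos (sub_pos.2 hr)]
      linarith [min_le_left (t₀ + δ / 2) 1]) hr
    simp at this
  · have hr : max (t₀ - δ / 2) 0 < t₀ := max_lt (by linarith) (by linarith)
    have := hlt (max (t₀ - δ / 2) 0) ⟨le_max_right _ _, hr.le.trans ht₀.2⟩ t₀ ht₀ (by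
      rw [abs_of_neg (sub_neg.2 hr)]
      linarith [le_max_left (t₀ - δ / 2) 0]) h0 hr
    simp at this

/-- Subdivision and reparametrization of a system of arcs. -/
theorem ArcSystem.subdivide {σ : Set ℂ} {K J : Type*} {α : K → ℝ → σ} (h : ArcSystem α)
    {κ : J → K} {a b : J → ℝ} (ha : ∀ j, a j ∈ Icc (0 : ℝ) 1) (hb : ∀ j, b j ∈ Icc (0 : ℝ) 1)
    (hab : ∀ j, a j ≠ b j)
    (hcover : ∀ z, ∃ j, ∃ s ∈ uIcc (a j) (b j), α (κ j) s = z)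
    (hmeet : ∀ j k, j ≠ k → ∀ s ∈ uIcc (a j) (b j), ∀ t ∈ uIcc (a k) (b k),
      α (κ j) s = α (κ k) t → (s = a j ∨ s = b j) ∧ (t = a k ∨ t = b k)) :
    ArcSystem fun j t => α (κ j) (affineTo (a j) (b j) t) := by
  have hm : ∀ j, ∀ t ∈ Icc (0 : ℝ) 1, affineTo (a j) (b j) t ∈ Icc (0 : ℝ) 1 := fun j t ht =>
    uIcc_subset_unit (ha j) (hb j) (affineTo_mem ht)
  have htend : ∀ j, ∀ s ∈ Icc (0 : ℝ) 1, Tendsto (affineTo (a j) (b j)) (𝓝[Icc 0 1] s)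
      (𝓝[Icc 0 1] (affineTo (a j) (b j) s)) := fun j s _ =>
    tendsto_nhdsWithin_iff.2 ⟨((continuous_affineTo _ _).tendsto s).mono_left nhdsWithin_le_nhds,
      eventually_nhdsWithin_of_forall fun t ht => hm j t ht⟩
  have hend : ∀ j s, affineTo (a j) (b j) s = a j ∨ affineTo (a j) (b j) s = b j →
      s = 0 ∨ s = 1 := fun j s hs => by
    rcases hs with hs | hs
    · exact Or.inl (affineTo_injective (hab j) (hs.trans (affineTo_zero _ _).symm))
    · exact Or.inr (affineTo_injective (hab j) (hs.trans (affineTo_one _ _).symm))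
  refine ⟨fun j => (h.arc _).comp_affineTo (ha j) (hb j) (hab j), fun z => ?_,
    fun j k hjk s hs t ht hst => ?_, fun j k hjk s hs t ht hst => ?_⟩
  · obtain ⟨j, s, hs, hz⟩ := hcover z
    rw [← affineTo_image] at hs
    obtain ⟨t, ht, rfl⟩ := hs
    exact ⟨j, t, ht, hz⟩
  · obtain ⟨h1, h2⟩ := hmeet j k hjk _ (affineTo_mem hs) _ (affineTo_mem ht) hst
    exact ⟨hend j s h1, hend k t h2⟩
  · by_cases hκ : κ j = κ k
    · -- two subarcs of the same arc, on different sides of the common parameter `p`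
      set p := affineTo (a j) (b j) s with hp
      have hpk : affineTo (a k) (b k) t = p := by
        refine ((h.arc (κ j)).injOn (hm j s hs) (hm k t ht) ?_).symm
        simp only [← hκ] at hst
        exact hst
      have hst' : α (κ j) p = α (κ k) p := by rw [hκ]
      obtain ⟨e1, e2⟩ := hmeet j k hjk p (affineTo_mem hs) p (hpk ▸ affineTo_mem ht) hst'
      have other : ∀ i, (p = a i ∨ p = b i) → ∃ m, m ≠ p ∧ uIcc (a i) (b i) = uIcc p m ∧
          ∀ r, (r = a i ∨ r = b i) → r = p ∨ r = m := by
        rintro i (hi | hi)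
        · exact ⟨b i, hi ▸ (hab i).symm, by rw [hi], fun r hr => by rwa [hi]⟩
        · exact ⟨a i, hi ▸ hab i, by rw [hi, uIcc_comm], fun r hr => by rw [hi]; exact hr.symm⟩
      obtain ⟨m, hmp, hum, hem⟩ := other j e1
      obtain ⟨m', hmp', hum', -⟩ := other k e2
      have hcontra : ∀ r, r ∈ uIcc p m → r ∈ uIcc p m' → r = p ∨ r = m := fun r h1 h2 =>
        hem r (hmeet j k hjk r (hum ▸ h1) r (hum' ▸ h2) (by rw [hκ])).1
      obtain ⟨u, hu, δ, hδ, hlt⟩ := (h.arc (κ j)).exists_chart_ne_zero (hm j s hs)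
      have hp0 : |p - p| < δ := by simpa using hδ
      have near : ∀ i, ∀ x ∈ Icc (0 : ℝ) 1, affineTo (a i) (b i) x = p → ∀ᶠ x' in 𝓝[Icc 0 1] x,
          x' ∈ Icc (0 : ℝ) 1 ∧ |affineTo (a i) (b i) x' - p| < δ := by
        intro i x hx hxp
        refine eventually_mem_nhdsWithin.and ?_
        have := (htend i x hx).mono_right nhdsWithin_le_nhds
        rw [hxp] at this
        exact this.eventually (Metric.ball_mem_nhds p hδ)
      have hnej : ∀ x', x' ≠ s → affineTo (a j) (b j) x' ≠ p := fun x' hx' he =>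
        hx' (affineTo_injective (hab j) (he.trans hp))
      have hnek : ∀ x', x' ≠ t → affineTo (a k) (b k) x' ≠ p := fun x' hx' he =>
        hx' (affineTo_injective (hab k) (he.trans hpk.symm))
      rcases lt_or_gt_of_ne hmp with h1 | h1 <;> rcases lt_or_gt_of_ne hmp' with h2 | h2
      · exfalso
        rw [uIcc_of_ge h1.le, uIcc_of_ge h2.le] at hcontra
        have h3 := max_lt h1 h2
        rcases hcontra ((max m m' + p) / 2) ⟨by linarith [le_max_left m m'], by linarith⟩
          ⟨by linarith [le_max_right m m'], by linarith⟩ with h | h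
        · linarith
        · linarith [le_max_left m m']
      · refine ⟨u, hu, inner ℝ u (α (κ j) p : ℂ), sub_self _, ?_, ?_⟩
        · filter_upwards [near j s hs rfl] with x' hx' hne
          have hmem : affineTo (a j) (b j) x' ∈ uIcc p m := hum ▸ affineTo_mem hx'.1
          rw [uIcc_of_ge h1.le] at hmem
          exact sub_neg.2 (hlt _ (hm j x' hx'.1) p (hm j s hs) hx'.2 hp0
            (lt_of_le_of_ne hmem.2 (hnej x' hne)))
        · filter_upwards [near k t ht hpk] with x' hx' hne
          have hmem : affineTo (a k) (b k) x' ∈ uIcc p m' := hum' ▸ affineTo_mem hx'.1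
          rw [uIcc_of_le h2.le] at hmem
          rw [← hκ]
          exact sub_pos.2 (hlt p (hm j s hs) _ (hm k x' hx'.1) hp0 hx'.2
            (lt_of_le_of_ne hmem.1 (hnek x' hne).symm))
      · refine ⟨-u, neg_ne_zero.2 hu, inner ℝ (-u) (α (κ j) p : ℂ), sub_self _, ?_, ?_⟩
        · filter_upwards [near j s hs rfl] with x' hx' hne
          have hmem : affineTo (a j) (b j) x' ∈ uIcc p m := hum ▸ affineTo_mem hx'.1
          rw [uIcc_of_le h1.le] at hmem
          refine sub_neg.2 ?_
          rw [inner_neg_left, inner_neg_left, neg_lt_neg_iff]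
          exact hlt p (hm j s hs) _ (hm j x' hx'.1) hp0 hx'.2
            (lt_of_le_of_ne hmem.1 (hnej x' hne).symm)
        · filter_upwards [near k t ht hpk] with x' hx' hne
          have hmem : affineTo (a k) (b k) x' ∈ uIcc p m' := hum' ▸ affineTo_mem hx'.1
          rw [uIcc_of_ge h2.le] at hmem
          rw [← hκ]
          refine sub_pos.2 ?_
          rw [inner_neg_left, inner_neg_left, neg_lt_neg_iff]
          exact hlt _ (hm k x' hx'.1) p (hm j s hs) hx'.2 hp0
            (lt_of_le_of_ne hmem.2 (hnek x' hne))
      · exfalso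
        rw [uIcc_of_le h1.le, uIcc_of_le h2.le] at hcontra
        have h3 := lt_min h1 h2
        rcases hcontra ((min m m' + p) / 2) ⟨by linarith, by linarith [min_le_left m m']⟩
          ⟨by linarith, by linarith [min_le_right m m']⟩ with h | h
        · linarith
        · linarith [min_le_left m m']
    · obtain ⟨u, hu, c, h0, h1, h2⟩ := h.sep _ _ hκ _ (hm j s hs) _ (hm k t ht) hst
      refine ⟨u, hu, c, h0, ?_, ?_⟩
      · filter_upwards [(htend j s hs).eventually h1] with x hx hne
        exact hx fun he => hne (affineTo_injective (hab j) he)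
      · filter_upwards [(htend k t ht).eventually h2] with x hx hne
        exact hx fun he => hne (affineTo_injective (hab k) he)

/-! ### Common subdivisions under a homeomorphism -/

/-- The image of an arc that avoids the ends of all arcs of a system, except possibly at its own
ends, is a subarc of one arc of the system. -/
theorem ArcSystem.exists_image_subarc {τ : Set ℂ} {K : Type*} [Finite K] {β : K → ℝ → τ}
    (h : ArcSystem β) {A : ℝ → τ} {a b : ℝ} (hab : a < b) (hA : ContinuousOn A (Icc a b))
    (hinj : InjOn A (Icc a b))
    (hends : ∀ t ∈ Ioo a b, ∀ l, A t ≠ β l 0 ∧ A t ≠ β l 1) :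
    ∃ l, ∃ p ∈ Icc (0 : ℝ) 1, ∃ q ∈ Icc (0 : ℝ) 1, p ≠ q ∧ β l p = A a ∧ β l q = A b ∧
      β l '' uIcc p q = A '' Icc a b := by
  have hclosed : ∀ l, IsClosed (β l '' Icc 0 1) := fun l =>
    (isCompact_Icc.image_of_continuousOn (h.arc l).continuousOn).isClosed
  have hpre : IsPreconnected (A '' Ioo a b) :=
    isPreconnected_Ioo.image A (hA.mono Ioo_subset_Icc_self)
  obtain ⟨l, s₀, hs₀, hl⟩ := h.cover (A ((a + b) / 2))
  have ht₀ : (a + b) / 2 ∈ Ioo a b := ⟨by linarith, by linarith⟩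
  -- the arcs other than `l` meet arc `l` only at ends, which the connected image avoids
  have hsub : A '' Ioo a b ⊆ β l '' Icc 0 1 := by
    by_contra hnot
    obtain ⟨w, hw, hwl⟩ := not_subset.1 hnot
    have hB : IsClosed (⋃ m : {m // m ≠ l}, β m '' Icc 0 1) :=
      isClosed_iUnion_of_finite fun m => hclosed m
    have hcov : A '' Ioo a b ⊆ β l '' Icc 0 1 ∪ ⋃ m : {m // m ≠ l}, β m '' Icc 0 1 := by
      intro z _
      obtain ⟨m, s, hs, rfl⟩ := h.cover z
      by_cases hm : m = l
      · subst hm; exact Or.inl ⟨s, hs, rfl⟩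
      · exact Or.inr (mem_iUnion.2 ⟨⟨m, hm⟩, s, hs, rfl⟩)
    obtain ⟨z, ⟨t, ht, rfl⟩, ⟨s, hs, hz⟩, hz'⟩ := isPreconnected_closed_iff.1 hpre _ _ (hclosed l) hB
      hcov ⟨_, ⟨_, ht₀, rfl⟩, ⟨s₀, hs₀, hl⟩⟩ ⟨w, hw, (hcov hw).resolve_left hwl⟩
    obtain ⟨⟨m, hm⟩, s', hs', hz'⟩ := mem_iUnion.1 hz'
    rcases (h.meet m l hm s' hs' s hs (hz'.trans hz.symm)).2 with rfl | rfl
    · exact (hends t ht l).1 hz.symm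
    · exact (hends t ht l).2 hz.symm
  have hsub' : A '' Icc a b ⊆ β l '' Icc 0 1 := by
    have h1 : closure (Ioo a b) = Icc a b := closure_Ioo hab.ne
    have h2 := ContinuousOn.image_closure (f := A) (s := Ioo a b) (by rwa [h1])
    rw [h1] at h2
    exact h2.trans ((hclosed l).closure_subset_iff.2 hsub)
  set m : ℝ → ℝ := fun t => Function.invFunOn (β l) (Icc 0 1) (A t)
  have hm : ∀ t ∈ Icc a b, m t ∈ Icc (0 : ℝ) 1 := fun t ht =>
    Function.invFunOn_mem (hsub' (mem_image_of_mem A ht))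
  have hβm : ∀ t ∈ Icc a b, β l (m t) = A t := fun t ht =>
    Function.invFunOn_eq (hsub' (mem_image_of_mem A ht))
  have hmc : ContinuousOn m (Icc a b) := by
    intro t ht
    refine tendsto_nhds.2 fun O hO hmO => ?_
    have hev := (h.arc l).eventually_mem hO (z := A t) fun s hs hst => by
      have : s = m t := (h.arc l).injOn hs (hm t ht) (hst.trans (hβm t ht).symm)
      rw [this]; exact hmO
    filter_upwards [(hA t ht).eventually hev, self_mem_nhdsWithin] with t' ht' hmem
    exact ht' (m t') (hm t' hmem) (hβm t' hmem)
  have hmi : InjOn m (Icc a b) := fun s hs t ht hst => hinj hs ht (by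
    rw [← hβm s hs, ← hβm t ht, hst])
  have ha : a ∈ Icc a b := left_mem_Icc.2 hab.le
  have hb : b ∈ Icc a b := right_mem_Icc.2 hab.le
  have himage : m '' Icc a b = uIcc (m a) (m b) := by
    refine Subset.antisymm ?_ ?_
    · rintro _ ⟨t, ht, rfl⟩
      rcases ContinuousOn.strictMonoOn_of_injOn_Icc' hab.le hmc hmi with hmono | hanti
      · exact mem_uIcc.2 (Or.inl ⟨hmono.monotoneOn ha ht ht.1, hmono.monotoneOn ht hb ht.2⟩)
      · exact mem_uIcc.2 (Or.inr ⟨hanti.antitoneOn ht hb ht.2, hanti.antitoneOn ha ht ht.1⟩)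
    · have := intermediate_value_uIcc (a := a) (b := b) (f := m) (by rwa [uIcc_of_le hab.le])
      rwa [uIcc_of_le hab.le] at this
  refine ⟨l, m a, hm a ha, m b, hm b hb, fun he => hab.ne (hmi ha hb he), hβm a ha, hβm b hb, ?_⟩
  rw [← himage, image_image]
  exact image_congr fun t ht => hβm t ht

/-- Homeomorphic sets that are decomposed into arcs have decompositions with the same
coincidences. The first set is subdivided at its own vertices and at the preimages of the vertices
of the second one. -/
theorem ArcSystem.exists_algEquiv_of_homeomorph {σ τ : Set ℂ} {K L : Type} [Finite K] [Finite L]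
    {α : K → ℝ → σ} {β : L → ℝ → τ} (hα : ArcSystem α) (hβ : ArcSystem β) (h : σ ≃ₜ τ) :
    ∃ Φ : AC σ ≃ₐ[ℂ] AC τ, Continuous Φ ∧ Continuous Φ.symm := by
  set V : Set σ := ((⋃ k, {α k 0, α k 1}) ∪ ⋃ l, {h.symm (β l 0), h.symm (β l 1)}) with hV
  have hVfin : V.Finite := (finite_iUnion fun k => toFinite _).union
    (finite_iUnion fun l => toFinite _)
  have hVα : ∀ k s, (s = 0 ∨ s = 1) → α k s ∈ V := by
    rintro k s (rfl | rfl)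
    · exact Or.inl (mem_iUnion.2 ⟨k, Or.inl rfl⟩)
    · exact Or.inl (mem_iUnion.2 ⟨k, Or.inr rfl⟩)
  have hVβ : ∀ z l, (h z = β l 0 ∨ h z = β l 1) → z ∈ V := by
    rintro z l (hz | hz)
    · exact Or.inr (mem_iUnion.2 ⟨l, Or.inl (by rw [← hz, h.symm_apply_apply])⟩)
    · exact Or.inr (mem_iUnion.2 ⟨l, Or.inr (by rw [← hz, h.symm_apply_apply]; rfl)⟩)
  set T : K → Set ℝ := fun k => {t | t ∈ Icc (0 : ℝ) 1 ∧ α k t ∈ V}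
  have hTfin : ∀ k, (T k).Finite := fun k => by
    refine Set.Finite.of_finite_image (f := α k) (hVfin.subset ?_) fun s hs t ht hst =>
      (hα.arc k).injOn hs.1 ht.1 hst
    rintro _ ⟨t, ht, rfl⟩
    exact ht.2
  have hT0 : ∀ k, (0 : ℝ) ∈ T k := fun k => ⟨left_mem_Icc.2 zero_le_one, hVα k 0 (Or.inl rfl)⟩
  have hT1 : ∀ k, (1 : ℝ) ∈ T k := fun k => ⟨right_mem_Icc.2 zero_le_one, hVα k 1 (Or.inr rfl)⟩
  -- the pieces of the subdivision: pairs of consecutive parameters of points of `V`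
  set 𝒥 : Set (K × ℝ × ℝ) := {x | x.2.1 ∈ T x.1 ∧ x.2.2 ∈ T x.1 ∧ x.2.1 < x.2.2 ∧
    ∀ c ∈ T x.1, ¬ (x.2.1 < c ∧ c < x.2.2)}
  have h𝒥fin : 𝒥.Finite := by
    refine Set.Finite.subset (finite_iUnion fun k : K =>
      (finite_singleton k).prod ((hTfin k).prod (hTfin k))) ?_
    rintro ⟨k, a, b⟩ ⟨h1, h2, -, -⟩
    exact mem_iUnion.2 ⟨k, rfl, h1, h2⟩
  have := h𝒥fin.fintype
  set κ : 𝒥 → K := fun j => j.1.1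
  set a : 𝒥 → ℝ := fun j => j.1.2.1
  set b : 𝒥 → ℝ := fun j => j.1.2.2
  have haT : ∀ j, a j ∈ T (κ j) := fun j => j.2.1
  have hbT : ∀ j, b j ∈ T (κ j) := fun j => j.2.2.1
  have hab : ∀ j, a j < b j := fun j => j.2.2.2.1
  have hcons : ∀ j, ∀ c ∈ T (κ j), ¬ (a j < c ∧ c < b j) := fun j => j.2.2.2.2
  have hIcc : ∀ j, Icc (a j) (b j) ⊆ Icc 0 1 := fun j => Icc_subset_Icc (haT j).1.1 (hbT j).1.2
  have hTmem : ∀ j, ∀ s ∈ Icc (a j) (b j), α (κ j) s ∈ V → s = a j ∨ s = b j := by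
    intro j s hs hsV
    by_contra! hne
    exact hcons j s ⟨hIcc j hs, hsV⟩ ⟨lt_of_le_of_ne hs.1 hne.1.symm, lt_of_le_of_ne hs.2 hne.2⟩
  have hcover : ∀ z, ∃ j, ∃ s ∈ Icc (a j) (b j), α (κ j) s = z := by
    intro z
    obtain ⟨k, t, ht, rfl⟩ := hα.cover z
    have piece : ∀ t ∈ Ico (0 : ℝ) 1, ∃ x y, x ∈ T k ∧ y ∈ T k ∧ x ≤ t ∧ t < y ∧
        ∀ c ∈ T k, ¬ (x < c ∧ c < y) := by
      intro t ht
      obtain ⟨x, hx, hxmax⟩ := Set.exists_max_image (T k ∩ Iic t) id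
        ((hTfin k).subset inter_subset_left) ⟨0, hT0 k, ht.1⟩
      obtain ⟨y, hy, hymin⟩ := Set.exists_min_image (T k ∩ Ioi t) id
        ((hTfin k).subset inter_subset_left) ⟨1, hT1 k, ht.2⟩
      refine ⟨x, y, hx.1, hy.1, hx.2, hy.2, fun c hc hxy => ?_⟩
      rcases le_or_gt c t with hct | hct
      · exact absurd (hxmax c ⟨hc, hct⟩) (not_le.2 hxy.1)
      · exact absurd (hymin c ⟨hc, hct⟩) (not_le.2 hxy.2)
    rcases ht.2.lt_or_eq with h1 | rfl
    · obtain ⟨x, y, hx, hy, hxt, hty, hxy⟩ := piece t ⟨ht.1, h1⟩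
      exact ⟨⟨(k, x, y), hx, hy, hxt.trans_lt hty, hxy⟩, t, ⟨hxt, hty.le⟩, rfl⟩
    · obtain ⟨x, hx, hxmax⟩ := Set.exists_max_image (T k ∩ Iio 1) id
        ((hTfin k).subset inter_subset_left) ⟨0, hT0 k, mem_Iio.2 zero_lt_one⟩
      have hx1 : x < 1 := hx.2
      exact ⟨⟨(k, x, 1), hx.1, hT1 k, hx1, fun c hc hxc =>
        absurd (hxmax c ⟨hc, hxc.2⟩) (not_le.2 hxc.1)⟩, 1, ⟨hx1.le, le_rfl⟩, rfl⟩
  have hmeet : ∀ j k, j ≠ k → ∀ s ∈ Icc (a j) (b j), ∀ t ∈ Icc (a k) (b k),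
      α (κ j) s = α (κ k) t → (s = a j ∨ s = b j) ∧ (t = a k ∨ t = b k) := by
    intro j k hjk s hs t ht hst
    suffices hsV : α (κ j) s ∈ V from ⟨hTmem j s hs hsV, hTmem k t ht (hst ▸ hsV)⟩
    by_contra hsV
    have hκ : κ j = κ k := by
      by_contra hκ
      exact hsV (hVα _ _ (hα.meet _ _ hκ s (hIcc j hs) t (hIcc k ht) hst).1)
    have hst' : s = t := (hα.arc (κ j)).injOn (hIcc j hs) (hIcc k ht) (by rw [hst, hκ])
    subst hst'
    have strict : ∀ i, s ∈ Icc (a i) (b i) → κ i = κ j → a i < s ∧ s < b i := by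
      intro i hi hij
      refine ⟨lt_of_le_of_ne hi.1 fun he => hsV ?_, lt_of_le_of_ne hi.2 fun he => hsV ?_⟩
      · rw [← hij, ← he]; exact (haT i).2
      · rw [← hij, he]; exact (hbT i).2
    obtain ⟨j1, j2⟩ := strict j hs rfl
    obtain ⟨k1, k2⟩ := strict k ht hκ.symm
    have e1 : a j = a k := by
      rcases lt_trichotomy (a j) (a k) with hlt | heq | hlt
      · exact absurd ⟨hlt, k1.trans j2⟩ (hcons j _ (hκ ▸ haT k))
      · exact heq
      · exact absurd ⟨hlt, j1.trans k2⟩ (hcons k _ (hκ ▸ haT j))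
    have e2 : b j = b k := by
      rcases lt_trichotomy (b j) (b k) with hlt | heq | hlt
      · exact absurd ⟨k1.trans j2, hlt⟩ (hcons k _ (hκ ▸ hbT j))
      · exact heq
      · exact absurd ⟨j1.trans k2, hlt⟩ (hcons j _ (hκ ▸ hbT k))
    exact hjk (Subtype.ext (Prod.ext hκ (Prod.ext e1 e2)))
  have himg : ∀ j : 𝒥, ∃ l, ∃ p ∈ Icc (0 : ℝ) 1, ∃ q ∈ Icc (0 : ℝ) 1, p ≠ q ∧
      β l p = h (α (κ j) (a j)) ∧ β l q = h (α (κ j) (b j)) ∧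
      β l '' uIcc p q = (fun t => h (α (κ j) t)) '' Icc (a j) (b j) := fun j =>
    hβ.exists_image_subarc (A := fun t => h (α (κ j) t)) (hab j)
      (h.continuous.comp_continuousOn ((hα.arc _).continuousOn.mono (hIcc j)))
      (fun s hs t ht hst => (hα.arc _).injOn (hIcc j hs) (hIcc j ht) (h.injective hst))
      (fun t ht l => by
        have hn : α (κ j) t ∉ V := fun hV => by
          rcases hTmem j t (Ioo_subset_Icc_self ht) hV with he | he
          · exact ht.1.ne' he
          · exact ht.2.ne he
        exact ⟨fun he => hn (hVβ _ l (Or.inl he)), fun he => hn (hVβ _ l (Or.inr he))⟩)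
  choose l p hp q hq hpq hβp hβq himg using himg
  have hsys : ArcSystem fun j t => α (κ j) (affineTo (a j) (b j) t) := by
    refine hα.subdivide (fun j => (haT j).1) (fun j => (hbT j).1) (fun j => (hab j).ne) ?_ ?_
    · intro z
      obtain ⟨j, s, hs, hz⟩ := hcover z
      exact ⟨j, s, by rwa [uIcc_of_le (hab j).le], hz⟩
    · intro j k hjk s hs t ht hst
      rw [uIcc_of_le (hab _).le] at hs ht
      exact hmeet j k hjk s hs t ht hst
  have hsys' : ArcSystem fun j t => β (l j) (affineTo (p j) (q j) t) := by
    refine hβ.subdivide hp hq hpq ?_ ?_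
    · intro w
      obtain ⟨j, s, hs, hz⟩ := hcover (h.symm w)
      have : w ∈ β (l j) '' uIcc (p j) (q j) := by
        rw [himg j]
        exact ⟨s, hs, by simp only [hz, h.apply_symm_apply]⟩
      obtain ⟨t, ht, htw⟩ := this
      exact ⟨j, t, ht, htw⟩
    · have aux : ∀ j, ∀ s ∈ uIcc (p j) (q j), ∀ r, (r = a j ∨ r = b j) →
          β (l j) s = h (α (κ j) r) → s = p j ∨ s = q j := by
        rintro j s hs r (rfl | rfl) hr
        · exact Or.inl ((hβ.arc _).injOn (uIcc_subset_unit (hp j) (hq j) hs) (hp j)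
            (hr.trans (hβp j).symm))
        · exact Or.inr ((hβ.arc _).injOn (uIcc_subset_unit (hp j) (hq j) hs) (hq j)
            (hr.trans (hβq j).symm))
      intro j k hjk s hs t ht hst
      have h1 : β (l j) s ∈ (fun t => h (α (κ j) t)) '' Icc (a j) (b j) :=
        himg j ▸ mem_image_of_mem _ hs
      have h2 : β (l k) t ∈ (fun t => h (α (κ k) t)) '' Icc (a k) (b k) :=
        himg k ▸ mem_image_of_mem _ ht
      obtain ⟨r, hr, hr'⟩ := h1
      obtain ⟨r', hr1, hr1'⟩ := h2
      obtain ⟨e1, e2⟩ := hmeet j k hjk r hr r' hr1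
        (h.injective (hr'.trans (hst.trans hr1'.symm)))
      exact ⟨aux j s hs r e1 hr'.symm, aux k t ht r' e2 hr1'.symm⟩
  refine hsys.exists_algEquiv hsys' fun j k s hs t ht => ?_
  -- corresponding arcs have corresponding ends, and only ends can coincide
  have hends : ∀ j s, (s = 0 ∨ s = 1) →
      β (l j) (affineTo (p j) (q j) s) = h (α (κ j) (affineTo (a j) (b j) s)) := by
    rintro j s (rfl | rfl)
    · rw [affineTo_zero, affineTo_zero, hβp]
    · rw [affineTo_one, affineTo_one, hβq]
  by_cases hjk : j = k
  · subst hjk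
    exact ⟨fun he => by rw [(hsys.arc j).injOn hs ht he],
      fun he => by rw [(hsys'.arc j).injOn hs ht he]⟩
  · constructor
    · intro he
      obtain ⟨h1, h2⟩ := hsys.meet j k hjk s hs t ht he
      rw [hends j s h1, hends k t h2, he]
    · intro he
      obtain ⟨h1, h2⟩ := hsys'.meet j k hjk s hs t ht he
      rw [hends j s h1, hends k t h2] at he
      exact h.injective he

/-! ### Differentiable convex curves are arcs -/

theorem hasDerivAt_inner_const {γ : ℝ → ℂ} {t : ℝ} (h : DifferentiableAt ℝ γ t) (w : ℂ) :
    HasDerivAt (fun s => inner ℝ w (γ s)) (inner ℝ w (deriv γ t)) t :=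
  (innerSL ℝ w).hasFDerivAt.comp_hasDerivAt t h.hasDerivAt

theorem continuousOn_inner_const {γ : ℝ → ℂ} {s : Set ℝ} (h : ContinuousOn γ s) (w : ℂ) :
    ContinuousOn (fun t => inner ℝ w (γ t)) s :=
  continuousOn_const.inner h

/-- Let `N` be an outer normal of a planar set at a point whose tangent direction there is `T`, and
let the points displaced by `x` and `y` also belong to the set. If the value of a linear functional
at the point is far from being extremal, then the functional is not small on `T`. -/
theorem le_abs_inner_of_support {u N T x y : ℂ} {η R : ℝ} (hN : N ≠ 0) (hT : ‖T‖ = 1)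
    (hNT : inner ℝ N T = 0) (hux : η ≤ inner ℝ u x) (huy : inner ℝ u y ≤ -η)
    (hNx : inner ℝ N x ≤ 0) (hNy : inner ℝ N y ≤ 0) (hx : ‖x‖ ≤ R) (hy : ‖y‖ ≤ R) :
    η ≤ |inner ℝ u T| * R := by
  have hT2 : T.re * T.re + T.im * T.im = 1 := by
    have := Complex.sq_norm T
    rw [hT, Complex.normSq_apply] at this
    linarith
  set ν : ℝ := -N.re * T.im + N.im * T.re with hν
  have hNT' := hNT
  rw [inner_eq_re_im] at hNT'
  have hNre : N.re = -ν * T.im := by rw [hν]; linear_combination T.re * hNT' - N.re * hT2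
  have hNim : N.im = ν * T.re := by rw [hν]; linear_combination T.im * hNT' - N.im * hT2
  have hν0 : ν ≠ 0 := fun h0 => hN (Complex.ext (by simp [hNre, h0]) (by simp [hNim, h0]))
  -- `u` is a combination of `T` and the normal `N`
  obtain ⟨β, hβ⟩ : ∃ β : ℝ, ∀ z : ℂ,
      inner ℝ u z = inner ℝ u T * inner ℝ T z + β * inner ℝ N z := by
    refine ⟨(-u.re * T.im + u.im * T.re) / ν, fun z => ?_⟩
    simp only [inner_eq_re_im]
    rw [hNre, hNim]
    field_simp
    linear_combination (-u.re * z.re - u.im * z.im) * hT2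
  have hb : ∀ z : ℂ, ‖z‖ ≤ R → |inner ℝ u T * inner ℝ T z| ≤ |inner ℝ u T| * R := fun z hz => by
    rw [abs_mul]
    refine mul_le_mul_of_nonneg_left ((abs_real_inner_le_norm T z).trans ?_) (abs_nonneg _)
    rw [hT, one_mul]
    exact hz
  rcases le_total 0 β with h0 | h0
  · have h1 := mul_nonpos_of_nonneg_of_nonpos h0 hNx
    have h2 := (le_abs_self _).trans (hb x hx)
    rw [hβ] at hux
    linarith
  · have h1 := mul_nonneg_of_nonpos_of_nonpos h0 hNy
    have h2 := (neg_le_abs _).trans (hb y hy)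
    rw [hβ] at huy
    linarith

section Curve

variable {L : ℝ} {γ : ℝ → ℂ}

/-- Near each parameter the tangent of a differentiable convex curve makes, with a suitable
direction, an angle bounded away from the right angle. -/
theorem exists_le_abs_inner_deriv (hL : 0 < L) (hc : ContinuousOn γ (Icc 0 L))
    (hinj : InjOn γ (Icc 0 L))
    (hd : ∀ t ∈ Ioo 0 L, DifferentiableAt ℝ γ t ∧ ‖deriv γ t‖ = 1)
    (hs : ∀ t ∈ Icc 0 L, ∃ u : ℂ, u ≠ 0 ∧ ∀ s ∈ Icc 0 L, inner ℝ u (γ s) ≤ inner ℝ u (γ t))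
    {t₀ : ℝ} (ht₀ : t₀ ∈ Icc 0 L) :
    ∃ u : ℂ, ∃ c > 0, ∃ δ > 0, ∀ t ∈ Ioo 0 L, |t - t₀| < δ → c ≤ |inner ℝ u (deriv γ t)| := by
  obtain ⟨t₁, ht₁, hne⟩ : ∃ t₁ ∈ Icc 0 L, t₁ ≠ t₀ := by
    by_cases h : t₀ = 0
    · exact ⟨L, right_mem_Icc.2 hL.le, by rw [h]; exact hL.ne'⟩
    · exact ⟨0, left_mem_Icc.2 hL.le, Ne.symm h⟩
  set d := γ t₁ - γ t₀ with hdd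
  have hd0 : d ≠ 0 := sub_ne_zero.2 fun h => hne (hinj ht₁ ht₀ h)
  by_cases hcol : ∀ s ∈ Icc 0 L, inner ℝ (Complex.I * d) (γ s - γ t₀) = 0
  · -- the curve is a line segment with direction `d`
    refine ⟨d, ‖d‖, norm_pos_iff.2 hd0, 1, one_pos, fun t ht _ => ?_⟩
    have h1 : inner ℝ (Complex.I * d) (deriv γ t) = 0 := by
      refine (hasDerivAt_inner_const (hd t ht).1 (Complex.I * d)).unique ?_
      refine (hasDerivAt_const t (inner ℝ (Complex.I * d) (γ t₀))).congr_of_eventuallyEq ?_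
      filter_upwards [Icc_mem_nhds ht.1 ht.2] with s hs'
      have := hcol s hs'
      rwa [inner_sub_right, sub_eq_zero] at this
    have h2 := Complex.sq_norm (deriv γ t)
    rw [(hd t ht).2, Complex.normSq_apply] at h2
    rw [inner_eq_re_im] at h1
    simp only [Complex.mul_re, Complex.mul_im, Complex.I_re, Complex.I_im] at h1
    have h3 : ‖d‖ ^ 2 ≤ (inner ℝ d (deriv γ t)) ^ 2 := by
      rw [Complex.sq_norm, Complex.normSq_apply, inner_eq_re_im]
      have h4 : (d.re * d.re + d.im * d.im) *
          ((deriv γ t).re * (deriv γ t).re + (deriv γ t).im * (deriv γ t).im) =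
          (d.re * (deriv γ t).re + d.im * (deriv γ t).im) ^ 2 := by
        linear_combination
          ((0 * d.re - 1 * d.im) * (deriv γ t).re + (0 * d.im + 1 * d.re) * (deriv γ t).im) * h1
      rw [← h4, ← h2]
      linarith
    simpa using sq_le_sq.1 h3
  · push Not at hcol
    obtain ⟨t₂, ht₂, hk⟩ := hcol
    set e := γ t₂ - γ t₀ with he
    set k := inner ℝ (Complex.I * d) e with hk'
    -- a functional whose value at `γ t₀` is strictly between those at `γ t₁` and `γ t₂`
    set u : ℂ := -(k : ℂ) * (Complex.I * (d + e)) with hu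
    have hud : inner ℝ u d = k ^ 2 := by
      rw [hu, hk', inner_eq_re_im, inner_eq_re_im]
      simp
      ring
    have hue : inner ℝ u e = -k ^ 2 := by
      rw [hu, hk', inner_eq_re_im, inner_eq_re_im]
      simp
      ring
    have hk2 : 0 < k ^ 2 := by positivity
    have hcu := continuousOn_inner_const hc u t₀ ht₀
    obtain ⟨δ, hδ, hδ'⟩ := Metric.continuousWithinAt_iff.1 hcu (k ^ 2 / 2) (by positivity)
    obtain ⟨R, hR⟩ := isBounded_iff_forall_norm_le.1 (isCompact_Icc.image_of_continuousOn hc).isBounded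
    have hR' : ∀ s ∈ Icc 0 L, ‖γ s‖ ≤ R := fun s hs' => hR _ (mem_image_of_mem γ hs')
    have hR0 : 0 ≤ R := (norm_nonneg _).trans (hR' t₀ ht₀)
    refine ⟨u, k ^ 2 / 2 / (R + R + 1), by positivity, δ, hδ, fun t ht htδ => ?_⟩
    have ht' := Ioo_subset_Icc_self ht
    obtain ⟨N, hN, hNs⟩ := hs t ht'
    have hmax : IsLocalMax (fun s => inner ℝ N (γ s)) t := by
      filter_upwards [Icc_mem_nhds ht.1 ht.2] with s hs' using hNs s hs'
    have hNT := hmax.hasDerivAt_eq_zero (hasDerivAt_inner_const (hd t ht).1 N)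
    have h1 := hδ' ht' (by rwa [Real.dist_eq])
    rw [Real.dist_eq, abs_lt] at h1
    rw [hdd, inner_sub_right] at hud
    rw [he, inner_sub_right] at hue
    have hb : ∀ s ∈ Icc 0 L, ‖γ s - γ t‖ ≤ R + R + 1 := fun s hs' =>
      (norm_sub_le _ _).trans (by linarith [hR' s hs', hR' t ht'])
    rw [div_le_iff₀ (by positivity)]
    refine le_abs_inner_of_support (x := γ t₁ - γ t) (y := γ t₂ - γ t) hN (hd t ht).2 hNT
      ?_ ?_ ?_ ?_ (hb _ ht₁) (hb _ ht₂) <;> rw [inner_sub_right]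
    · linarith
    · linarith
    · linarith [hNs t₁ ht₁]
    · linarith [hNs t₂ ht₂]

/-- By Darboux's theorem the derivative of a differentiable convex curve keeps its sign in a
direction in which it does not vanish, so that locally the curve is a graph over this direction. -/
theorem exists_chart (hL : 0 < L) (hc : ContinuousOn γ (Icc 0 L)) (hinj : InjOn γ (Icc 0 L))
    (hd : ∀ t ∈ Ioo 0 L, DifferentiableAt ℝ γ t ∧ ‖deriv γ t‖ = 1)
    (hs : ∀ t ∈ Icc 0 L, ∃ u : ℂ, u ≠ 0 ∧ ∀ s ∈ Icc 0 L, inner ℝ u (γ s) ≤ inner ℝ u (γ t))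
    {t₀ : ℝ} (ht₀ : t₀ ∈ Icc 0 L) :
    ∃ u : ℂ, ∃ c > 0, ∃ δ > 0, ∀ s ∈ Icc 0 L, ∀ t ∈ Icc 0 L, |s - t₀| < δ → |t - t₀| < δ →
      s ≤ t → c * (t - s) ≤ inner ℝ u (γ t) - inner ℝ u (γ s) := by
  obtain ⟨u, c, hc0, δ, hδ, h⟩ := exists_le_abs_inner_deriv hL hc hinj hd hs ht₀
  set S := Ioo 0 L ∩ Ioo (t₀ - δ) (t₀ + δ) with hS
  have hSmem : ∀ t ∈ S, t ∈ Ioo 0 L ∧ |t - t₀| < δ := fun t ht =>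
    ⟨ht.1, abs_lt.2 ⟨by linarith [ht.2.1], by linarith [ht.2.2]⟩⟩
  have hdar := hasDerivWithinAt_forall_lt_or_forall_gt_of_forall_ne
    ((convex_Ioo 0 L).inter (convex_Ioo (t₀ - δ) (t₀ + δ)))
    (f := fun t => inner ℝ u (γ t)) (f' := fun t => inner ℝ u (deriv γ t)) (m := 0)
    (fun t ht => (hasDerivAt_inner_const (hd t ht.1).1 u).hasDerivWithinAt)
    (fun t ht h0 => by
      have := h t (hSmem t ht).1 (hSmem t ht).2
      rw [h0, abs_zero] at this
      linarith)
  obtain ⟨v, hv⟩ : ∃ v : ℂ, ∀ t ∈ S, c ≤ inner ℝ v (deriv γ t) := by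
    rcases hdar with h1 | h1
    · refine ⟨-u, fun t ht => ?_⟩
      have := h t (hSmem t ht).1 (hSmem t ht).2
      rwa [abs_of_neg (h1 t ht), ← inner_neg_left] at this
    · refine ⟨u, fun t ht => ?_⟩
      have := h t (hSmem t ht).1 (hSmem t ht).2
      rwa [abs_of_pos (h1 t ht)] at this
  refine ⟨v, c, hc0, δ, hδ, fun s hs' t ht' hsδ htδ hst => ?_⟩
  rw [abs_lt] at hsδ htδ
  have hint : interior (Icc 0 L ∩ Ioo (t₀ - δ) (t₀ + δ)) = S := by
    rw [interior_inter, interior_Icc, interior_Ioo]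
  refine ((convex_Icc 0 L).inter (convex_Ioo (t₀ - δ) (t₀ + δ))).mul_sub_le_image_sub_of_le_deriv
    (f := fun t => inner ℝ v (γ t)) (continuousOn_inner_const (hc.mono inter_subset_left) v)
    ?_ ?_ s ⟨hs', by constructor <;> linarith⟩ t ⟨ht', by constructor <;> linarith⟩ hst
  · rw [hint]
    exact fun r hr => (hasDerivAt_inner_const (hd r hr.1).1 v).differentiableAt.differentiableWithinAt
  · rw [hint]
    intro r hr
    rw [(hasDerivAt_inner_const (hd r hr.1).1 v).deriv]
    exact hv r hr

theorem lipschitzOnWith_of_norm_deriv_eq_one (hL : 0 < L) (hc : ContinuousOn γ (Icc 0 L))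
    (hd : ∀ t ∈ Ioo 0 L, DifferentiableAt ℝ γ t ∧ ‖deriv γ t‖ = 1) :
    LipschitzOnWith 1 γ (Icc 0 L) := by
  rw [← closure_Ioo hL.ne] at hc ⊢
  refine (lipschitzOnWith_closure_iff hc).2 ?_
  refine (convex_Ioo 0 L).lipschitzOnWith_of_nnnorm_deriv_le (fun t ht => (hd t ht).1) fun t ht => ?_
  rw [← NNReal.coe_le_coe, coe_nnnorm, (hd t ht).2, NNReal.coe_one]

end Curve

/-- A differentiable convex curve, parametrized proportionally to arc length. -/
theorem IsDiffConvexCurve.exists_isArc {σ C : Set ℂ} {v w : ℂ} (h : IsDiffConvexCurve C v w)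
    (hC : C ⊆ σ) : ∃ α : ℝ → σ, IsArc α ∧ (fun t => (α t : ℂ)) '' Icc 0 1 = C ∧
      (α 0 : ℂ) = v ∧ (α 1 : ℂ) = w := by
  obtain ⟨L, γ, hL, hc, hinj, himg, h0, h1, hd, hs⟩ := h
  have hmem : ∀ t ∈ Icc (0 : ℝ) 1, L * t ∈ Icc 0 L := fun t ht =>
    ⟨mul_nonneg hL.le ht.1, by nlinarith [ht.2]⟩
  have hγC : ∀ t ∈ Icc 0 L, γ t ∈ C := fun t ht => himg ▸ mem_image_of_mem γ ht
  have hs' : ∀ t ∈ Icc 0 L, ∃ u : ℂ, u ≠ 0 ∧ ∀ s ∈ Icc 0 L, inner ℝ u (γ s) ≤ inner ℝ u (γ t) :=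
    fun t ht => by
      obtain ⟨u, hu, hu'⟩ := hs _ (hγC t ht)
      exact ⟨u, hu, fun s hs => hu' _ (hγC s hs)⟩
  have hproj : ∀ t : ℝ, L * projIcc (0 : ℝ) 1 zero_le_one t ∈ Icc 0 L := fun t => hmem _ (projIcc (0 : ℝ) 1 zero_le_one t).2
  let α : ℝ → σ := fun t => ⟨γ (L * projIcc (0 : ℝ) 1 zero_le_one t), hC (hγC _ (hproj t))⟩
  have hα : ∀ t ∈ Icc (0 : ℝ) 1, (α t : ℂ) = γ (L * t) := fun t ht => by
    simp only [α, projIcc_of_mem zero_le_one ht]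
  refine ⟨α, ⟨⟨Real.toNNReal L, ?_⟩, ?_, ?_, ?_⟩, ?_, ?_, ?_⟩
  · refine LipschitzOnWith.of_dist_le_mul fun s hs t ht => ?_
    rw [Subtype.dist_eq, hα s hs, hα t ht]
    refine ((lipschitzOnWith_of_norm_deriv_eq_one hL hc hd).dist_le_mul _ (hmem s hs) _
      (hmem t ht)).trans ?_
    rw [NNReal.coe_one, one_mul, Real.dist_eq, Real.dist_eq, ← mul_sub, abs_mul, abs_of_pos hL,
      Real.coe_toNNReal L hL.le]
  · intro s hs t ht hst
    have h2 : (α s : ℂ) = α t := congrArg _ hst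
    rw [hα s hs, hα t ht] at h2
    exact mul_left_cancel₀ hL.ne' (hinj (hmem s hs) (hmem t ht) h2)
  · intro t₀ ht₀
    obtain ⟨u, c, hc0, δ, hδ, h2⟩ := exists_chart hL hc hinj hd hs' (hmem t₀ ht₀)
    refine ⟨u, L * c, by positivity, δ / L, by positivity, fun s hs t ht hsδ htδ hst => ?_⟩
    rw [hα s hs, hα t ht]
    have h3 : ∀ r : ℝ, |r - t₀| < δ / L → |L * r - L * t₀| < δ := fun r hr => by
      rw [← mul_sub, abs_mul, abs_of_pos hL, mul_comm]
      exact (lt_div_iff₀ hL).1 hr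
    have h4 := h2 _ (hmem s hs) _ (hmem t ht) (h3 s hsδ) (h3 t htδ)
      (mul_le_mul_of_nonneg_left hst hL.le)
    linarith
  · intro t ht
    obtain ⟨u, hu, hu'⟩ := hs' _ (hmem t ht)
    refine ⟨u, hu, fun s hs => ?_⟩
    rw [hα s hs, hα t ht]
    exact hu' _ (hmem s hs)
  · rw [← himg]
    ext z
    constructor
    · rintro ⟨t, ht, rfl⟩
      exact ⟨L * t, hmem t ht, (hα t ht).symm⟩
    · rintro ⟨t, ht, rfl⟩
      have h2 : t / L ∈ Icc (0 : ℝ) 1 := ⟨div_nonneg ht.1 hL.le, (div_le_one hL).2 ht.2⟩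
      exact ⟨t / L, h2, by simp only [hα _ h2]; rw [mul_div_cancel₀ _ hL.ne']⟩
  · rw [hα 0 (left_mem_Icc.2 zero_le_one), mul_zero, h0]
  · rw [hα 1 (right_mem_Icc.2 zero_le_one), mul_one, h1]

/-! ### Polygonally inscribed curves are systems of arcs -/

theorem IsConvexPolygon.convex {P : Set ℂ} (h : IsConvexPolygon P) : Convex ℝ P := by
  obtain ⟨-, s, -, rfl⟩ := h
  exact convex_convexHull ℝ s

theorem IsPolygonalMosaic.inter_subset_frontier {𝓜 : Set (Set ℂ)} (h : IsPolygonalMosaic 𝓜)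
    {P Q : Set ℂ} (hP : P ∈ 𝓜) (hQ : Q ∈ 𝓜) (hPQ : P ≠ Q) : P ∩ Q ⊆ frontier P := by
  intro z hz
  rcases h.inter P hP Q hQ hPQ ⟨z, hz⟩ with ⟨v, hv, -, hPv⟩ | ⟨⟨_, _, _, _, _, _, hs⟩, -⟩
  · have hzv : z = v := by rwa [hPv] at hz
    rw [hzv] at hz ⊢
    exact ⟨subset_closure hz.1, fun hi => (disjoint_interior_extremePoints P).le_bot ⟨hi, hv⟩⟩
  · exact hs hz

/-- Two polygons of a mosaic lie on opposite sides of a line that contains their intersection. -/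
theorem IsPolygonalMosaic.exists_separating_line {𝓜 : Set (Set ℂ)} (h : IsPolygonalMosaic 𝓜)
    {P Q : Set ℂ} (hP : P ∈ 𝓜) (hQ : Q ∈ 𝓜) (hPQ : P ≠ Q) :
    ∃ u : ℂ, u ≠ 0 ∧ ∃ c : ℝ, (∀ z ∈ interior P, lineFun u c z < 0) ∧
      (∀ z ∈ interior Q, 0 < lineFun u c z) ∧ ∀ z ∈ P ∩ Q, lineFun u c z = 0 := by
  have hPp := h.isConvexPolygon P hP
  have hQp := h.isConvexPolygon Q hQ
  have hdisj : Disjoint (interior P) (interior Q) := disjoint_left.2 fun z hz hz' =>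
    (h.inter_subset_frontier hP hQ hPQ ⟨interior_subset hz, interior_subset hz'⟩).2 hz
  obtain ⟨f, c, hfP, hfQ⟩ := geometric_hahn_banach_open_open hPp.convex.interior isOpen_interior
    hQp.convex.interior isOpen_interior hdisj
  set u : ℂ := (InnerProductSpace.toDual ℝ ℂ).symm f with hu
  have hf : ∀ z, inner ℝ u z = f z := fun z => InnerProductSpace.toDual_symm_apply
  have hcl : ∀ {R : Set ℂ}, IsConvexPolygon R → R ⊆ closure (interior R) := fun hR => by
    rw [hR.convex.closure_interior_eq_closure_of_nonempty_interior hR.1]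
    exact subset_closure
  refine ⟨u, fun h0 => ?_, c, fun z hz => ?_, fun z hz => ?_, fun z hz => ?_⟩
  · obtain ⟨p, hp⟩ := hPp.1
    obtain ⟨q, hq⟩ := hQp.1
    have h1 := hfP p hp
    have h2 := hfQ q hq
    rw [← hf, h0, inner_zero_left] at h1 h2
    linarith
  · rw [lineFun, hf]
    exact sub_neg.2 (hfP z hz)
  · rw [lineFun, hf]
    exact sub_pos.2 (hfQ z hz)
  · rw [lineFun, hf, sub_eq_zero]
    exact le_antisymm
      (closure_minimal (fun z hz => (hfP z hz).le) (isClosed_le f.continuous continuous_const)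
        (hcl hPp hz.1))
      (closure_minimal (fun z hz => (hfQ z hz).le) (isClosed_le continuous_const f.continuous)
        (hcl hQp hz.2))

theorem IsPIC.exists_arcSystem {σ : Set ℂ} (h : IsPIC σ) :
    ∃ (K : Type) (_ : Finite K) (α : K → ℝ → σ), ArcSystem α := by
  obtain ⟨-, -, 𝓜, h𝓜, hσ, hcurve⟩ := h
  have key : ∀ P : 𝓜, ∃ α : ℝ → σ, IsArc α ∧ (fun t => (α t : ℂ)) '' Icc 0 1 = σ ∩ P ∧
      ∀ t ∈ Icc (0 : ℝ) 1, (t = 0 ∨ t = 1) ∨ (α t : ℂ) ∈ interior (P : Set ℂ) := by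
    intro P
    obtain ⟨v, -, w, -, hC, hfr⟩ := hcurve P P.2
    obtain ⟨α, hα, himg, h0, h1⟩ := hC.exists_isArc inter_subset_left
    refine ⟨α, hα, himg, fun t ht => ?_⟩
    by_contra! hcon
    have hm : (α t : ℂ) ∈ σ ∩ P := himg ▸ mem_image_of_mem _ ht
    have hm' : (α t : ℂ) ∈ σ ∩ frontier P := ⟨hm.1, subset_closure hm.2, hcon.2⟩
    rw [hfr, ← h0, ← h1] at hm'
    rcases hm' with hm' | hm'
    · exact hcon.1.1 (hα.injOn ht (left_mem_Icc.2 zero_le_one) (Subtype.ext hm'))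
    · exact hcon.1.2 (hα.injOn ht (right_mem_Icc.2 zero_le_one) (Subtype.ext hm'))
  choose α hα himg hint using key
  have hmem : ∀ P : 𝓜, ∀ t ∈ Icc (0 : ℝ) 1, (α P t : ℂ) ∈ (P : Set ℂ) := fun P t ht =>
    ((himg P).subset (mem_image_of_mem _ ht)).2
  have hends : ∀ P Q : 𝓜, P ≠ Q → ∀ s ∈ Icc (0 : ℝ) 1, (α P s : ℂ) ∈ (Q : Set ℂ) →
      s = 0 ∨ s = 1 := fun P Q hPQ s hs hQ =>
    (hint P s hs).resolve_right (h𝓜.inter_subset_frontier P.2 Q.2 (Subtype.coe_ne_coe.2 hPQ)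
      ⟨hmem P s hs, hQ⟩).2
  -- near an end of an arc the other points of the arc are interior to its polygon
  have hnear : ∀ P : 𝓜, ∀ s : ℝ, (s = 0 ∨ s = 1) → ∀ᶠ s' in 𝓝[Icc 0 1] s, s' ≠ s →
      (α P s' : ℂ) ∈ interior (P : Set ℂ) := by
    intro P s hs
    filter_upwards [self_mem_nhdsWithin, mem_nhdsWithin_of_mem_nhds (Metric.ball_mem_nhds s one_pos)]
      with s' hs' hb hne
    rw [Metric.mem_ball, Real.dist_eq, abs_lt] at hb
    refine (hint P s' hs').resolve_left ?_
    rintro (rfl | rfl) <;> rcases hs with rfl | rfl <;>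
      first | exact hne rfl | norm_num at hb
  refine ⟨𝓜, h𝓜.finite.to_subtype, α, hα, ?_, ?_, ?_⟩
  · intro z
    obtain ⟨P, hP, hz⟩ := hσ z.2
    obtain ⟨t, ht, htz⟩ := (himg ⟨P, hP⟩).superset ⟨z.2, hz⟩
    exact ⟨⟨P, hP⟩, t, ht, Subtype.ext htz⟩
  · intro P Q hPQ s hs t ht hst
    exact ⟨hends P Q hPQ s hs (hst ▸ hmem Q t ht), hends Q P hPQ.symm t ht (hst ▸ hmem P s hs)⟩
  · intro P Q hPQ s hs t ht hst
    have hQ : (α P s : ℂ) ∈ (Q : Set ℂ) := hst ▸ hmem Q t ht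
    have hP : (α Q t : ℂ) ∈ (P : Set ℂ) := hst ▸ hmem P s hs
    obtain ⟨u, hu, c, h1, h2, h3⟩ :=
      h𝓜.exists_separating_line P.2 Q.2 (Subtype.coe_ne_coe.2 hPQ)
    refine ⟨u, hu, c, h3 _ ⟨hmem P s hs, hQ⟩, ?_, ?_⟩
    · filter_upwards [hnear P s (hends P Q hPQ s hs hQ)] with s' hs' hne using h1 _ (hs' hne)
    · filter_upwards [hnear Q t (hends Q P hPQ.symm t ht hP)] with t' ht' hne using h2 _ (ht' hne)

theorem IsArc.inclusion {σ τ : Set ℂ} {α : ℝ → σ} (h : IsArc α) (hστ : σ ⊆ τ) :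
    IsArc fun t => Set.inclusion hστ (α t) where
  lipschitz := h.lipschitz
  injOn _ hs _ ht hst := h.injOn hs ht (inclusion_injective hστ hst)
  chart := h.chart
  support := h.support

theorem ArcSystem.iUnion {M : Type} {s : M → Set ℂ} (hs : Pairwise fun m k => Disjoint (s m) (s k))
    {K : M → Type} {α : ∀ m, K m → ℝ → s m} (h : ∀ m, ArcSystem (α m)) :
    ArcSystem fun (j : Σ m, K m) t => Set.inclusion (subset_iUnion s j.1) (α j.1 j.2 t) where
  arc j := ((h j.1).arc j.2).inclusion _
  cover z := by
    obtain ⟨m, hm⟩ := mem_iUnion.1 z.2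
    obtain ⟨k, t, ht, hkt⟩ := (h m).cover ⟨z, hm⟩
    exact ⟨⟨m, k⟩, t, ht, Subtype.ext (congrArg (Subtype.val : s m → ℂ) hkt)⟩
  meet := by
    rintro ⟨m, j⟩ ⟨l, k⟩ hne x hx y hy hxy
    have hxy' : (α m j x : ℂ) = α l k y := congrArg (Subtype.val : (⋃ m, s m : Set ℂ) → ℂ) hxy
    obtain rfl : m = l := by
      by_contra hml
      exact disjoint_left.1 (hs hml) (α m j x).2 (hxy' ▸ (α l k y).2)
    exact (h m).meet j k (fun hjk => hne (by rw [hjk])) x hx y hy (Subtype.ext hxy')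
  sep := by
    rintro ⟨m, j⟩ ⟨l, k⟩ hne x hx y hy hxy
    have hxy' : (α m j x : ℂ) = α l k y := congrArg (Subtype.val : (⋃ m, s m : Set ℂ) → ℂ) hxy
    obtain rfl : m = l := by
      by_contra hml
      exact disjoint_left.1 (hs hml) (α m j x).2 (hxy' ▸ (α l k y).2)
    exact (h m).sep j k (fun hjk => hne (by rw [hjk])) x hx y hy (Subtype.ext hxy')

theorem IsUPIC.exists_arcSystem {σ : Set ℂ} (h : IsUPIC σ) :
    ∃ (K : Type) (_ : Finite K) (α : K → ℝ → σ), ArcSystem α := by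
  obtain ⟨M, s, -, hs, hdisj, rfl⟩ := h
  choose K hK α hα using fun m => (hs m).exists_arcSystem
  exact ⟨Σ m, K m, inferInstance, _, ArcSystem.iUnion hdisj hα⟩

theorem IsUPIC.nonempty {σ : Set ℂ} (h : IsUPIC σ) : σ.Nonempty := by
  obtain ⟨M, s, hM, hs, -, rfl⟩ := h
  exact (hs ⟨0, hM⟩).2.1.nonempty.mono (subset_iUnion s _)

end PlanarAC

theorem mainTheorem2 (σ τ : Set ℂ) (hσ : PlanarAC.IsUPIC σ) (hτ : PlanarAC.IsUPIC τ) :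
    (∃ Φ : PlanarAC.AC σ ≃ₐ[ℂ] PlanarAC.AC τ, Continuous Φ ∧ Continuous Φ.symm) ↔
      Nonempty (σ ≃ₜ τ) := by
  obtain ⟨K, _, α, hα⟩ := hσ.exists_arcSystem
  obtain ⟨L, _, β, hβ⟩ := hτ.exists_arcSystem
  constructor
  · rintro ⟨Φ, hΦ, hΦ'⟩
    exact PlanarAC.nonempty_homeomorph_of_algEquiv hα.isCompact hβ.isCompact hσ.nonempty
      hτ.nonempty Φ hΦ hΦ'
  · rintro ⟨h⟩
    exact hα.exists_algEquiv_of_homeomorph hβ h
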